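/- **Conventions.** Let $\mathbb R^{n+1,1}$ be Minkowski space with inner product $\langle\cdot,\cdot\rangle$ of signature $(n+1,1)$, extended complex bilinearly to its complexification. A point $x\in S^n$ corresponds to the null line spanned by $(1,x)$, and a 2-sphere in $S^n$ to a 4-dimensional subspace $W\subset\mathbb R^{n+1,1}$ of signature $(3,1)$. A smooth map $f:M\to S^n$ *envelops* a family $p\mapsto W(p)$ of 2-spheres if $F(p)\in W(p)$ and $dF(T_pM)\subset W(p)$ for all $p\in M$, where $F=(1,f)$. For a smooth conformal immersion $f:M\to S^n$ of a Riemann surface and a complex coordinate $z$, let $Y$ be the canonical lift, that is, the multiple of $F$ in the forward light cone with $|dY|^2=|dz|^2$. Let $V=\mathrm{span}\{Y,dY,Y_{z\bar z}\}$ (the mean curvature sphere) and let $N$ be the section of $V$ with $\langle N,N\rangle=0$, $\langle N,Y\rangle=-1$, $\langle N,Y_z\rangle=0$. Let $D$ be the normal connection on $V^\perp$ (differentiation followed by orthogonal projection to $V^\perp\otimes\mathbb C$), and let the Schwarzian $s$ and the Hopf differential $\kappa\in\Gamma(V^\perp\otimes\mathbb C)$ be defined by $Y_{zz}=-\frac s2Y+\kappa$.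 * $f$ is *isothermic* with curvature line coordinate $z$ if $\kappa$ is real in the coordinate $z$. * $f$ is *Willmore* if $D_{\bar z}D_{\bar z}\kappa+\frac{\bar s}{2}\kappa=0$, and *S-Willmore* if moreover $\kappa$ and $D_{\bar z}\kappa$ are linearly dependent over $\mathbb C$ at every point. * $(f,\hat f)$ is a *Darboux pair of isothermic surfaces* (in the coordinate $z$) if both are isothermic with common curvature line coordinate $z$ and, for some real $r\neq0$, the null line of $\hat f$ is parallel for the connection $d+r\,\eta$ with $\eta=Y\wedge(Y_{\bar z}\,dz+Y_z\,d\bar z)$, where $(a\wedge b)c=\langle a,c\rangle b-\langle b,c\rangle a$. * $(f,\hat f)$ is an *S-Willmore surface with its dual* if $f$ is S-Willmore and $\hat f$ is the point of $S^n$ represented by $\frac{|\mu|^2}{2}Y+\bar\mu Y_z+\mu Y_{\bar z}+N$ for a function $\mu$ with $D_{\bar z}\kappa+\frac{\bar\mu}{2}\kappa=0$, and moreover $\hat f$ is also S-Willmore and has the same mean curvature spheres as $f$. * If $f,\hat f$ envelop a common family of 2-spheres $W$ and $f(p)\ne\hat f(p)$, then with $z=u+iv$, $\hat F=(1,\hat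 f)$, the bases $(F,F_u,F_v,\hat F)$ and $(\hat F,\hat F_u,\hat F_v,F)$ of $W(p)$ give the orientations of the sphere $W(p)$ induced by $f$ and by $\hat f$. The correspondence $f(p)\mapsto\hat f(p)$ is *orientation preserving* at $p$ if the two orientations agree and *orientation reversing* (that is, anti-conformal, since it preserves angles) if they are opposite. **Theorem.** Let $M$ be a Riemann surface and let $f,\hat f:M\to S^n$ be smooth conformal immersions that envelop a common family of 2-spheres. Then every $p\in M$ with $f(p)\ne\hat f(p)$ has a neighborhood $U$ with a complex coordinate $z$ on which at least one of the following holds: 0. (trivial case) there is a fixed vector $X\in\mathbb R^{n+1,1}$ with $\langle X,X\rangle\neq0$ such that $\hat f|_U$ is the image of $f|_U$ under the Möbius transformation of $S^n$ induced by the reflection $y\mapsto y-\frac{2\langle y,X\rangle}{\langle X,X\rangle}X$; 1. $(f,\hat f)$ is a Darboux pair of isothermic surfaces on $U$, and the correspondence is orientation preserving on $U$; 2. $(f,\hat f)$ is an S-Willmore surface with its dual surface on $U$, and the correspondence is anti-conformal on $U$. -/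

import Mathlib

open scoped Manifold ContDiff ComplexConjugate

noncomputable section

namespace Blaschke

/-! ### The sphere and the light cone -/

/-- The ambient Euclidean space of the unit sphere. -/
abbrev Amb (n : ℕ) : Type := EuclideanSpace ℝ (Fin (n + 1))

/-- The unit `n`-sphere. -/
abbrev Sph (n : ℕ) : Type := Metric.sphere (0 : Amb n) 1

/-- The Minkowski bilinear form of signature `(n+1, 1)` on `R^(n+2)`. For `R = ℝ` this is the
inner product of Minkowski space, for `R = ℂ` its complex bilinear extension. -/
def mink {R : Type*} [CommRing R] {n : ℕ} (x y : Fin (n + 2) → R) : R :=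
  -(x 0 * y 0) + ∑ i : Fin (n + 1), x i.succ * y i.succ

/-- The lift `x ↦ (1, x)` of the sphere into the forward light cone; points of the sphere
correspond to the null lines that are spanned by these vectors. -/
def coneLift {n : ℕ} (x : Sph n) : Fin (n + 2) → ℝ :=
  Matrix.vecCons 1 (fun i => (x : Amb n) i)

/-- Inclusion of Minkowski space into its complexification. -/
def toC {n : ℕ} (v : Fin (n + 2) → ℝ) : Fin (n + 2) → ℂ := fun i => (v i : ℂ)

/-! ### Wirtinger derivatives -/

/-- `∂F/∂z = (F_u - i F_v) / 2` with `z = u + i v`. -/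
def dz {n : ℕ} (F : ℂ → Fin (n + 2) → ℂ) (z : ℂ) : Fin (n + 2) → ℂ :=
  (1 / 2 : ℂ) • (fderiv ℝ F z 1 - Complex.I • fderiv ℝ F z Complex.I)

/-- `∂F/∂z̄ = (F_u + i F_v) / 2` with `z = u + i v`. -/
def dzbar {n : ℕ} (F : ℂ → Fin (n + 2) → ℂ) (z : ℂ) : Fin (n + 2) → ℂ :=
  (1 / 2 : ℂ) • (fderiv ℝ F z 1 + Complex.I • fderiv ℝ F z Complex.I)

/-! ### Conformal invariants of one surface in a complex coordinate

Here `g : ℂ → Sph n` is a surface written in a complex coordinate; all the notions depend only on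
the germ of `g` at the point in question and are meant for points at which `g` is a conformal
immersion. -/

/-- The canonical lift `Y` into the forward light cone, normalized by `|dY|² = |dz|²`:
it is `(1, g) / |g_u|`. -/
def canonLift {n : ℕ} (g : ℂ → Sph n) (z : ℂ) : Fin (n + 2) → ℂ :=
  ((‖fderiv ℝ (fun w => (g w : Amb n)) z 1‖⁻¹ : ℝ) : ℂ) • toC (coneLift (g z))

/-- The vector `N` of the canonical frame `Y, Y_z, Y_z̄, N`, that is, the section of the mean
curvature sphere bundle with `⟨N, N⟩ = 0`, `⟨N, Y⟩ = -1`, `⟨N, Y_z⟩ = 0`. -/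
def frameN {n : ℕ} (g : ℂ → Sph n) (z : ℂ) : Fin (n + 2) → ℂ :=
  (2 : ℂ) • dzbar (dz (canonLift g)) z +
    (2 * mink (dzbar (dz (canonLift g)) z) (dzbar (dz (canonLift g)) z)) • canonLift g z

/-- The complexified mean curvature sphere (central sphere)
`V ⊗ ℂ = span {Y, Y_z, Y_z̄, Y_zz̄}`. -/
def meanSphere {n : ℕ} (g : ℂ → Sph n) (z : ℂ) : Submodule ℂ (Fin (n + 2) → ℂ) :=
  Submodule.span ℂ {canonLift g z, dz (canonLift g) z, dzbar (canonLift g) z,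
    dzbar (dz (canonLift g)) z}

/-- The orthogonal projection of the complexified Minkowski space onto the complexified normal
bundle `V^⊥ ⊗ ℂ` of the mean curvature sphere, written in the canonical frame. -/
def normalProj {n : ℕ} (g : ℂ → Sph n) (z : ℂ) (v : Fin (n + 2) → ℂ) : Fin (n + 2) → ℂ :=
  v + mink v (frameN g z) • canonLift g z + mink v (canonLift g z) • frameN g z
    - (2 * mink v (dzbar (canonLift g) z)) • dz (canonLift g) z
    - (2 * mink v (dz (canonLift g) z)) • dzbar (canonLift g) z

/-- The Schwarzian derivative `s`, the coefficient in `Y_zz = -(s/2) Y + κ`. -/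
def schwarzian {n : ℕ} (g : ℂ → Sph n) (z : ℂ) : ℂ :=
  2 * mink (dz (dz (canonLift g)) z) (frameN g z)

/-- The normal valued Hopf differential `κ = Y_zz + (s/2) Y`. -/
def hopf {n : ℕ} (g : ℂ → Sph n) (z : ℂ) : Fin (n + 2) → ℂ :=
  dz (dz (canonLift g)) z + (schwarzian g z / 2) • canonLift g z

/-- The operator `D_z̄` of the normal connection on sections of `V^⊥ ⊗ ℂ`. -/
def normalDzbar {n : ℕ} (g : ℂ → Sph n) (ψ : ℂ → Fin (n + 2) → ℂ) (z : ℂ) : Fin (n + 2) → ℂ :=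
  normalProj g z (dzbar ψ z)

/-- The Willmore equation `D_z̄ D_z̄ κ + (s̄/2) κ = 0` on `U`. -/
def IsWillmoreOn {n : ℕ} (g : ℂ → Sph n) (U : Set ℂ) : Prop :=
  ∀ z ∈ U, normalDzbar g (normalDzbar g (hopf g)) z + (conj (schwarzian g z) / 2) • hopf g z = 0

/-- S-Willmore surfaces: Willmore surfaces for which `κ` and `D_z̄ κ` are linearly dependent. -/
def IsSWillmoreOn {n : ℕ} (g : ℂ → Sph n) (U : Set ℂ) : Prop :=
  IsWillmoreOn g U ∧
    ∀ z ∈ U, ¬ LinearIndependent ℂ ![hopf g z, normalDzbar g (hopf g) z]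

/-- The surface is isothermic on `U` and the coordinate `z` is one of its curvature line
coordinates: the Hopf differential with respect to `z` is real. -/
def IsIsothermicCoordOn {n : ℕ} (g : ℂ → Sph n) (U : Set ℂ) : Prop :=
  ∀ z ∈ U, star (hopf g z) = hopf g z

/-! ### Pairs of surfaces in a common complex coordinate -/

/-- The infinitesimal rotation `a ∧ b`, acting by `c ↦ ⟨a, c⟩ b - ⟨b, c⟩ a`. -/
def wedge {n : ℕ} (a b c : Fin (n + 2) → ℂ) : Fin (n + 2) → ℂ := mink a c • b - mink b c • a

/-- Darboux pairs of isothermic surfaces. Both surfaces are isothermic with common curvature line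
coordinate `z`, and there is a real parameter `r ≠ 0` such that the null line of `g'` is parallel
for the connection `d + r η` (which is flat), where `η = Y ∧ (Y_z̄ dz + Y_z dz̄)` is the closed
one-form of the isothermic surface `g`. Since `η` is real, the `dz`-part of the condition
implies the `dz̄`-part. -/
def IsDarbouxPairOn {n : ℕ} (g g' : ℂ → Sph n) (U : Set ℂ) : Prop :=
  IsIsothermicCoordOn g U ∧ IsIsothermicCoordOn g' U ∧
    ∃ r : ℝ, r ≠ 0 ∧ ∀ z ∈ U,
      dz (fun w => toC (coneLift (g' w))) z
          + (r : ℂ) • wedge (canonLift g z) (dzbar (canonLift g) z) (toC (coneLift (g' z)))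
        ∈ Submodule.span ℂ {toC (coneLift (g' z))}

/-- `g` is an S-Willmore surface and `g'` is its dual surface: `g'` is spanned by
`(|μ|²/2) Y + μ̄ Y_z + μ Y_z̄ + N` with `D_z̄ κ + (μ̄/2) κ = 0`; moreover the duality is mutual,
that is, `g'` is S-Willmore too and has the same mean curvature spheres. -/
def IsSWillmoreDualPairOn {n : ℕ} (g g' : ℂ → Sph n) (U : Set ℂ) : Prop :=
  IsSWillmoreOn g U ∧ IsSWillmoreOn g' U ∧ (∀ z ∈ U, meanSphere g z = meanSphere g' z) ∧
    ∃ μ : ℂ → ℂ, ∀ z ∈ U,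
      normalDzbar g (hopf g) z + (conj (μ z) / 2) • hopf g z = 0 ∧
      ∃ c : ℂ, toC (coneLift (g' z)) =
        c • (((‖μ z‖ ^ 2 / 2 : ℝ) : ℂ) • canonLift g z + conj (μ z) • dz (canonLift g) z
          + μ z • dzbar (canonLift g) z + frameN g z)

/-- The frame `(F, F_u, F_v, F')` with `F = (1, g)` and `F' = (1, g')`. If the surface `g` is
tangent to a 2-sphere through `g'`, this is a basis of the 4-dimensional subspace representing that
sphere, and it gives the orientation that the oriented surface `g` induces on the sphere. -/
def contactFrame {n : ℕ} (g g' : ℂ → Sph n) (z : ℂ) : Fin 4 → Fin (n + 2) → ℝ :=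
  ![coneLift (g z), fderiv ℝ (fun w => coneLift (g w)) z 1,
    fderiv ℝ (fun w => coneLift (g w)) z Complex.I, coneLift (g' z)]

/-- The two surfaces induce the same orientation on the common tangent sphere at `z`: the
correspondence `g ↦ g'` is orientation preserving. -/
def IsOrientationPreservingAt {n : ℕ} (g g' : ℂ → Sph n) (z : ℂ) : Prop :=
  ∃ A : Matrix (Fin 4) (Fin 4) ℝ, 0 < A.det ∧
    ∀ i, contactFrame g' g z i = ∑ j, A i j • contactFrame g g' z j

/-- The two surfaces induce opposite orientations on the common tangent sphere at `z`: the
(angle preserving) correspondence `g ↦ g'` is anti-conformal. -/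
def IsOrientationReversingAt {n : ℕ} (g g' : ℂ → Sph n) (z : ℂ) : Prop :=
  ∃ A : Matrix (Fin 4) (Fin 4) ℝ, A.det < 0 ∧
    ∀ i, contactFrame g' g z i = ∑ j, A i j • contactFrame g g' z j

/-! ### Immersions of a Riemann surface, sphere congruences, reflections -/

/-- The complex coordinates of a Riemann surface. -/
abbrev coords (M : Type*) [TopologicalSpace M] [ChartedSpace ℂ M] :
    Set (OpenPartialHomeomorph M ℂ) :=
  IsManifold.maximalAtlas 𝓘(ℂ) ω M

/-- Smooth conformal immersions of a Riemann surface into the sphere. -/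
structure IsConformalImmersion {M : Type*} [TopologicalSpace M] [ChartedSpace ℂ M] {n : ℕ}
    (f : M → Sph n) : Prop where
  smooth : ContMDiff 𝓘(ℝ, ℂ) (𝓡 n) ∞ f
  conformal : ∀ φ ∈ coords M, ∀ z ∈ φ.target, ConformalAt (fun w => (f (φ.symm w) : Amb n)) z

/-- The 4-dimensional subspaces of Minkowski space of signature `(3, 1)`, equivalently those with
space-like orthogonal complement. They represent the 2-spheres in the `n`-sphere: `W` represents
the set of all points whose null line lies in `W`. -/
structure IsTwoSphere {n : ℕ} (W : Submodule ℝ (Fin (n + 2) → ℝ)) : Prop where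
  finrank_eq : Module.finrank ℝ W = 4
  spacelike : ∀ ξ : Fin (n + 2) → ℝ, (∀ w ∈ W, mink w ξ = 0) → ξ ≠ 0 → 0 < mink ξ ξ

/-- The surface `f` envelops the family `W` of 2-spheres: at each point it passes through the
corresponding sphere and is tangent to it. -/
def Envelops {M : Type*} [TopologicalSpace M] [ChartedSpace ℂ M] {n : ℕ}
    (f : M → Sph n) (W : M → Submodule ℝ (Fin (n + 2) → ℝ)) : Prop :=
  (∀ p, coneLift (f p) ∈ W p) ∧
    ∀ φ ∈ coords M, ∀ z ∈ φ.target, ∀ h : ℂ,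
      fderiv ℝ (fun w => coneLift (f (φ.symm w))) z h ∈ W (φ.symm z)

/-- On `U`, the map `f'` is the image of `f` under one fixed Möbius transformation of the sphere
that is induced by the reflection of Minkowski space with respect to a non-null vector `X`. -/
def IsReflectionOn {M : Type*} {n : ℕ} (f f' : M → Sph n) (U : Set M) : Prop :=
  ∃ X : Fin (n + 2) → ℝ, mink X X ≠ 0 ∧ ∀ p ∈ U, ∃ c : ℝ,
    coneLift (f' p) =
      c • (coneLift (f p) - (2 * mink (coneLift (f p)) X / mink X X) • X)

end Blaschke

end

open Blaschke

/-!
Two conformal immersions `f`, `f'` that envelop a common sphere congruence and have no common points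
are written in a complex coordinate as an *adapted pair* of real null lifts: the canonical lift `Y`
of `f`, and the lift `Z` of `f'` with `⟨Y, Z⟩ = -1`. That both surfaces envelop the spheres
`span {Y, Y_z, Y_z̄, Z}` is the structure equation (`IsAdaptedPair.wz_right`)

  `Z_z = a Z + ρ (Y_z + a Y) + θ (Y_z̄ + ā Y)`,  where `a = ⟨Y_z, Z⟩`.

Conformality of `f'` says `θ ρ = 0`, and since `f'` is an immersion the two coefficients have no
common zero. Hence near a given point either `ρ = 0` and `θ ≠ 0`, and then the correspondence
preserves the orientation, or `θ = 0` and `ρ ≠ 0`, and then it reverses the orientation. Everything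
else follows from the compatibility condition that `Z_zz̄` is real, which is expanded in
`compat_of_rho_eq_zero` and `compat_of_theta_eq_zero`.

*Orientation preserving pairs.* If `ρ = 0`, then `θ` is holomorphic. The quadratic differential
`θ dz²` does not depend on the choice of the lifts and is symmetric in the two surfaces
(`pairTheta`), so there is a coordinate in which `θ = 1` for either order of the surfaces
(`exists_coord_of_quadratic_differential`). In this coordinate compatibility says that the Hopf
differentials are real, and the structure equation says that `f'` is parallel for `d + θ η`.

*Orientation reversing pairs.* If `θ = 0`, compatibility gives `ρ_z̄ = 2 ā ρ`, and says that
wherever `ρ` is not real, the enveloped sphere is the mean curvature sphere of `f` (`sphereDefect`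
vanishes).
* If `ρ` is real, the direction of `Z - ρ Y` is constant, and the reflection in this direction
  interchanges the two surfaces (`reflection_of_rho_real`).
* If the enveloped sphere is the mean curvature sphere, then `Z = 2 |a|² Y + 2 ā Y_z + 2 a Y_z̄ + N`
  and `D_z̄ κ = -ā κ`, which together with `Z_z = a Z + ρ (Y_z + a Y)` makes `f` an S-Willmore
  surface with dual surface `f'`, and the roles of the two surfaces can be interchanged.

It remains to see that one of these alternatives holds on a full neighborhood of each point,
although the set where `ρ` is real could have a boundary there. The pair of functions
`(ρ - ρ̄, ρ_z - 2 a ρ)` solves a linear system in which the `z̄`-derivatives are bounded by the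
functions (`elliptic_system`). By a Carleman inequality such a solution vanishes on a disc as soon
as it vanishes near the center (`unique_continuation`). Thus, if the point has no
neighborhood in which the mean curvature spheres are the enveloped ones, then `ρ` is real on a small
disc next to the point, and therefore also near the point itself (`reversing_alternative`).
-/

namespace Blaschke

/-! ### Algebra of the Minkowski form -/

section Mink

variable {R : Type*} [CommRing R] {n : ℕ}

theorem mink_comm (x y : Fin (n + 2) → R) : mink x y = mink y x := by
  simp only [mink, mul_comm]

@[simp] theorem mink_add_left (x y z : Fin (n + 2) → R) :
    mink (x + y) z = mink x z + mink y z := by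
  simp only [mink, Pi.add_apply, add_mul, Finset.sum_add_distrib]; ring

@[simp] theorem mink_smul_left (c : R) (x z : Fin (n + 2) → R) :
    mink (c • x) z = c * mink x z := by
  simp only [mink, Pi.smul_apply, smul_eq_mul, mul_assoc, ← Finset.mul_sum]; ring

@[simp] theorem mink_add_right (x y z : Fin (n + 2) → R) :
    mink z (x + y) = mink z x + mink z y := by
  rw [mink_comm, mink_add_left, mink_comm x, mink_comm y]

@[simp] theorem mink_smul_right (c : R) (x z : Fin (n + 2) → R) :
    mink z (c • x) = c * mink z x := by
  rw [mink_comm, mink_smul_left, mink_comm x]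

@[simp] theorem mink_neg_left (x z : Fin (n + 2) → R) : mink (-x) z = -mink x z := by
  simpa using mink_smul_left (-1) x z

@[simp] theorem mink_neg_right (x z : Fin (n + 2) → R) : mink z (-x) = -mink z x := by
  simpa using mink_smul_right (-1) x z

@[simp] theorem mink_sub_left (x y z : Fin (n + 2) → R) :
    mink (x - y) z = mink x z - mink y z := by
  rw [sub_eq_add_neg, mink_add_left, mink_neg_left, ← sub_eq_add_neg]

@[simp] theorem mink_sub_right (x y z : Fin (n + 2) → R) :
    mink z (x - y) = mink z x - mink z y := by
  rw [sub_eq_add_neg, mink_add_right, mink_neg_right, ← sub_eq_add_neg]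

@[simp] theorem mink_zero_left (z : Fin (n + 2) → R) : mink 0 z = 0 := by simp [mink]

@[simp] theorem mink_zero_right (z : Fin (n + 2) → R) : mink z 0 = 0 := by simp [mink]

theorem conj_mink (x y : Fin (n + 2) → ℂ) : conj (mink x y) = mink (star x) (star y) := by
  simp [mink]

theorem mink_toC (x y : Fin (n + 2) → ℝ) : mink (toC x) (toC y) = ((mink x y : ℝ) : ℂ) := by
  simp [mink, toC]

theorem star_toC (x : Fin (n + 2) → ℝ) : star (toC x) = toC x := by
  ext i; simp [toC]

end Mink

/-! ### Wirtinger calculus -/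

section Wirtinger

variable {E : Type*} [NormedAddCommGroup E] [NormedSpace ℂ E] {F G : ℂ → E} {c : ℂ → ℂ} {z : ℂ}

/-- The Wirtinger derivative `∂F/∂z` of a function with values in a complex normed space. -/
noncomputable def wz (F : ℂ → E) (z : ℂ) : E :=
  (1 / 2 : ℂ) • (fderiv ℝ F z 1 - Complex.I • fderiv ℝ F z Complex.I)

/-- The Wirtinger derivative `∂F/∂z̄` of a function with values in a complex normed space. -/
noncomputable def wzb (F : ℂ → E) (z : ℂ) : E :=
  (1 / 2 : ℂ) • (fderiv ℝ F z 1 + Complex.I • fderiv ℝ F z Complex.I)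

theorem dz_eq_wz {n : ℕ} (F : ℂ → Fin (n + 2) → ℂ) : dz F = wz F := rfl

theorem dzbar_eq_wzb {n : ℕ} (F : ℂ → Fin (n + 2) → ℂ) : dzbar F = wzb F := rfl

theorem fderiv_one_eq (F : ℂ → E) (z : ℂ) : fderiv ℝ F z 1 = wz F z + wzb F z := by
  simp only [wz, wzb]; module

theorem fderiv_I_eq (F : ℂ → E) (z : ℂ) :
    fderiv ℝ F z Complex.I = Complex.I • (wz F z - wzb F z) := by
  have h : Complex.I • Complex.I • fderiv ℝ F z Complex.I = -fderiv ℝ F z Complex.I := by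
    rw [smul_smul, Complex.I_mul_I, neg_one_smul]
  simp only [wz, wzb]
  linear_combination (norm := module) (1 : ℂ) • h

theorem wz_congr (h : F =ᶠ[nhds z] G) : wz F z = wz G z := by
  simp only [wz, h.fderiv_eq]

theorem wzb_congr (h : F =ᶠ[nhds z] G) : wzb F z = wzb G z := by
  simp only [wzb, h.fderiv_eq]

theorem wz_congr_on {U : Set ℂ} (hU : IsOpen U) (h : ∀ z ∈ U, F z = G z) (hz : z ∈ U) :
    wz F z = wz G z :=
  wz_congr (Filter.eventually_of_mem (hU.mem_nhds hz) h)

theorem wzb_congr_on {U : Set ℂ} (hU : IsOpen U) (h : ∀ z ∈ U, F z = G z) (hz : z ∈ U) :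
    wzb F z = wzb G z :=
  wzb_congr (Filter.eventually_of_mem (hU.mem_nhds hz) h)

theorem wz_const (v : E) : wz (fun _ => v) z = 0 := by simp [wz]

theorem wzb_const (v : E) : wzb (fun _ => v) z = 0 := by simp [wzb]

theorem wz_add (hF : DifferentiableAt ℝ F z) (hG : DifferentiableAt ℝ G z) :
    wz (fun w => F w + G w) z = wz F z + wz G z := by
  simp only [wz, fderiv_fun_add hF hG, add_apply]; module

theorem wzb_add (hF : DifferentiableAt ℝ F z) (hG : DifferentiableAt ℝ G z) :
    wzb (fun w => F w + G w) z = wzb F z + wzb G z := by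
  simp only [wzb, fderiv_fun_add hF hG, add_apply]; module

theorem wz_sub (hF : DifferentiableAt ℝ F z) (hG : DifferentiableAt ℝ G z) :
    wz (fun w => F w - G w) z = wz F z - wz G z := by
  simp only [wz, fderiv_fun_sub hF hG, sub_apply]; module

theorem wzb_sub (hF : DifferentiableAt ℝ F z) (hG : DifferentiableAt ℝ G z) :
    wzb (fun w => F w - G w) z = wzb F z - wzb G z := by
  simp only [wzb, fderiv_fun_sub hF hG, sub_apply]; module

theorem wz_smul (hc : DifferentiableAt ℝ c z) (hF : DifferentiableAt ℝ F z) :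
    wz (fun w => c w • F w) z = wz c z • F z + c z • wz F z := by
  simp only [wz, fderiv_fun_smul hc hF, add_apply,
    smul_apply, ContinuousLinearMap.smulRight_apply, smul_eq_mul]
  module

theorem wzb_smul (hc : DifferentiableAt ℝ c z) (hF : DifferentiableAt ℝ F z) :
    wzb (fun w => c w • F w) z = wzb c z • F z + c z • wzb F z := by
  simp only [wzb, fderiv_fun_smul hc hF, add_apply,
    smul_apply, ContinuousLinearMap.smulRight_apply, smul_eq_mul]
  module

theorem wz_const_smul (k : ℂ) (hF : DifferentiableAt ℝ F z) :
    wz (fun w => k • F w) z = k • wz F z := by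
  rw [wz_smul (differentiableAt_const k) hF, wz_const, zero_smul, zero_add]

theorem wzb_const_smul (k : ℂ) (hF : DifferentiableAt ℝ F z) :
    wzb (fun w => k • F w) z = k • wzb F z := by
  rw [wzb_smul (differentiableAt_const k) hF, wzb_const, zero_smul, zero_add]

theorem wz_mul {d : ℂ → ℂ} (hc : DifferentiableAt ℝ c z) (hd : DifferentiableAt ℝ d z) :
    wz (fun w => c w * d w) z = wz c z * d z + c z * wz d z := by
  simpa only [smul_eq_mul] using wz_smul (F := d) hc hd

theorem wzb_mul {d : ℂ → ℂ} (hc : DifferentiableAt ℝ c z) (hd : DifferentiableAt ℝ d z) :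
    wzb (fun w => c w * d w) z = wzb c z * d z + c z * wzb d z := by
  simpa only [smul_eq_mul] using wzb_smul (F := d) hc hd

theorem wz_const_mul {d : ℂ → ℂ} (k : ℂ) (hd : DifferentiableAt ℝ d z) :
    wz (fun w => k * d w) z = k * wz d z := by
  simpa only [smul_eq_mul] using wz_const_smul (F := d) k hd

theorem wzb_const_mul {d : ℂ → ℂ} (k : ℂ) (hd : DifferentiableAt ℝ d z) :
    wzb (fun w => k * d w) z = k * wzb d z := by
  simpa only [smul_eq_mul] using wzb_const_smul (F := d) k hd

section Star

variable [StarAddMonoid E] [NormedStarGroup E] [StarModule ℂ E] [StarModule ℝ E]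

theorem wz_star : wz (fun w => star (F w)) z = star (wzb F z) := by
  simp [wz, wzb, fderiv_star, star_smul, sub_eq_add_neg]

theorem wzb_star : wzb (fun w => star (F w)) z = star (wz F z) := by
  simp [wz, wzb, fderiv_star, star_smul, sub_eq_add_neg]

end Star

theorem wz_conj : wz (fun w => conj (c w)) z = conj (wzb c z) := wz_star (F := c)

theorem wzb_conj : wzb (fun w => conj (c w)) z = conj (wz c z) := wzb_star (F := c)

theorem contDiffAt_wz (hF : ContDiffAt ℝ ∞ F z) : ContDiffAt ℝ ∞ (wz F) z := by
  have h : ContDiffAt ℝ ∞ (fderiv ℝ F) z := hF.fderiv_right (by simp)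
  exact contDiffAt_const.smul ((h.clm_apply contDiffAt_const).sub
    (contDiffAt_const.smul (h.clm_apply contDiffAt_const)))

theorem contDiffAt_wzb (hF : ContDiffAt ℝ ∞ F z) : ContDiffAt ℝ ∞ (wzb F) z := by
  have h : ContDiffAt ℝ ∞ (fderiv ℝ F) z := hF.fderiv_right (by simp)
  exact contDiffAt_const.smul ((h.clm_apply contDiffAt_const).add
    (contDiffAt_const.smul (h.clm_apply contDiffAt_const)))

theorem fderiv_wz_apply (hF : ContDiffAt ℝ ∞ F z) (h : ℂ) : fderiv ℝ (wz F) z h =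
    (1 / 2 : ℂ) • (fderiv ℝ (fderiv ℝ F) z h 1
      - Complex.I • fderiv ℝ (fderiv ℝ F) z h Complex.I) := by
  have hd : DifferentiableAt ℝ (fderiv ℝ F) z :=
    (hF.fderiv_right (m := ∞) (by simp)).differentiableAt (by simp)
  have h1 := hd.clm_apply (differentiableAt_const (1 : ℂ))
  have hI := hd.clm_apply (differentiableAt_const Complex.I)
  unfold wz
  rw [fderiv_fun_const_smul (h1.fun_sub (hI.fun_const_smul _)),
    fderiv_fun_sub h1 (hI.fun_const_smul _), fderiv_fun_const_smul hI,
    fderiv_clm_apply hd (differentiableAt_const _),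
    fderiv_clm_apply hd (differentiableAt_const _)]
  simp

theorem fderiv_wzb_apply (hF : ContDiffAt ℝ ∞ F z) (h : ℂ) : fderiv ℝ (wzb F) z h =
    (1 / 2 : ℂ) • (fderiv ℝ (fderiv ℝ F) z h 1
      + Complex.I • fderiv ℝ (fderiv ℝ F) z h Complex.I) := by
  have hd : DifferentiableAt ℝ (fderiv ℝ F) z :=
    (hF.fderiv_right (m := ∞) (by simp)).differentiableAt (by simp)
  have h1 := hd.clm_apply (differentiableAt_const (1 : ℂ))
  have hI := hd.clm_apply (differentiableAt_const Complex.I)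
  unfold wzb
  rw [fderiv_fun_const_smul (h1.fun_add (hI.fun_const_smul _)),
    fderiv_fun_add h1 (hI.fun_const_smul _), fderiv_fun_const_smul hI,
    fderiv_clm_apply hd (differentiableAt_const _),
    fderiv_clm_apply hd (differentiableAt_const _)]
  simp

/-- Mixed Wirtinger derivatives commute. -/
theorem wz_wzb (hF : ContDiffAt ℝ ∞ F z) : wz (wzb F) z = wzb (wz F) z := by
  have hs := (hF.isSymmSndFDerivAt (by simp; exact WithTop.coe_le_coe.2 le_top)).eq 1 Complex.I
  rw [wz, wzb]
  simp only [fderiv_wz_apply hF, fderiv_wzb_apply hF, hs]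
  module

theorem fderiv_apply_eq (F : ℂ → E) (z a : ℂ) :
    fderiv ℝ F z a = a • wz F z + conj a • wzb F z := by
  have : a = a.re • (1 : ℂ) + a.im • Complex.I := by
    simp [Complex.re_add_im]
  conv_lhs => rw [this]
  rw [map_add, map_smul, map_smul, fderiv_one_eq, fderiv_I_eq]
  conv_rhs => rw [← Complex.re_add_im a]
  simp only [map_add, map_mul, Complex.conj_ofReal, Complex.conj_I]
  simp only [← Complex.coe_smul]
  module

theorem wz_comp_holomorphic {k : ℂ → ℂ} {k' w : ℂ} (hk : HasDerivAt k k' w)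
    (hF : DifferentiableAt ℝ F (k w)) : wz (fun w => F (k w)) w = k' • wz F (k w) := by
  have hk' : HasFDerivAt k ((ContinuousLinearMap.toSpanSingleton ℂ k').restrictScalars ℝ) w :=
    hk.hasFDerivAt.restrictScalars ℝ
  have h : fderiv ℝ (fun w => F (k w)) w = _ := (hF.hasFDerivAt.comp w hk').fderiv
  have hI : ∀ v : E, Complex.I • Complex.I • v = -v := fun v => by
    rw [smul_smul, Complex.I_mul_I, neg_one_smul]
  rw [wz, h]
  simp [fderiv_apply_eq F]
  linear_combination (norm := module) (-(1 / 2) * k') • hI (wz F (k w)) +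
    (1 / 2 * conj k') • hI (wzb F (k w))

/-- A function on a connected open set whose Wirtinger derivatives vanish is constant. -/
theorem eq_of_wz_eq_zero {U : Set ℂ} (hU : IsOpen U) (hc : IsPreconnected U)
    (hF : ∀ z ∈ U, DifferentiableAt ℝ F z) (h : ∀ z ∈ U, wz F z = 0) (h' : ∀ z ∈ U, wzb F z = 0)
    {w : ℂ} (hz : z ∈ U) (hw : w ∈ U) : F z = F w := by
  refine hU.is_const_of_fderiv_eq_zero (𝕜 := ℝ) hc
    (fun z hz => (hF z hz).differentiableWithinAt) (fun z hz => ?_) hz hw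
  ext a
  simp [fderiv_apply_eq F, h z hz, h' z hz]

/-- A function with vanishing `∂/∂z̄` is complex differentiable. -/
theorem differentiableAt_of_wzb_eq_zero {c : ℂ → ℂ} (hc : DifferentiableAt ℝ c z)
    (h : wzb c z = 0) : DifferentiableAt ℂ c z := by
  rw [differentiableAt_complex_iff_differentiableAt_real]
  refine ⟨hc, ?_⟩
  rw [fderiv_one_eq, fderiv_I_eq, h]
  simp

end Wirtinger

section MinkDeriv

variable {n : ℕ} {F G : ℂ → Fin (n + 2) → ℂ} {z : ℂ}

theorem contDiffAt_mink (hF : ContDiffAt ℝ ∞ F z) (hG : ContDiffAt ℝ ∞ G z) :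
    ContDiffAt ℝ ∞ (fun w => mink (F w) (G w)) z := by
  have hF' := contDiffAt_pi.1 hF
  have hG' := contDiffAt_pi.1 hG
  unfold mink
  exact ((hF' 0).mul (hG' 0)).neg.add
    (ContDiffAt.sum fun i _ => (hF' i.succ).mul (hG' i.succ))

theorem fderiv_mink_apply (hF : DifferentiableAt ℝ F z) (hG : DifferentiableAt ℝ G z) (h : ℂ) :
    fderiv ℝ (fun w => mink (F w) (G w)) z h =
      mink (fderiv ℝ F z h) (G z) + mink (F z) (fderiv ℝ G z h) := by
  have hF' := hasFDerivAt_pi'.1 hF.hasFDerivAt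
  have hG' := hasFDerivAt_pi'.1 hG.hasFDerivAt
  have h1 := ((hF' 0).mul (hG' 0)).neg.add
    (HasFDerivAt.fun_sum (u := Finset.univ) fun (i : Fin (n + 1)) _ =>
      (hF' i.succ).mul (hG' i.succ))
  have h2 : fderiv ℝ (fun w => mink (F w) (G w)) z = _ := h1.fderiv
  rw [h2]
  simp [mink, Finset.sum_add_distrib]
  simp only [mul_comm]
  ring

theorem wz_mink (hF : DifferentiableAt ℝ F z) (hG : DifferentiableAt ℝ G z) :
    wz (fun w => mink (F w) (G w)) z = mink (wz F z) (G z) + mink (F z) (wz G z) := by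
  simp only [wz, fderiv_mink_apply hF hG, mink_smul_left, mink_smul_right, mink_sub_left,
    mink_sub_right, smul_eq_mul]
  ring

theorem wzb_mink (hF : DifferentiableAt ℝ F z) (hG : DifferentiableAt ℝ G z) :
    wzb (fun w => mink (F w) (G w)) z = mink (wzb F z) (G z) + mink (F z) (wzb G z) := by
  simp only [wzb, fderiv_mink_apply hF hG, mink_smul_left, mink_smul_right, mink_add_left,
    mink_add_right, smul_eq_mul]
  ring

end MinkDeriv

/-! ### The frame of a canonical lift -/

section Canonical

variable {n : ℕ} {U : Set ℂ} {Y : ℂ → Fin (n + 2) → ℂ} {z : ℂ}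

/-- A real smooth map `Y` into the light cone with `|dY|² = |dz|²` on the open set `U`. -/
structure IsCanonicalLift (U : Set ℂ) (Y : ℂ → Fin (n + 2) → ℂ) : Prop where
  isOpen : IsOpen U
  smooth : ∀ z ∈ U, ContDiffAt ℝ ∞ Y z
  real : ∀ z ∈ U, star (Y z) = Y z
  null : ∀ z ∈ U, mink (Y z) (Y z) = 0
  conformal : ∀ z ∈ U, mink (wz Y z) (wz Y z) = 0
  norm : ∀ z ∈ U, mink (wz Y z) (wzb Y z) = 1 / 2

theorem star_wz_of_real (hU : IsOpen U) (hY : ∀ z ∈ U, star (Y z) = Y z) (hz : z ∈ U) :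
    star (wz Y z) = wzb Y z := by
  rw [← wzb_star]; exact wzb_congr_on hU hY hz

theorem star_wzb_of_real (hU : IsOpen U) (hY : ∀ z ∈ U, star (Y z) = Y z) (hz : z ∈ U) :
    star (wzb Y z) = wz Y z := by
  rw [← wz_star]; exact wz_congr_on hU hY hz

/-- If `⟨F, G⟩` is constant, then `⟨F_z, G⟩ = -⟨F, G_z⟩`. -/
theorem mink_wz_of_const {F G : ℂ → Fin (n + 2) → ℂ} {c : ℂ} (hU : IsOpen U)
    (hF : ∀ z ∈ U, ContDiffAt ℝ ∞ F z) (hG : ∀ z ∈ U, ContDiffAt ℝ ∞ G z)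
    (h : ∀ z ∈ U, mink (F z) (G z) = c) (hz : z ∈ U) :
    mink (wz F z) (G z) = -mink (F z) (wz G z) := by
  have h1 := wz_mink ((hF z hz).differentiableAt (by simp)) ((hG z hz).differentiableAt (by simp))
  rw [wz_congr_on hU h hz, wz_const] at h1
  linear_combination -h1

/-- If `⟨F, G⟩` is constant, then `⟨F_z̄, G⟩ = -⟨F, G_z̄⟩`. -/
theorem mink_wzb_of_const {F G : ℂ → Fin (n + 2) → ℂ} {c : ℂ} (hU : IsOpen U)
    (hF : ∀ z ∈ U, ContDiffAt ℝ ∞ F z) (hG : ∀ z ∈ U, ContDiffAt ℝ ∞ G z)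
    (h : ∀ z ∈ U, mink (F z) (G z) = c) (hz : z ∈ U) :
    mink (wzb F z) (G z) = -mink (F z) (wzb G z) := by
  have h1 := wzb_mink ((hF z hz).differentiableAt (by simp)) ((hG z hz).differentiableAt (by simp))
  rw [wzb_congr_on hU h hz, wzb_const] at h1
  linear_combination -h1

namespace IsCanonicalLift

theorem smooth_wz (h : IsCanonicalLift U Y) : ∀ z ∈ U, ContDiffAt ℝ ∞ (wz Y) z :=
  fun z hz => contDiffAt_wz (h.smooth z hz)

theorem smooth_wzb (h : IsCanonicalLift U Y) : ∀ z ∈ U, ContDiffAt ℝ ∞ (wzb Y) z :=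
  fun z hz => contDiffAt_wzb (h.smooth z hz)

theorem star_wz (h : IsCanonicalLift U Y) (hz : z ∈ U) : star (wz Y z) = wzb Y z :=
  star_wz_of_real h.isOpen h.real hz

theorem star_wzb (h : IsCanonicalLift U Y) (hz : z ∈ U) : star (wzb Y z) = wz Y z :=
  star_wzb_of_real h.isOpen h.real hz

theorem wz_wzb (h : IsCanonicalLift U Y) (hz : z ∈ U) : wz (wzb Y) z = wzb (wz Y) z :=
  Blaschke.wz_wzb (h.smooth z hz)

theorem star_wzb_wz (h : IsCanonicalLift U Y) (hz : z ∈ U) :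
    star (wzb (wz Y) z) = wzb (wz Y) z := by
  rw [← Blaschke.wz_star, wz_congr_on h.isOpen (fun w hw => h.star_wz hw) hz, h.wz_wzb hz]

theorem star_wz_wz (h : IsCanonicalLift U Y) (hz : z ∈ U) :
    star (wz (wz Y) z) = wzb (wzb Y) z := by
  rw [← Blaschke.wzb_star, wzb_congr_on h.isOpen (fun w hw => h.star_wz hw) hz]

theorem conformal_bar (h : IsCanonicalLift U Y) (z) (hz : z ∈ U) :
    mink (wzb Y z) (wzb Y z) = 0 := by
  rw [← h.star_wz hz, ← conj_mink, h.conformal z hz, map_zero]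

theorem norm_symm (h : IsCanonicalLift U Y) (z) (hz : z ∈ U) :
    mink (wzb Y z) (wz Y z) = 1 / 2 := by
  rw [mink_comm, h.norm z hz]

theorem mink_wz (h : IsCanonicalLift U Y) (z) (hz : z ∈ U) : mink (Y z) (wz Y z) = 0 := by
  have := mink_wz_of_const h.isOpen h.smooth h.smooth h.null hz
  rw [mink_comm] at this
  linear_combination this / 2

theorem mink_wzb (h : IsCanonicalLift U Y) (z) (hz : z ∈ U) : mink (Y z) (wzb Y z) = 0 := by
  have := mink_wzb_of_const h.isOpen h.smooth h.smooth h.null hz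
  rw [mink_comm] at this
  linear_combination this / 2

theorem mink_wz_wz (h : IsCanonicalLift U Y) (z) (hz : z ∈ U) :
    mink (Y z) (wz (wz Y) z) = 0 := by
  have := mink_wz_of_const h.isOpen h.smooth h.smooth_wz h.mink_wz hz
  rw [h.conformal z hz] at this
  linear_combination this

theorem mink_wzb_wz (h : IsCanonicalLift U Y) (z) (hz : z ∈ U) :
    mink (Y z) (wzb (wz Y) z) = -(1 / 2) := by
  have := mink_wzb_of_const h.isOpen h.smooth h.smooth_wz h.mink_wz hz
  rw [h.norm_symm z hz] at this
  linear_combination this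

theorem wz_mink_wz_wz (h : IsCanonicalLift U Y) (z) (hz : z ∈ U) :
    mink (wz Y z) (wz (wz Y) z) = 0 := by
  have := mink_wz_of_const h.isOpen h.smooth_wz h.smooth_wz h.conformal hz
  rw [mink_comm] at this
  linear_combination this / 2

theorem wz_mink_wzb_wz (h : IsCanonicalLift U Y) (z) (hz : z ∈ U) :
    mink (wz Y z) (wzb (wz Y) z) = 0 := by
  have := mink_wzb_of_const h.isOpen h.smooth_wz h.smooth_wz h.conformal hz
  rw [mink_comm] at this
  linear_combination this / 2

theorem wzb_mink_wzb_wz (h : IsCanonicalLift U Y) (z) (hz : z ∈ U) :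
    mink (wzb Y z) (wzb (wz Y) z) = 0 := by
  have := congrArg conj (h.wz_mink_wzb_wz z hz)
  rwa [conj_mink, h.star_wz hz, h.star_wzb_wz hz, map_zero] at this

theorem wzb_mink_wz_wz (h : IsCanonicalLift U Y) (z) (hz : z ∈ U) :
    mink (wzb Y z) (wz (wz Y) z) = 0 := by
  have := mink_wz_of_const h.isOpen h.smooth_wzb h.smooth_wz h.norm_symm hz
  rw [h.wz_wzb hz, mink_comm, h.wz_mink_wzb_wz z hz] at this
  linear_combination this

theorem mink_wzb_wzb (h : IsCanonicalLift U Y) (z) (hz : z ∈ U) :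
    mink (Y z) (wzb (wzb Y) z) = 0 := by
  have := congrArg conj (h.mink_wz_wz z hz)
  rwa [conj_mink, h.real z hz, h.star_wz_wz hz, map_zero] at this

theorem wz_mink_wzb_wzb (h : IsCanonicalLift U Y) (z) (hz : z ∈ U) :
    mink (wz Y z) (wzb (wzb Y) z) = 0 := by
  have := congrArg conj (h.wzb_mink_wz_wz z hz)
  rwa [conj_mink, h.star_wzb hz, h.star_wz_wz hz, map_zero] at this

theorem wzb_mink_wzb_wzb (h : IsCanonicalLift U Y) (z) (hz : z ∈ U) :
    mink (wzb Y z) (wzb (wzb Y) z) = 0 := by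
  have := congrArg conj (h.wz_mink_wz_wz z hz)
  rwa [conj_mink, h.star_wz hz, h.star_wz_wz hz, map_zero] at this

/-- The inner products of `Y`, `Y_z`, `Y_z̄` with all derivatives of `Y` of order at most two. -/
theorem gram (h : IsCanonicalLift U Y) (hz : z ∈ U) :
    (mink (Y z) (Y z) = 0 ∧ mink (Y z) (wz Y z) = 0 ∧ mink (Y z) (wzb Y z) = 0 ∧
      mink (Y z) (wz (wz Y) z) = 0 ∧ mink (Y z) (wzb (wz Y) z) = -(1 / 2) ∧
      mink (Y z) (wzb (wzb Y) z) = 0) ∧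
    (mink (wz Y z) (Y z) = 0 ∧ mink (wz Y z) (wz Y z) = 0 ∧ mink (wz Y z) (wzb Y z) = 1 / 2 ∧
      mink (wz Y z) (wz (wz Y) z) = 0 ∧ mink (wz Y z) (wzb (wz Y) z) = 0 ∧
      mink (wz Y z) (wzb (wzb Y) z) = 0) ∧
    (mink (wzb Y z) (Y z) = 0 ∧ mink (wzb Y z) (wz Y z) = 1 / 2 ∧ mink (wzb Y z) (wzb Y z) = 0 ∧
      mink (wzb Y z) (wz (wz Y) z) = 0 ∧ mink (wzb Y z) (wzb (wz Y) z) = 0 ∧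
      mink (wzb Y z) (wzb (wzb Y) z) = 0) ∧
    (mink (wz (wz Y) z) (Y z) = 0 ∧ mink (wz (wz Y) z) (wz Y z) = 0 ∧
      mink (wz (wz Y) z) (wzb Y z) = 0) ∧
    (mink (wzb (wz Y) z) (Y z) = -(1 / 2) ∧ mink (wzb (wz Y) z) (wz Y z) = 0 ∧
      mink (wzb (wz Y) z) (wzb Y z) = 0) ∧
    (mink (wzb (wzb Y) z) (Y z) = 0 ∧ mink (wzb (wzb Y) z) (wz Y z) = 0 ∧
      mink (wzb (wzb Y) z) (wzb Y z) = 0) := by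
  refine ⟨⟨h.null z hz, h.mink_wz z hz, h.mink_wzb z hz, h.mink_wz_wz z hz, h.mink_wzb_wz z hz,
    h.mink_wzb_wzb z hz⟩, ⟨?_, h.conformal z hz, h.norm z hz, h.wz_mink_wz_wz z hz,
    h.wz_mink_wzb_wz z hz, h.wz_mink_wzb_wzb z hz⟩, ⟨?_, h.norm_symm z hz, h.conformal_bar z hz,
    h.wzb_mink_wz_wz z hz, h.wzb_mink_wzb_wz z hz, h.wzb_mink_wzb_wzb z hz⟩, ⟨?_, ?_, ?_⟩,
    ⟨?_, ?_, ?_⟩, ⟨?_, ?_, ?_⟩⟩ <;> rw [mink_comm]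
  exacts [h.mink_wz z hz, h.mink_wzb z hz, h.mink_wz_wz z hz, h.wz_mink_wz_wz z hz,
    h.wzb_mink_wz_wz z hz, h.mink_wzb_wz z hz, h.wz_mink_wzb_wz z hz, h.wzb_mink_wzb_wz z hz,
    h.mink_wzb_wzb z hz, h.wz_mink_wzb_wzb z hz, h.wzb_mink_wzb_wzb z hz]

end IsCanonicalLift

end Canonical

/-! ### Adapted pairs of lifts -/

section Adapted

variable {n : ℕ} {U : Set ℂ} {Y Z : ℂ → Fin (n + 2) → ℂ} {z : ℂ}

/-- The canonical lift `Y` of a surface together with the lift `Z` of a second surface which is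
normalized by `⟨Y, Z⟩ = -1`, such that both surfaces envelop the 2-spheres
`span {Y, Y_z, Y_z̄, Z}`. -/
structure IsAdaptedPair (U : Set ℂ) (Y Z : ℂ → Fin (n + 2) → ℂ) : Prop
    extends IsCanonicalLift U Y where
  smooth' : ∀ z ∈ U, ContDiffAt ℝ ∞ Z z
  real' : ∀ z ∈ U, star (Z z) = Z z
  null' : ∀ z ∈ U, mink (Z z) (Z z) = 0
  pairing : ∀ z ∈ U, mink (Y z) (Z z) = -1
  conformal' : ∀ z ∈ U, mink (wz Z z) (wz Z z) = 0
  immersed' : ∀ z ∈ U, mink (wz Z z) (wzb Z z) ≠ 0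
  tangent : ∀ z ∈ U, ∃ c₀ c₁ c₂ c₃ : ℂ,
    wz Z z = c₀ • Y z + c₁ • wz Y z + c₂ • wzb Y z + c₃ • Z z

/-- The coefficient `a = ⟨Y_z, Z⟩` of the connection form of the bundle of null lines. -/
noncomputable def connCoef (Y Z : ℂ → Fin (n + 2) → ℂ) (z : ℂ) : ℂ := mink (wz Y z) (Z z)

/-- The coefficient `θ` of `Y_z̄ + ā Y` in `Z_z`, for an adapted pair. -/
noncomputable def thetaCoef (Y Z : ℂ → Fin (n + 2) → ℂ) (z : ℂ) : ℂ :=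
  2 * (mink (wz Y z) (wz Z z) - connCoef Y Z z * connCoef Y Z z)

/-- The coefficient `ρ` of `Y_z + a Y` in `Z_z`, for an adapted pair. -/
noncomputable def rhoCoef (Y Z : ℂ → Fin (n + 2) → ℂ) (z : ℂ) : ℂ :=
  2 * (mink (wzb Y z) (wz Z z) - connCoef Y Z z * conj (connCoef Y Z z))

namespace IsAdaptedPair

theorem smooth_connCoef (h : IsAdaptedPair U Y Z) :
    ∀ z ∈ U, ContDiffAt ℝ ∞ (connCoef Y Z) z :=
  fun z hz => contDiffAt_mink (h.smooth_wz z hz) (h.smooth' z hz)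

theorem smooth_conj {c : ℂ → ℂ} (hc : ContDiffAt ℝ ∞ c z) :
    ContDiffAt ℝ ∞ (fun w => conj (c w)) z :=
  Complex.conjCLE.contDiff.contDiffAt.comp z hc

theorem smooth_thetaCoef (h : IsAdaptedPair U Y Z) :
    ∀ z ∈ U, ContDiffAt ℝ ∞ (thetaCoef Y Z) z :=
  fun z hz => contDiffAt_const.mul ((contDiffAt_mink (h.smooth_wz z hz)
    (contDiffAt_wz (h.smooth' z hz))).sub ((h.smooth_connCoef z hz).mul (h.smooth_connCoef z hz)))

theorem smooth_rhoCoef (h : IsAdaptedPair U Y Z) :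
    ∀ z ∈ U, ContDiffAt ℝ ∞ (rhoCoef Y Z) z :=
  fun z hz => contDiffAt_const.mul ((contDiffAt_mink (h.smooth_wzb z hz)
    (contDiffAt_wz (h.smooth' z hz))).sub
      ((h.smooth_connCoef z hz).mul (smooth_conj (h.smooth_connCoef z hz))))

theorem mink_wzb_right (h : IsAdaptedPair U Y Z) (hz : z ∈ U) :
    mink (wzb Y z) (Z z) = conj (connCoef Y Z z) := by
  rw [connCoef, conj_mink, h.star_wz hz, h.real' z hz]

theorem star_wz' (h : IsAdaptedPair U Y Z) (hz : z ∈ U) : star (wz Z z) = wzb Z z :=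
  star_wz_of_real h.isOpen h.real' hz

theorem mink_left_wz' (h : IsAdaptedPair U Y Z) (hz : z ∈ U) :
    mink (Y z) (wz Z z) = -connCoef Y Z z := by
  have := mink_wz_of_const h.isOpen h.smooth h.smooth' h.pairing hz
  rw [connCoef, this, neg_neg]

theorem mink_wz'_right (h : IsAdaptedPair U Y Z) (hz : z ∈ U) :
    mink (Z z) (wz Z z) = 0 := by
  have := mink_wz_of_const h.isOpen h.smooth' h.smooth' h.null' hz
  rw [mink_comm] at this
  linear_combination this / 2

/-- The structure equation of the second surface. The components of `Z_z` are determined by the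
inner products with `Y, Y_z, Y_z̄, Z`, since the span of these vectors is nondegenerate. -/
theorem wz_right (h : IsAdaptedPair U Y Z) (hz : z ∈ U) :
    wz Z z = connCoef Y Z z • Z z + rhoCoef Y Z z • (wz Y z + connCoef Y Z z • Y z)
      + thetaCoef Y Z z • (wzb Y z + conj (connCoef Y Z z) • Y z) := by
  obtain ⟨c₀, c₁, c₂, c₃, hc⟩ := h.tangent z hz
  obtain ⟨⟨g00, g01, g02, -⟩, ⟨g10, g11, g12, -⟩, ⟨g20, g21, g22, -⟩, -⟩ := h.gram hz
  have ha : mink (wz Y z) (Z z) = connCoef Y Z z := rfl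
  have ha' := h.mink_wzb_right hz
  have e0 := h.mink_left_wz' hz
  have e3 := h.mink_wz'_right hz
  rw [mink_comm] at e3
  rw [hc] at e0 e3
  simp only [mink_add_right, mink_smul_right, mink_add_left, mink_smul_left, g00, g01, g02,
    h.pairing z hz, h.null' z hz, ha, ha'] at e0 e3
  have h3 : c₃ = connCoef Y Z z := by linear_combination -e0
  have h0 : c₀ = c₁ * connCoef Y Z z + c₂ * conj (connCoef Y Z z) := by
    linear_combination -e3
  have hr : rhoCoef Y Z z = c₁ := by
    rw [rhoCoef, hc]
    simp only [mink_add_right, mink_smul_right, g20, g21, g22, ha']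
    rw [h3]; ring
  have ht : thetaCoef Y Z z = c₂ := by
    rw [thetaCoef, hc]
    simp only [mink_add_right, mink_smul_right, g10, g11, g12, ha]
    rw [h3]; ring
  rw [hr, ht, hc, h3, h0]
  module

/-- Conformality of the second surface: only one of the two coefficients survives. -/
theorem theta_mul_rho (h : IsAdaptedPair U Y Z) (hz : z ∈ U) :
    thetaCoef Y Z z * rhoCoef Y Z z = 0 := by
  obtain ⟨⟨g00, g01, g02, -⟩, ⟨g10, g11, g12, -⟩, ⟨g20, g21, g22, -⟩, -⟩ := h.gram hz
  have ha : mink (wz Y z) (Z z) = connCoef Y Z z := rfl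
  have ha' := h.mink_wzb_right hz
  have hc := h.conformal' z hz
  rw [h.wz_right hz] at hc
  simp only [mink_add_right, mink_smul_right, mink_add_left, mink_smul_left, g00, g01, g02, g10,
    g11, g12, g20, g21, g22, h.pairing z hz, h.null' z hz, mink_comm (Z z) (Y z),
    mink_comm (Z z) (wz Y z), mink_comm (Z z) (wzb Y z), ha, ha'] at hc
  linear_combination hc

/-- Otherwise `Z_z` is a multiple of the null vector `Z`, and the second surface is not immersed. -/
theorem theta_ne_zero_or_rho_ne_zero (h : IsAdaptedPair U Y Z) (hz : z ∈ U) :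
    thetaCoef Y Z z ≠ 0 ∨ rhoCoef Y Z z ≠ 0 := by
  by_contra! hc
  apply h.immersed' z hz
  have e := h.wz_right hz
  rw [hc.1, hc.2, zero_smul, zero_smul, add_zero, add_zero] at e
  rw [← h.star_wz' hz, e, star_smul, h.real' z hz]
  simp [h.null' z hz]

end IsAdaptedPair

end Adapted

/-! ### Reality of the mixed derivative -/

section Compat

variable {n : ℕ} {U : Set ℂ} {Y Z : ℂ → Fin (n + 2) → ℂ} {z : ℂ}

theorem star_smul_eq (c : ℂ) (v : Fin (n + 2) → ℂ) : star (c • v) = conj c • star v :=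
  star_smul c v

theorem IsCanonicalLift.star_wzb_wzb (h : IsCanonicalLift U Y) (hz : z ∈ U) :
    star (wzb (wzb Y) z) = wz (wz Y) z := by
  rw [← h.star_wz_wz hz, star_star]

namespace IsAdaptedPair

theorem wzb_right (h : IsAdaptedPair U Y Z) (hz : z ∈ U) :
    wzb Z z = conj (connCoef Y Z z) • Z z
      + conj (rhoCoef Y Z z) • (wzb Y z + conj (connCoef Y Z z) • Y z)
      + conj (thetaCoef Y Z z) • (wz Y z + connCoef Y Z z • Y z) := by
  rw [← h.star_wz' hz, h.wz_right hz]
  simp only [star_add, star_smul_eq, h.real z hz, h.real' z hz, h.star_wz hz, h.star_wzb hz,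
    Complex.conj_conj]

/-- The `z̄`-derivative of the structure equation. -/
theorem wzb_wz_right (h : IsAdaptedPair U Y Z) (hz : z ∈ U) :
    wzb (wz Z) z = wzb (connCoef Y Z) z • Z z + connCoef Y Z z • wzb Z z
      + wzb (rhoCoef Y Z) z • (wz Y z + connCoef Y Z z • Y z)
      + rhoCoef Y Z z • (wzb (wz Y) z + wzb (connCoef Y Z) z • Y z + connCoef Y Z z • wzb Y z)
      + wzb (thetaCoef Y Z) z • (wzb Y z + conj (connCoef Y Z z) • Y z)
      + thetaCoef Y Z z • (wzb (wzb Y) z + conj (wz (connCoef Y Z) z) • Y z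
        + conj (connCoef Y Z z) • wzb Y z) := by
  have d : ∀ {E : Type} [NormedAddCommGroup E] [NormedSpace ℂ E] {F : ℂ → E},
      ContDiffAt ℝ ∞ F z → DifferentiableAt ℝ F z := fun hF => hF.differentiableAt (by simp)
  have dY := d (h.smooth z hz)
  have dY1 := d (h.smooth_wz z hz)
  have dY2 := d (h.smooth_wzb z hz)
  have dZ := d (h.smooth' z hz)
  have da := d (h.smooth_connCoef z hz)
  have dac := d (smooth_conj (h.smooth_connCoef z hz))
  have dr := d (h.smooth_rhoCoef z hz)
  have dt := d (h.smooth_thetaCoef z hz)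
  rw [wzb_congr_on h.isOpen (fun w hw => h.wz_right hw) hz,
    wzb_add ((da.fun_smul dZ).fun_add (dr.fun_smul (dY1.fun_add (da.fun_smul dY))))
      (dt.fun_smul (dY2.fun_add (dac.fun_smul dY))),
    wzb_add (da.fun_smul dZ) (dr.fun_smul (dY1.fun_add (da.fun_smul dY))),
    wzb_smul da dZ, wzb_smul dr (dY1.fun_add (da.fun_smul dY)), wzb_add dY1 (da.fun_smul dY),
    wzb_smul da dY, wzb_smul dt (dY2.fun_add (dac.fun_smul dY)), wzb_add dY2 (dac.fun_smul dY),
    wzb_smul dac dY, wzb_conj]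
  module

theorem star_wzb_wz' (h : IsAdaptedPair U Y Z) (hz : z ∈ U) :
    star (wzb (wz Z) z) = wzb (wz Z) z := by
  rw [← Blaschke.wz_star, wz_congr_on h.isOpen (fun w hw => h.star_wz' hw) hz,
    Blaschke.wz_wzb (h.smooth' z hz)]

/-! ### Pairs that preserve the orientation -/

/-- If `ρ = 0`, the compatibility condition that `Z_zz̄` is real says that `θ` is holomorphic and
that the normal part of `θ̄ Y_zz` is real. -/
theorem compat_of_rho_eq_zero (h : IsAdaptedPair U Y Z) (hr : ∀ z ∈ U, rhoCoef Y Z z = 0)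
    (hz : z ∈ U) : wzb (thetaCoef Y Z) z = 0 ∧
      ∃ c : ℂ, thetaCoef Y Z z • wzb (wzb Y) z - conj (thetaCoef Y Z z) • wz (wz Y) z =
        c • Y z := by
  obtain ⟨⟨g00, g01, g02, g03, g04, g05⟩, ⟨g10, g11, g12, g13, g14, g15⟩, -⟩ := h.gram hz
  have hr' : wzb (rhoCoef Y Z) z = 0 := by
    rw [wzb_congr_on h.isOpen hr hz, wzb_const]
  have e := h.star_wzb_wz' hz
  rw [h.wzb_wz_right hz, h.wzb_right hz, hr z hz, hr'] at e
  simp only [star_add, star_smul_eq, h.real z hz, h.real' z hz, h.star_wz hz, h.star_wzb hz,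
    h.star_wzb_wz hz, h.star_wzb_wzb hz, Complex.conj_conj, map_zero] at e
  have e0 := congrArg (mink (Y z)) e
  have e1 := congrArg (mink (wz Y z)) e
  simp only [mink_add_right, mink_smul_right, g00, g01, g02, g03, g04, g05, g10, g11, g12, g13,
    g14, g15, h.pairing z hz] at e0 e1
  have ha : conj (wzb (connCoef Y Z) z) = wzb (connCoef Y Z) z := by linear_combination -e0
  have ht : wzb (thetaCoef Y Z) z = 0 := by
    rw [ha] at e1
    linear_combination -2 * e1
  refine ⟨ht, conj (connCoef Y Z z) * thetaCoef Y Z z * conj (connCoef Y Z z)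
    + conj (thetaCoef Y Z z) * wz (connCoef Y Z) z
    - connCoef Y Z z * conj (thetaCoef Y Z z) * connCoef Y Z z
    - thetaCoef Y Z z * conj (wz (connCoef Y Z) z), ?_⟩
  rw [ha, ht, map_zero] at e
  linear_combination (norm := module) -e

end IsAdaptedPair

/-! ### Pairs that reverse the orientation -/

/-- The deviation of the mean curvature sphere of `Y` from the enveloped sphere
`span {Y, Y_z, Y_z̄, Z}`, expressed by the component of `Y_zz̄` normal to the latter. -/
noncomputable def sphereDefect (Y Z : ℂ → Fin (n + 2) → ℂ) (z : ℂ) : Fin (n + 2) → ℂ :=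
  wzb (wz Y) z - (1 / 2 : ℂ) • Z z + conj (connCoef Y Z z) • wz Y z + connCoef Y Z z • wzb Y z
    + (mink (wzb (wz Y) z) (Z z) + 2 * connCoef Y Z z * conj (connCoef Y Z z)) • Y z

namespace IsAdaptedPair

/-- If `θ = 0`, the compatibility condition that `Z_zz̄` is real yields three equations. The last
one says that, wherever `ρ` is not real, the enveloped sphere is the mean curvature sphere. -/
theorem compat_of_theta_eq_zero (h : IsAdaptedPair U Y Z) (ht : ∀ z ∈ U, thetaCoef Y Z z = 0)
    (hz : z ∈ U) :
    rhoCoef Y Z z - conj (rhoCoef Y Z z) =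
        2 * (conj (wzb (connCoef Y Z) z) - wzb (connCoef Y Z) z) ∧
      wzb (rhoCoef Y Z) z = 2 * conj (connCoef Y Z z) * rhoCoef Y Z z ∧
      (rhoCoef Y Z z - conj (rhoCoef Y Z z)) • sphereDefect Y Z z = 0 := by
  obtain ⟨⟨g00, g01, g02, g03, g04, g05⟩, ⟨g10, g11, g12, g13, g14, g15⟩,
    ⟨g20, g21, g22, g23, g24, g25⟩, -⟩ := h.gram hz
  have ht' : wzb (thetaCoef Y Z) z = 0 := by
    rw [wzb_congr_on h.isOpen ht hz, wzb_const]
  have e := h.star_wzb_wz' hz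
  rw [h.wzb_wz_right hz, h.wzb_right hz, ht z hz, ht'] at e
  simp only [star_add, star_smul_eq, h.real z hz, h.real' z hz, h.star_wz hz, h.star_wzb hz,
    h.star_wzb_wz hz, h.star_wzb_wzb hz, Complex.conj_conj, map_zero] at e
  -- The components of the condition along the enveloped sphere.
  have e0 := congrArg (mink (Y z)) e
  have e2 := congrArg (mink (wzb Y z)) e
  have e3 := congrArg (mink (Z z)) e
  simp only [mink_add_right, mink_smul_right, g00, g01, g02, g03, g04, g05, g20, g21, g22, g23,
    g24, g25, h.pairing z hz, h.mink_wzb_right hz, mink_comm (Z z) (Y z),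
    mink_comm (Z z) (wz Y z), mink_comm (Z z) (wzb Y z), h.null' z hz,
    show mink (wz Y z) (Z z) = connCoef Y Z z from rfl] at e0 e2 e3
  have h1 : rhoCoef Y Z z - conj (rhoCoef Y Z z) =
      2 * (conj (wzb (connCoef Y Z) z) - wzb (connCoef Y Z) z) := by
    linear_combination 2 * e0
  have h2 : wzb (rhoCoef Y Z) z = 2 * conj (connCoef Y Z z) * rhoCoef Y Z z := by
    linear_combination -2 * e2 - conj (connCoef Y Z z) * h1
  refine ⟨h1, h2, ?_⟩
  rw [h2] at e e3
  simp only [map_mul, Complex.conj_conj, map_ofNat] at e e3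
  have h3 : wzb (connCoef Y Z) z = conj (wzb (connCoef Y Z) z)
    - (rhoCoef Y Z z - conj (rhoCoef Y Z z)) / 2 := by linear_combination h1 / 2
  rw [sphereDefect, mink_comm (wzb (wz Y) z)]
  generalize conj (wzb (connCoef Y Z) z) = b at e e3 h3
  rw [h3] at e e3
  linear_combination (norm := module) (-1 : ℂ) • e - e3 • Y z

end IsAdaptedPair

end Compat

/-! ### The elliptic system and the reflection -/

section Reflection

variable {n : ℕ} {U : Set ℂ} {Y Z : ℂ → Fin (n + 2) → ℂ} {z : ℂ}

theorem differentiableAt_of_contDiffAt {E : Type*} [NormedAddCommGroup E] [NormedSpace ℝ E]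
    {F : ℂ → E} (hF : ContDiffAt ℝ ∞ F z) : DifferentiableAt ℝ F z :=
  hF.differentiableAt (by simp)

theorem wz_apply {F : ℂ → Fin (n + 2) → ℂ} (hF : DifferentiableAt ℝ F z) (i : Fin (n + 2)) :
    wz (fun w => F w i) z = wz F z i := by
  have := fun a => congrArg (fun L : ℂ →L[ℝ] ℂ => L a) (hasFDerivAt_pi'.1 hF.hasFDerivAt i).fderiv
  simp only [wz, this]
  simp

theorem wzb_apply {F : ℂ → Fin (n + 2) → ℂ} (hF : DifferentiableAt ℝ F z) (i : Fin (n + 2)) :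
    wzb (fun w => F w i) z = wzb F z i := by
  have := fun a => congrArg (fun L : ℂ →L[ℝ] ℂ => L a) (hasFDerivAt_pi'.1 hF.hasFDerivAt i).fderiv
  simp only [wzb, this]
  simp

namespace IsAdaptedPair

/-- The first-order system satisfied by `ρ - ρ̄` and `ρ_z - 2 a ρ`. Unique continuation for this
system is what makes the reality of `ρ` propagate. -/
theorem elliptic_system (h : IsAdaptedPair U Y Z) (ht : ∀ z ∈ U, thetaCoef Y Z z = 0)
    (hz : z ∈ U) :
    wzb (fun w => rhoCoef Y Z w - conj (rhoCoef Y Z w)) z =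
        2 * conj (connCoef Y Z z) * (rhoCoef Y Z z - conj (rhoCoef Y Z z))
          - conj (wz (rhoCoef Y Z) z - 2 * (connCoef Y Z z * rhoCoef Y Z z)) ∧
      wzb (fun w => wz (rhoCoef Y Z) w - 2 * (connCoef Y Z w * rhoCoef Y Z w)) z =
        2 * conj (connCoef Y Z z) * (wz (rhoCoef Y Z) z - 2 * (connCoef Y Z z * rhoCoef Y Z z))
          + rhoCoef Y Z z * (rhoCoef Y Z z - conj (rhoCoef Y Z z)) := by
  have sr := h.smooth_rhoCoef z hz
  have dr := differentiableAt_of_contDiffAt sr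
  have drc := differentiableAt_of_contDiffAt (smooth_conj sr)
  have dr1 := differentiableAt_of_contDiffAt (contDiffAt_wz sr)
  have da := differentiableAt_of_contDiffAt (h.smooth_connCoef z hz)
  have dac := differentiableAt_of_contDiffAt (smooth_conj (h.smooth_connCoef z hz))
  obtain ⟨h1, h2, -⟩ := h.compat_of_theta_eq_zero ht hz
  constructor
  · rw [wzb_sub dr drc, wzb_conj, h2]
    simp only [map_sub, map_mul, map_ofNat]
    ring
  · have h3 : wzb (wz (rhoCoef Y Z)) z = 2 * (conj (wzb (connCoef Y Z) z) * rhoCoef Y Z z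
        + conj (connCoef Y Z z) * wz (rhoCoef Y Z) z) := by
      rw [← wz_wzb sr, wz_congr_on (G := fun w => 2 * (conj (connCoef Y Z w) * rhoCoef Y Z w))
        h.isOpen (fun w hw => by rw [(h.compat_of_theta_eq_zero ht hw).2.1]; ring) hz,
        wz_const_mul _ (dac.fun_mul dr), wz_mul dac dr, wz_conj]
    rw [wzb_sub dr1 ((da.fun_mul dr).const_mul _), wzb_const_mul _ (da.fun_mul dr),
      wzb_mul da dr, h2, h3, h1]
    ring

/-- If `θ = 0` and `ρ` is real, the direction of `Z - ρ Y` is constant, and the reflection in this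
direction interchanges the two surfaces. -/
theorem reflection_of_rho_real (h : IsAdaptedPair U Y Z) (hU : IsPreconnected U)
    (ht : ∀ z ∈ U, thetaCoef Y Z z = 0) (hr : ∀ z ∈ U, conj (rhoCoef Y Z z) = rhoCoef Y Z z)
    (hr0 : ∀ z ∈ U, rhoCoef Y Z z ≠ 0) {z₀ : ℂ} (hz₀ : z₀ ∈ U) :
    ∃ X : Fin (n + 2) → ℂ, star X = X ∧ mink X X ≠ 0 ∧ ∀ z ∈ U,
      Z z = rhoCoef Y Z z • (Y z - (2 * mink (Y z) X / mink X X) • X) := by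
  set ρ := rhoCoef Y Z with hρ
  set a := connCoef Y Z with ha
  let W : ℂ → Fin (n + 2) → ℂ := fun w => Z w - ρ w • Y w
  have dY := fun z hz => differentiableAt_of_contDiffAt (h.smooth z hz)
  have dZ := fun z hz => differentiableAt_of_contDiffAt (h.smooth' z hz)
  have dr := fun z hz => differentiableAt_of_contDiffAt (h.smooth_rhoCoef z hz)
  have hrzb : ∀ z ∈ U, wzb ρ z = 2 * conj (a z) * ρ z :=
    fun z hz => (h.compat_of_theta_eq_zero ht hz).2.1
  have hrz : ∀ z ∈ U, wz ρ z = 2 * a z * ρ z := by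
    intro z hz
    have := wz_conj (c := ρ) (z := z)
    rw [wz_congr_on h.isOpen hr hz, hrzb z hz] at this
    rw [this]
    simp only [map_mul, map_ofNat, Complex.conj_conj, hr z hz]
  have dW : ∀ z ∈ U, DifferentiableAt ℝ W z :=
    fun z hz => (dZ z hz).fun_sub ((dr z hz).fun_smul (dY z hz))
  have hWz : ∀ z ∈ U, wz W z = a z • W z := by
    intro z hz
    rw [wz_sub (dZ z hz) ((dr z hz).fun_smul (dY z hz)), wz_smul (dr z hz) (dY z hz), hrz z hz,
      h.wz_right hz, ht z hz]
    simp only [W]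
    module
  have hWreal : ∀ z ∈ U, star (W z) = W z := by
    intro z hz
    simp only [W, star_sub, star_smul_eq, h.real' z hz, h.real z hz, hr z hz]
  have hWzb : ∀ z ∈ U, wzb W z = conj (a z) • W z := by
    intro z hz
    rw [← star_wz_of_real h.isOpen hWreal hz, hWz z hz, star_smul_eq, hWreal z hz]
  have hWW : ∀ z ∈ U, mink (W z) (W z) = 2 * ρ z := by
    intro z hz
    simp only [W, mink_sub_left, mink_sub_right, mink_smul_left, mink_smul_right, h.null z hz,
      h.null' z hz, h.pairing z hz, mink_comm (Z z) (Y z)]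
    ring
  -- Both `W ⊗ W` and `ρ` are parallel up to the factor `2 a`, so that the functions
  -- `W i * W j / ρ` are constant and determine a constant direction.
  have hconst : ∀ i j, ∀ z ∈ U, W z i * W z j * (ρ z)⁻¹ = W z₀ i * W z₀ j * (ρ z₀)⁻¹ := by
    intro i j z hz
    have dWi := fun i z hz => differentiableAt_pi.1 (dW z hz) i
    have df : ∀ z ∈ U, DifferentiableAt ℝ (fun w => W w i * W w j * (ρ w)⁻¹) z :=
      fun z hz => ((dWi i z hz).fun_mul (dWi j z hz)).fun_mul ((dr z hz).inv (hr0 z hz))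
    have hf : ∀ z ∈ U, W z i * W z j = W z i * W z j * (ρ z)⁻¹ * ρ z :=
      fun z hz => (inv_mul_cancel_right₀ (hr0 z hz) _).symm
    refine eq_of_wz_eq_zero (F := fun w => W w i * W w j * (ρ w)⁻¹) h.isOpen hU df
      (fun z hz => ?_) (fun z hz => ?_) hz hz₀
    · have e := wz_congr_on h.isOpen hf hz
      rw [wz_mul (dWi i z hz) (dWi j z hz), wz_apply (dW z hz), wz_apply (dW z hz),
        wz_mul (df z hz) (dr z hz), hWz z hz, hrz z hz] at e
      simp only [Pi.smul_apply, smul_eq_mul] at e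
      apply mul_right_cancel₀ (hr0 z hz)
      linear_combination -e + 2 * a z * hf z hz
    · have e := wzb_congr_on h.isOpen hf hz
      rw [wzb_mul (dWi i z hz) (dWi j z hz), wzb_apply (dW z hz), wzb_apply (dW z hz),
        wzb_mul (df z hz) (dr z hz), hWzb z hz, hrzb z hz] at e
      simp only [Pi.smul_apply, smul_eq_mul] at e
      apply mul_right_cancel₀ (hr0 z hz)
      linear_combination -e + 2 * conj (a z) * hf z hz
  have hne : W z₀ ≠ 0 := fun h0 => hr0 z₀ hz₀ (by
    have := hWW z₀ hz₀
    rw [h0, mink_zero_left] at this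
    linear_combination -this / 2)
  obtain ⟨j, hj⟩ := Function.ne_iff.1 hne
  refine ⟨W z₀, hWreal z₀ hz₀, ?_, fun z hz => ?_⟩
  · rw [hWW z₀ hz₀]; exact mul_ne_zero two_ne_zero (hr0 z₀ hz₀)
  obtain ⟨t, ht0, hWt⟩ : ∃ t : ℂ, t ≠ 0 ∧ W z = t • W z₀ := by
    have e := fun i => hconst i j z hz
    have hj' : W z j ≠ 0 := by
      intro h0
      have := e j
      rw [h0] at this
      simp [hr0 z₀ hz₀] at this
      exact hj this
    have hρz := hr0 z hz
    have hρ0 := hr0 z₀ hz₀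
    refine ⟨ρ z * W z₀ j / (ρ z₀ * W z j), by
      refine div_ne_zero (mul_ne_zero hρz hj) (mul_ne_zero hρ0 hj'), ?_⟩
    ext i
    have := e i
    rw [Pi.smul_apply, smul_eq_mul]
    field_simp at this ⊢
    linear_combination this
  have hWX : mink (Y z) (W z) = -1 := by
    simp [W, h.pairing z hz, h.null z hz]
  have e1 : t * mink (Y z) (W z₀) = -1 := by rw [← mink_smul_right, ← hWt, hWX]
  have e2 : t * (t * mink (W z₀) (W z₀)) = 2 * ρ z := by
    rw [← mink_smul_right, ← mink_smul_left, ← hWt, hWW z hz]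
  have e3 : (2 * mink (Y z) (W z₀) / mink (W z₀) (W z₀)) • W z₀ = (-1 / ρ z) • W z := by
    have hρz := hr0 z hz
    have h0 : mink (W z₀) (W z₀) ≠ 0 := by
      intro h0; rw [h0] at e2; simp at e2; exact hρz e2
    rw [hWt, smul_smul]
    congr 1
    field_simp
    apply mul_left_cancel₀ ht0
    linear_combination 2 * ρ z * e1 + e2
  rw [e3, smul_sub, smul_smul, mul_div_cancel₀ _ (hr0 z hz)]
  simp only [W]
  module

end IsAdaptedPair

end Reflection

/-! ### Hopf differential, Schwarzian and mean curvature sphere -/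

section Surface

variable {n : ℕ} {U : Set ℂ} {g : ℂ → Sph n} {Z : ℂ → Fin (n + 2) → ℂ} {z : ℂ}

theorem frameN_eq (g : ℂ → Sph n) (z : ℂ) : frameN g z = (2 : ℂ) • wzb (wz (canonLift g)) z +
    (2 * mink (wzb (wz (canonLift g)) z) (wzb (wz (canonLift g)) z)) • canonLift g z := rfl

theorem hopf_eq (g : ℂ → Sph n) (z : ℂ) : hopf g z =
    wz (wz (canonLift g)) z + (schwarzian g z / 2) • canonLift g z := rfl

theorem schwarzian_eq (g : ℂ → Sph n) (z : ℂ) :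
    schwarzian g z = 2 * mink (wz (wz (canonLift g)) z) (frameN g z) := rfl

theorem normalProj_eq (g : ℂ → Sph n) (z : ℂ) (v : Fin (n + 2) → ℂ) : normalProj g z v =
    v + mink v (frameN g z) • canonLift g z + mink v (canonLift g z) • frameN g z
      - (2 * mink v (wzb (canonLift g) z)) • wz (canonLift g) z
      - (2 * mink v (wz (canonLift g) z)) • wzb (canonLift g) z := rfl

theorem normalProj_add (g : ℂ → Sph n) (z : ℂ) (v w : Fin (n + 2) → ℂ) :
    normalProj g z (v + w) = normalProj g z v + normalProj g z w := by
  simp only [normalProj_eq, mink_add_left]; module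

theorem normalProj_smul (g : ℂ → Sph n) (z c : ℂ) (v : Fin (n + 2) → ℂ) :
    normalProj g z (c • v) = c • normalProj g z v := by
  simp only [normalProj_eq, mink_smul_left]; module

namespace IsCanonicalLift

theorem mink_frameN (h : IsCanonicalLift U (canonLift g)) (hz : z ∈ U) :
    mink (canonLift g z) (frameN g z) = -1 ∧ mink (wz (canonLift g) z) (frameN g z) = 0 ∧
      mink (wzb (canonLift g) z) (frameN g z) = 0 ∧ mink (frameN g z) (frameN g z) = 0 := by
  obtain ⟨⟨g00, g01, g02, g03, g04, g05⟩, ⟨g10, g11, g12, g13, g14, g15⟩,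
    ⟨g20, g21, g22, g23, g24, g25⟩, -, ⟨g40, -⟩, -⟩ := h.gram hz
  rw [frameN_eq]
  simp only [mink_add_right, mink_smul_right, mink_add_left, mink_smul_left, g00, g04, g40, g10,
    g14, g20, g24]
  refine ⟨?_, ?_, ?_, ?_⟩ <;> ring

theorem star_frameN (h : IsCanonicalLift U (canonLift g)) (hz : z ∈ U) :
    star (frameN g z) = frameN g z := by
  rw [frameN_eq, star_add, star_smul_eq, star_smul_eq, map_mul, conj_mink, h.star_wzb_wz hz,
    h.real z hz, map_ofNat]

theorem smooth_schwarzian (h : IsCanonicalLift U (canonLift g)) (z) (hz : z ∈ U) :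
    ContDiffAt ℝ ∞ (schwarzian g) z := by
  have s11 := contDiffAt_wz (h.smooth_wz z hz)
  have s12 := contDiffAt_wzb (h.smooth_wz z hz)
  have sN : ContDiffAt ℝ ∞ (frameN g) z :=
    ((contDiffAt_const (c := (2 : ℂ))).smul s12).add
      (((contDiffAt_const (c := (2 : ℂ))).mul (contDiffAt_mink s12 s12)).smul (h.smooth z hz))
  exact contDiffAt_const.mul (contDiffAt_mink s11 sN)

/-- The Hopf differential is a section of the normal bundle. -/
theorem mink_hopf (h : IsCanonicalLift U (canonLift g)) (hz : z ∈ U) :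
    mink (hopf g z) (canonLift g z) = 0 ∧ mink (hopf g z) (wz (canonLift g) z) = 0 ∧
      mink (hopf g z) (wzb (canonLift g) z) = 0 ∧ mink (hopf g z) (frameN g z) = 0 := by
  obtain ⟨⟨g00, g01, g02, -⟩, -, -, ⟨g30, g31, g32⟩, -⟩ := h.gram hz
  rw [hopf_eq]
  simp only [mink_add_left, mink_smul_left, g00, g01, g02, g30, g31, g32,
    (h.mink_frameN hz).1]
  refine ⟨by ring, by ring, by ring, ?_⟩
  rw [schwarzian_eq]; ring

theorem normalProj_hopf (h : IsCanonicalLift U (canonLift g)) (hz : z ∈ U) :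
    normalProj g z (hopf g z) = hopf g z := by
  obtain ⟨h0, h1, h2, h3⟩ := h.mink_hopf hz
  rw [normalProj_eq, h0, h1, h2, h3]
  module

theorem normalProj_canonLift (h : IsCanonicalLift U (canonLift g)) (hz : z ∈ U) :
    normalProj g z (canonLift g z) = 0 := by
  obtain ⟨⟨g00, g01, g02, -⟩, -⟩ := h.gram hz
  rw [normalProj_eq, (h.mink_frameN hz).1, g00, g01, g02]
  module

theorem normalProj_wz (h : IsCanonicalLift U (canonLift g)) (hz : z ∈ U) :
    normalProj g z (wz (canonLift g) z) = 0 := by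
  obtain ⟨-, ⟨g10, g11, g12, -⟩, -⟩ := h.gram hz
  rw [normalProj_eq, (h.mink_frameN hz).2.1, g10, g11, g12]
  module

theorem normalProj_wzb (h : IsCanonicalLift U (canonLift g)) (hz : z ∈ U) :
    normalProj g z (wzb (canonLift g) z) = 0 := by
  obtain ⟨-, -, ⟨g20, g21, g22, -⟩, -⟩ := h.gram hz
  rw [normalProj_eq, (h.mink_frameN hz).2.2.1, g20, g21, g22]
  module

theorem normalProj_frameN (h : IsCanonicalLift U (canonLift g)) (hz : z ∈ U) :
    normalProj g z (frameN g z) = 0 := by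
  obtain ⟨h0, h1, h2, h3⟩ := h.mink_frameN hz
  rw [normalProj_eq, mink_comm _ (canonLift g z), mink_comm _ (wz (canonLift g) z),
    mink_comm _ (wzb (canonLift g) z), h0, h1, h2, h3]
  module

theorem normalProj_wzb_wz (h : IsCanonicalLift U (canonLift g)) (hz : z ∈ U) :
    normalProj g z (wzb (wz (canonLift g)) z) = 0 := by
  have e := h.normalProj_frameN hz
  rw [frameN_eq, normalProj_add, normalProj_smul, normalProj_smul,
    h.normalProj_canonLift hz, smul_zero, add_zero] at e
  exact (smul_eq_zero.1 e).resolve_left two_ne_zero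

theorem normalProj_wz_wz (h : IsCanonicalLift U (canonLift g)) (hz : z ∈ U) :
    normalProj g z (wz (wz (canonLift g)) z) = hopf g z := by
  have e := h.normalProj_hopf hz
  rwa [hopf_eq, normalProj_add, normalProj_smul, h.normalProj_canonLift hz, smul_zero,
    add_zero, ← hopf_eq] at e

/-- The vectors `Y, Y_z, Y_z̄, Y_zz̄` are linearly independent, since their Gram matrix is
regular. -/
theorem linearIndependent (h : IsCanonicalLift U (canonLift g)) (hz : z ∈ U) :
    LinearIndependent ℂ ![canonLift g z, wz (canonLift g) z, wzb (canonLift g) z,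
      wzb (wz (canonLift g)) z] := by
  obtain ⟨⟨g00, g01, g02, g03, g04, g05⟩, ⟨g10, g11, g12, g13, g14, g15⟩,
    ⟨g20, g21, g22, g23, g24, g25⟩, -, ⟨g40, g41, g42⟩, -⟩ := h.gram hz
  rw [Fintype.linearIndependent_iff]
  intro c hc
  simp only [Fin.sum_univ_four] at hc
  change c 0 • canonLift g z + c 1 • wz (canonLift g) z + c 2 • wzb (canonLift g) z
    + c 3 • wzb (wz (canonLift g)) z = 0 at hc
  have e0 := congrArg (mink (canonLift g z)) hc
  have e1 := congrArg (mink (wz (canonLift g) z)) hc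
  have e2 := congrArg (mink (wzb (canonLift g) z)) hc
  have e3 := congrArg (mink (wzb (wz (canonLift g)) z)) hc
  simp only [mink_add_right, mink_smul_right, mink_zero_right, g00, g01, g02, g04, g10, g11, g12,
    g14, g20, g21, g22, g24, g40, g41, g42] at e0 e1 e2 e3
  have h3 : c 3 = 0 := by linear_combination -2 * e0
  have h2 : c 2 = 0 := by linear_combination 2 * e1
  have h1 : c 1 = 0 := by linear_combination 2 * e2
  have h0 : c 0 = 0 := by
    rw [h3] at e3
    linear_combination -2 * e3
  intro i
  fin_cases i
  exacts [h0, h1, h2, h3]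

theorem meanSphere_eq_range (g : ℂ → Sph n) (z : ℂ) : meanSphere g z =
    Submodule.span ℂ (Set.range ![canonLift g z, wz (canonLift g) z, wzb (canonLift g) z,
      wzb (wz (canonLift g)) z]) := by
  rw [meanSphere]
  congr 1
  ext v
  simp only [dz_eq_wz, dzbar_eq_wzb, Set.mem_insert_iff, Set.mem_singleton_iff, @eq_comm _ v,
    Matrix.range_cons, Matrix.range_empty, Set.mem_union, Set.mem_empty_iff_false, or_false]

theorem finrank_meanSphere (h : IsCanonicalLift U (canonLift g)) (hz : z ∈ U) :
    Module.finrank ℂ (meanSphere g z) = 4 := by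
  rw [meanSphere_eq_range, finrank_span_eq_card (h.linearIndependent hz), Fintype.card_fin]

/-- If `Y_zz - Y_z̄z̄` is a multiple of `Y`, then the Hopf differential is real. -/
theorem star_hopf (h : IsCanonicalLift U (canonLift g)) (hz : z ∈ U) {c : ℂ}
    (hc : wzb (wzb (canonLift g)) z - wz (wz (canonLift g)) z = c • canonLift g z) :
    star (hopf g z) = hopf g z := by
  have e1 := (h.mink_hopf hz).2.2.2
  have e2 := congrArg conj e1
  rw [conj_mink, h.star_frameN hz, map_zero] at e2
  have e3 : star (hopf g z) - hopf g z =
      (c + (conj (schwarzian g z) - schwarzian g z) / 2) • canonLift g z := by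
    have e4 : conj (schwarzian g z / 2) = conj (schwarzian g z) / 2 := by
      rw [map_div₀, map_ofNat]
    rw [hopf_eq, star_add, star_smul_eq, h.star_wz_wz hz, h.real z hz, e4]
    linear_combination (norm := module) hc
  have e5 := congrArg (mink · (frameN g z)) e3
  simp only [mink_sub_left, mink_smul_left, e1, e2, (h.mink_frameN hz).1] at e5
  have e6 : c + (conj (schwarzian g z) - schwarzian g z) / 2 = 0 := by linear_combination e5
  rw [e6, zero_smul] at e3
  exact sub_eq_zero.1 e3

end IsCanonicalLift

namespace IsAdaptedPair

/-- If `ρ = 0` and `θ` is a real constant, then the coordinate is a curvature line coordinate. -/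
theorem isIsothermicCoordOn (h : IsAdaptedPair U (canonLift g) Z)
    (hr : ∀ z ∈ U, rhoCoef (canonLift g) Z z = 0) {r : ℝ} (hr0 : r ≠ 0)
    (ht : ∀ z ∈ U, thetaCoef (canonLift g) Z z = r) : IsIsothermicCoordOn g U := by
  intro z hz
  obtain ⟨-, c, hc⟩ := h.compat_of_rho_eq_zero hr hz
  rw [ht z hz, Complex.conj_ofReal, ← smul_sub] at hc
  have hr1 : (r : ℂ) ≠ 0 := by exact_mod_cast hr0
  refine h.star_hopf hz (c := (r : ℂ)⁻¹ * c) ?_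
  rw [mul_smul, ← hc, smul_smul, inv_mul_cancel₀ hr1, one_smul]

/-- If the enveloped sphere is the mean curvature sphere, then the second surface is given by the
formula for the dual surface, with `μ = 2 a`. -/
theorem right_eq_of_sphereDefect_eq_zero (h : IsAdaptedPair U (canonLift g) Z) (hz : z ∈ U)
    (hd : sphereDefect (canonLift g) Z z = 0) :
    Z z = (2 * connCoef (canonLift g) Z z * conj (connCoef (canonLift g) Z z)) • canonLift g z
      + (2 * conj (connCoef (canonLift g) Z z)) • wz (canonLift g) z
      + (2 * connCoef (canonLift g) Z z) • wzb (canonLift g) z + frameN g z := by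
  obtain ⟨⟨g00, g01, g02, g03, g04, g05⟩, ⟨g10, g11, g12, g13, g14, g15⟩,
    ⟨g20, g21, g22, g23, g24, g25⟩, -, ⟨g40, g41, g42⟩, -⟩ := h.gram hz
  rw [sphereDefect] at hd
  set a := connCoef (canonLift g) Z z
  have e : Z z = (2 : ℂ) • wzb (wz (canonLift g)) z + (2 * conj a) • wz (canonLift g) z
      + (2 * a) • wzb (canonLift g) z
      + (2 * (mink (wzb (wz (canonLift g)) z) (Z z) + 2 * a * conj a)) • canonLift g z := by
    linear_combination (norm := module) (-2 : ℂ) • hd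
  have e' := congrArg (mink (wzb (wz (canonLift g)) z)) e
  simp only [mink_add_right, mink_smul_right, g40, g41, g42] at e'
  have e1 : mink (wzb (wz (canonLift g)) z) (Z z) =
      mink (wzb (wz (canonLift g)) z) (wzb (wz (canonLift g)) z) - a * conj a := by
    linear_combination e' / 2
  rw [e1] at e
  rw [frameN_eq, e]
  module

section Dual

variable (h : IsAdaptedPair U (canonLift g) Z) (ht : ∀ z ∈ U, thetaCoef (canonLift g) Z z = 0)
  (hd : ∀ z ∈ U, sphereDefect (canonLift g) Z z = 0)

theorem normalProj_right {h : IsAdaptedPair U (canonLift g) Z}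
    (hd : ∀ z ∈ U, sphereDefect (canonLift g) Z z = 0) (hz : z ∈ U) :
    normalProj g z (Z z) = 0 := by
  rw [h.right_eq_of_sphereDefect_eq_zero hz (hd z hz)]
  simp only [normalProj_add, normalProj_smul, h.normalProj_canonLift hz, h.normalProj_wz hz,
    h.normalProj_wzb hz, h.normalProj_frameN hz]
  module

include h ht hd

/-- `D_z̄ κ = -ā κ`. Since `Y_zz̄` lies in the enveloped sphere, `Y_zzz̄` can be computed from the
structure equation, and its only normal part comes from the term `-ā Y_zz`. -/
theorem normalDzbar_hopf (hz : z ∈ U) :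
    normalDzbar g (hopf g) z = -conj (connCoef (canonLift g) Z z) • hopf g z := by
  set Y := canonLift g with hY
  set a := connCoef Y Z with ha
  have dY := differentiableAt_of_contDiffAt (h.smooth z hz)
  have dY1 := differentiableAt_of_contDiffAt (h.smooth_wz z hz)
  have dY2 := differentiableAt_of_contDiffAt (h.smooth_wzb z hz)
  have dY11 := differentiableAt_of_contDiffAt (contDiffAt_wz (h.smooth_wz z hz))
  have dZ := differentiableAt_of_contDiffAt (h.smooth' z hz)
  have da := differentiableAt_of_contDiffAt (h.smooth_connCoef z hz)
  have dac := differentiableAt_of_contDiffAt (smooth_conj (h.smooth_connCoef z hz))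
  have ds := differentiableAt_of_contDiffAt (h.smooth_schwarzian z hz)
  let c : ℂ → ℂ := fun w => mink (wzb (wz Y) w) (Z w) + 2 * a w * conj (a w)
  have dc : DifferentiableAt ℝ c z := (differentiableAt_of_contDiffAt (contDiffAt_mink
    (contDiffAt_wzb (h.smooth_wz z hz)) (h.smooth' z hz))).fun_add ((da.const_mul 2).fun_mul dac)
  -- Differentiate the expression of `Y_zz̄` in terms of the enveloped sphere.
  have e1 : wzb (wz (wz Y)) z = wz (wzb (wz Y)) z := (Blaschke.wz_wzb (h.smooth_wz z hz)).symm
  have e2 : ∀ w ∈ U, wzb (wz Y) w = (1 / 2 : ℂ) • Z w - (conj (a w) • wz Y w + a w • wzb Y w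
      + c w • Y w) := by
    intro w hw
    have := hd w hw
    rw [sphereDefect] at this
    simp only [c]
    linear_combination (norm := module) this
  have d1 := dac.fun_smul dY1
  have d2 := da.fun_smul dY2
  have d3 := dc.fun_smul dY
  rw [wz_congr_on h.isOpen e2 hz, wz_sub (dZ.fun_const_smul _) ((d1.fun_add d2).fun_add d3),
    wz_const_smul _ dZ, wz_add (d1.fun_add d2) d3, wz_add d1 d2, wz_smul dac dY1, wz_smul da dY2,
    wz_smul dc dY, h.wz_wzb hz, h.wz_right hz, ht z hz] at e1
  have e3 : wzb (hopf g) z = wzb (wz (wz Y)) z + ((wzb (schwarzian g) z / 2) • Y z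
      + (schwarzian g z / 2) • wzb Y z) := by
    have : hopf g = fun w => wz (wz Y) w + ((1 / 2 : ℂ) * schwarzian g w) • Y w := by
      funext w; rw [hopf_eq]; congr 2; ring
    rw [this, wzb_add dY11 ((ds.const_mul _).fun_smul dY), wzb_smul (ds.const_mul _) dY,
      wzb_const_mul _ ds]
    module
  rw [normalDzbar, dzbar_eq_wzb, e3, e1, sub_eq_add_neg, ← neg_one_smul ℂ]
  simp only [normalProj_add, normalProj_smul, hY, h.normalProj_canonLift hz, h.normalProj_wz hz,
    h.normalProj_wzb hz, h.normalProj_wzb_wz hz, h.normalProj_wz_wz hz,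
    normalProj_right (h := h) hd hz]
  module

/-- The Schwarzian, from the inner product of `Y_zz` with the formula for `Z`. -/
theorem schwarzian_eq_of_sphereDefect_eq_zero (hz : z ∈ U) : schwarzian g z =
    2 * (wz (connCoef (canonLift g) Z) z
      - connCoef (canonLift g) Z z * connCoef (canonLift g) Z z) := by
  obtain ⟨-, ⟨g10, g11, g12, -⟩, -, ⟨g30, g31, g32⟩, -⟩ := h.gram hz
  have e := congrArg (mink (wz (wz (canonLift g)) z))
    (h.right_eq_of_sphereDefect_eq_zero hz (hd z hz))
  simp only [mink_add_right, mink_smul_right, g30, g31, g32] at e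
  have e1 : wz (connCoef (canonLift g) Z) z = _ :=
    wz_mink (differentiableAt_of_contDiffAt (h.smooth_wz z hz))
      (differentiableAt_of_contDiffAt (h.smooth' z hz))
  rw [h.wz_right hz, ht z hz] at e1
  simp only [mink_add_right, mink_smul_right, g10, g11, g12] at e1
  rw [show mink (wz (canonLift g) z) (Z z) = connCoef (canonLift g) Z z from rfl] at e1
  rw [schwarzian_eq]
  linear_combination -2 * e - 2 * e1

/-- The Willmore equation follows by applying `D_z̄ κ = -ā κ` twice, as `s = 2 (a_z - a²)`. -/
theorem isSWillmoreOn : IsSWillmoreOn g U := by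
  refine ⟨fun z hz => ?_, fun z hz hli => ?_⟩
  · have hh : ∀ w ∈ U, normalDzbar g (hopf g) w =
        (-conj (connCoef (canonLift g) Z w)) • hopf g w :=
      fun w hw => normalDzbar_hopf h ht hd hw
    have dac := (differentiableAt_of_contDiffAt (smooth_conj (h.smooth_connCoef z hz))).fun_neg
    have dh : DifferentiableAt ℝ (hopf g) z := differentiableAt_of_contDiffAt
      ((contDiffAt_wz (h.smooth_wz z hz)).add
        (((h.smooth_schwarzian z hz).div_const 2).smul (h.smooth z hz)))
    have hn : wzb (fun w => -conj (connCoef (canonLift g) Z w)) z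
        = -conj (wz (connCoef (canonLift g) Z) z) := by
      rw [← wzb_conj, ← neg_one_mul, ← wzb_const_mul]
      · simp only [neg_one_mul]
      · exact differentiableAt_of_contDiffAt (smooth_conj (h.smooth_connCoef z hz))
    have e := hh z hz
    rw [normalDzbar, dzbar_eq_wzb] at e
    rw [normalDzbar, dzbar_eq_wzb, wzb_congr_on h.isOpen hh hz, wzb_smul dac dh, hn,
      normalProj_add, normalProj_smul, normalProj_smul, h.normalProj_hopf hz, e,
      schwarzian_eq_of_sphereDefect_eq_zero h ht hd hz]
    simp only [map_mul, map_sub, map_ofNat]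
    module
  · rw [normalDzbar_hopf h ht hd hz] at hli
    have := LinearIndependent.pair_iff.1 hli (conj (connCoef (canonLift g) Z z)) 1 (by module)
    exact one_ne_zero this.2

/-- A lift of the second surface has its derivatives up to `∂²/∂z∂z̄` in the mean curvature sphere
of the first one. -/
theorem wzb_wz_smul_mem_meanSphere {σ : ℂ → ℂ} (hσ : ∀ z ∈ U, ContDiffAt ℝ ∞ σ z) (hz : z ∈ U) :
    σ z • Z z ∈ meanSphere g z ∧ wz (fun w => σ w • Z w) z ∈ meanSphere g z ∧
      wzb (fun w => σ w • Z w) z ∈ meanSphere g z ∧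
      wzb (wz fun w => σ w • Z w) z ∈ meanSphere g z := by
  have m0 : canonLift g z ∈ meanSphere g z := Submodule.subset_span (by simp)
  have m1 : wz (canonLift g) z ∈ meanSphere g z :=
    Submodule.subset_span (by simp [dz_eq_wz, dzbar_eq_wzb])
  have m2 : wzb (canonLift g) z ∈ meanSphere g z :=
    Submodule.subset_span (by simp [dz_eq_wz, dzbar_eq_wzb])
  have m3 : wzb (wz (canonLift g)) z ∈ meanSphere g z :=
    Submodule.subset_span (by simp [dz_eq_wz, dzbar_eq_wzb])
  have add := fun x y => (meanSphere g z).add_mem (x := x) (y := y)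
  have smul := fun (c : ℂ) x => (meanSphere g z).smul_mem (x := x) c
  have mN : frameN g z ∈ meanSphere g z := add _ _ (smul _ _ m3) (smul _ _ m0)
  have mZ : Z z ∈ meanSphere g z := by
    rw [h.right_eq_of_sphereDefect_eq_zero hz (hd z hz)]
    exact add _ _ (add _ _ (add _ _ (smul _ _ m0) (smul _ _ m1)) (smul _ _ m2)) mN
  have mZ1 : wz Z z ∈ meanSphere g z := by
    rw [h.wz_right hz]
    exact add _ _ (add _ _ (smul _ _ mZ) (smul _ _ (add _ _ m1 (smul _ _ m0))))
      (smul _ _ (add _ _ m2 (smul _ _ m0)))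
  have mZ2 : wzb Z z ∈ meanSphere g z := by
    rw [h.wzb_right hz]
    exact add _ _ (add _ _ (smul _ _ mZ) (smul _ _ (add _ _ m2 (smul _ _ m0))))
      (smul _ _ (add _ _ m1 (smul _ _ m0)))
  have mZ12 : wzb (wz Z) z ∈ meanSphere g z := by
    have ht' : wzb (thetaCoef (canonLift g) Z) z = 0 := by
      rw [wzb_congr_on h.isOpen ht hz, wzb_const]
    rw [h.wzb_wz_right hz, ht', ht z hz, zero_smul, zero_smul, add_zero, add_zero]
    exact add _ _ (add _ _ (add _ _ (smul _ _ mZ) (smul _ _ mZ2))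
      (smul _ _ (add _ _ m1 (smul _ _ m0))))
      (smul _ _ (add _ _ (add _ _ m3 (smul _ _ m0)) (smul _ _ m2)))
  have dσ := fun z hz => differentiableAt_of_contDiffAt (hσ z hz)
  have dσ1 := differentiableAt_of_contDiffAt (contDiffAt_wz (hσ z hz))
  have dZ := fun z hz => differentiableAt_of_contDiffAt (h.smooth' z hz)
  have dZ1 := differentiableAt_of_contDiffAt (contDiffAt_wz (h.smooth' z hz))
  refine ⟨smul _ _ mZ, ?_, ?_, ?_⟩
  · rw [wz_smul (dσ z hz) (dZ z hz)]
    exact add _ _ (smul _ _ mZ) (smul _ _ mZ1)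
  · rw [wzb_smul (dσ z hz) (dZ z hz)]
    exact add _ _ (smul _ _ mZ) (smul _ _ mZ2)
  · rw [wzb_congr_on h.isOpen (fun w hw => wz_smul (dσ w hw) (dZ w hw)) hz,
      wzb_add (dσ1.fun_smul (dZ z hz)) ((dσ z hz).fun_smul dZ1), wzb_smul dσ1 (dZ z hz),
      wzb_smul (dσ z hz) dZ1]
    exact add _ _ (add _ _ (smul _ _ mZ) (smul _ _ mZ2)) (add _ _ (smul _ _ mZ1) (smul _ _ mZ12))

end Dual

end IsAdaptedPair

end Surface

/-! ### Unique continuation for `∂/∂z̄` -/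

section UniqueContinuation

open MeasureTheory

theorem contDiff_wz {f : ℂ → ℂ} (hf : ContDiff ℝ ∞ f) : ContDiff ℝ ∞ (wz f) :=
  contDiff_iff_contDiffAt.2 fun _ => contDiffAt_wz hf.contDiffAt

theorem contDiff_wzb {f : ℂ → ℂ} (hf : ContDiff ℝ ∞ f) : ContDiff ℝ ∞ (wzb f) :=
  contDiff_iff_contDiffAt.2 fun _ => contDiffAt_wzb hf.contDiffAt

theorem hasCompactSupport_wzb {f : ℂ → ℂ} (hf : HasCompactSupport f) :
    HasCompactSupport (wzb f) :=
  (hf.fderiv ℝ).comp_left (g := fun L : ℂ →L[ℝ] ℂ => (1 / 2 : ℂ) • (L 1 + Complex.I • L Complex.I))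
    (by simp)

theorem integral_fderiv_eq_zero {f : ℂ → ℂ} (hf : ContDiff ℝ ∞ f) (hc : HasCompactSupport f)
    (v : ℂ) : ∫ z, fderiv ℝ f z v = 0 := by
  have h1 : Continuous fun z => fderiv ℝ f z v :=
    (hf.continuous_fderiv (by simp)).clm_apply continuous_const
  have h2 : HasCompactSupport fun z => fderiv ℝ f z v := hc.fderiv_apply ℝ v
  have h3 := h1.integrable_of_hasCompactSupport (μ := volume) h2
  have h := integral_mul_fderiv_eq_neg_fderiv_mul_of_integrable (μ := (volume : Measure ℂ))
    (f := fun _ : ℂ => (1 : ℂ)) (g := f) (v := v) (by simp) (by simpa using h3)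
    (by simpa using hf.continuous.integrable_of_hasCompactSupport hc)
    (fun x _ => differentiableAt_const _) (fun x _ => hf.differentiable (by simp) x)
  simpa using h

theorem integrable_fderiv {f : ℂ → ℂ} (hf : ContDiff ℝ ∞ f) (hc : HasCompactSupport f)
    (v : ℂ) : Integrable (fun z => fderiv ℝ f z v) :=
  ((hf.continuous_fderiv (by simp)).clm_apply continuous_const).integrable_of_hasCompactSupport
    (hc.fderiv_apply ℝ v)

theorem integral_wz_eq_zero {f : ℂ → ℂ} (hf : ContDiff ℝ ∞ f) (hc : HasCompactSupport f) :
    ∫ z, wz f z = 0 := by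
  simp only [wz, smul_eq_mul]
  rw [integral_const_mul, integral_sub (integrable_fderiv hf hc _)
    ((integrable_fderiv hf hc _).const_mul _), integral_const_mul, integral_fderiv_eq_zero hf hc,
    integral_fderiv_eq_zero hf hc]
  simp

theorem integral_wzb_eq_zero {f : ℂ → ℂ} (hf : ContDiff ℝ ∞ f) (hc : HasCompactSupport f) :
    ∫ z, wzb f z = 0 := by
  simp only [wzb, smul_eq_mul]
  rw [integral_const_mul, integral_add (integrable_fderiv hf hc _)
    ((integrable_fderiv hf hc _).const_mul _), integral_const_mul, integral_fderiv_eq_zero hf hc,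
    integral_fderiv_eq_zero hf hc]
  simp

theorem wz_cexp {f : ℂ → ℂ} {z : ℂ} (hf : DifferentiableAt ℝ f z) :
    wz (fun w => Complex.exp (f w)) z = wz f z * Complex.exp (f z) := by
  simp only [wz, (hf.hasFDerivAt.cexp).fderiv, smul_apply, smul_eq_mul]
  ring

theorem wzb_cexp {f : ℂ → ℂ} {z : ℂ} (hf : DifferentiableAt ℝ f z) :
    wzb (fun w => Complex.exp (f w)) z = wzb f z * Complex.exp (f z) := by
  simp only [wzb, (hf.hasFDerivAt.cexp).fderiv, smul_apply, smul_eq_mul]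
  ring

theorem wz_sub_const (c z : ℂ) : wz (fun w => w - c) z = 1 := by
  simp [wz, fderiv_sub_const]
  norm_num

theorem wzb_sub_const (c z : ℂ) : wzb (fun w => w - c) z = 0 := by
  simp [wzb, fderiv_sub_const]

/-- The weight `exp (τ |z - c|²)`, as a complex valued function. -/
noncomputable def gaussWeight (τ : ℝ) (c z : ℂ) : ℂ := Complex.exp (τ * ((z - c) * conj (z - c)))

theorem contDiff_gaussWeight (τ : ℝ) (c : ℂ) : ContDiff ℝ ∞ (gaussWeight τ c) := by
  have h1 : ContDiff ℝ ∞ fun z : ℂ => z - c := contDiff_id.sub contDiff_const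
  exact (contDiff_const.mul (h1.mul (Complex.conjCLE.contDiff.comp h1))).cexp

theorem wz_gaussWeight (τ : ℝ) (c z : ℂ) :
    wz (gaussWeight τ c) z = τ * conj (z - c) * gaussWeight τ c z ∧
      wzb (gaussWeight τ c) z = τ * (z - c) * gaussWeight τ c z := by
  have h1 : DifferentiableAt ℝ (fun z : ℂ => z - c) z := by fun_prop
  have h2 : DifferentiableAt ℝ (fun z : ℂ => conj (z - c)) z :=
    Complex.conjCLE.differentiableAt.comp z h1
  have h3 := (h1.fun_mul h2).const_mul (τ : ℂ)
  unfold gaussWeight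
  rw [wz_cexp h3, wzb_cexp h3, wz_const_mul _ (h1.fun_mul h2), wzb_const_mul _ (h1.fun_mul h2),
    wz_mul h1 h2, wzb_mul h1 h2, wz_conj, wzb_conj, wz_sub_const, wzb_sub_const]
  simp

theorem integrable_exp_mul_norm_sq (τ : ℝ) (c : ℂ) {F : ℂ → ℂ} (hF : Continuous F)
    (hF' : HasCompactSupport F) :
    Integrable fun z => Real.exp (τ * ‖z - c‖ ^ 2) * ‖F z‖ ^ 2 := by
  have ce : Continuous fun z : ℂ => Real.exp (τ * ‖z - c‖ ^ 2) := by fun_prop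
  have h : HasCompactSupport fun z => ‖F z‖ ^ 2 :=
    hF'.comp_left (g := fun x : ℂ => ‖x‖ ^ 2) (by simp)
  exact (ce.mul (hF.norm.pow 2)).integrable_of_hasCompactSupport h.mul_left

/-- The Carleman inequality: integrate the identity
`E |v_z̄|² - E |E⁻¹ (E v)_z|² - τ E |v|² = (E v_z̄ v̄)_z - ((E v)_z v̄)_z̄` with
`E = exp (τ |z - c|²)`. -/
theorem carleman_inequality (τ : ℝ) (c : ℂ) {v : ℂ → ℂ} (hv : ContDiff ℝ ∞ v)
    (hc : HasCompactSupport v) :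
    τ * ∫ z, Real.exp (τ * ‖z - c‖ ^ 2) * ‖v z‖ ^ 2 ≤
      ∫ z, Real.exp (τ * ‖z - c‖ ^ 2) * ‖wzb v z‖ ^ 2 := by
  let E := gaussWeight τ c
  let δ : ℂ → ℂ := fun z => wz v z + τ * conj (z - c) * v z
  have sE : ContDiff ℝ ∞ E := contDiff_gaussWeight τ c
  have svc : ContDiff ℝ ∞ fun z => conj (v z) := Complex.conjCLE.contDiff.comp hv
  have hconj : ContDiff ℝ ∞ fun z : ℂ => conj (z - c) :=
    Complex.conjCLE.contDiff.comp (contDiff_id.sub contDiff_const)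
  have sδ : ContDiff ℝ ∞ δ := (contDiff_wz hv).add ((contDiff_const.mul hconj).mul hv)
  have cvc : HasCompactSupport fun z => conj (v z) := hc.comp_left (map_zero _)
  have s1 := (sE.mul (contDiff_wzb hv)).mul svc
  have s2 := (sE.mul sδ).mul svc
  have c1 : HasCompactSupport fun z => E z * wzb v z * conj (v z) := cvc.mul_left
  have c2 : HasCompactSupport fun z => E z * δ z * conj (v z) := cvc.mul_left
  have key : ∀ z, (((Real.exp (τ * ‖z - c‖ ^ 2) * ‖wzb v z‖ ^ 2
      - Real.exp (τ * ‖z - c‖ ^ 2) * ‖δ z‖ ^ 2) - τ * (Real.exp (τ * ‖z - c‖ ^ 2) * ‖v z‖ ^ 2) : ℝ)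
        : ℂ) = wz (fun z => E z * wzb v z * conj (v z)) z
          - wzb (fun z => E z * δ z * conj (v z)) z := by
    intro z
    have d : ∀ {F : ℂ → ℂ}, ContDiff ℝ ∞ F → DifferentiableAt ℝ F z :=
      fun hF => hF.differentiable (by simp) z
    rw [wz_mul ((d sE).fun_mul (d (contDiff_wzb hv))) (d svc),
      wz_mul (d sE) (d (contDiff_wzb hv)), wzb_mul ((d sE).fun_mul (d sδ)) (d svc),
      wzb_mul (d sE) (d sδ),
      wzb_add (d (contDiff_wz hv)) (d ((contDiff_const.mul hconj).mul hv)),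
      wzb_mul (d (contDiff_const.mul hconj)) (d hv), wzb_const_mul _ (d hconj), wzb_conj, wzb_conj,
      wz_conj, wz_sub_const, wz_wzb hv.contDiffAt, (wz_gaussWeight τ c z).1,
      (wz_gaussWeight τ c z).2]
    push_cast
    have hE : Complex.exp (τ * ((z - c) * conj (z - c))) = E z := rfl
    simp only [← Complex.mul_conj', hE]
    simp only [δ, map_add, map_mul, Complex.conj_ofReal, Complex.conj_conj, map_one, E]
    ring
  have hint : ∫ z, ((Real.exp (τ * ‖z - c‖ ^ 2) * ‖wzb v z‖ ^ 2
      - Real.exp (τ * ‖z - c‖ ^ 2) * ‖δ z‖ ^ 2) - τ * (Real.exp (τ * ‖z - c‖ ^ 2) * ‖v z‖ ^ 2))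
        = 0 := by
    have i1 : Integrable (wz fun z => E z * wzb v z * conj (v z)) := by
      exact ((integrable_fderiv s1 c1 _).sub ((integrable_fderiv s1 c1 _).const_mul _)).const_mul _
    have i2 : Integrable (wzb fun z => E z * δ z * conj (v z)) := by
      exact ((integrable_fderiv s2 c2 _).add ((integrable_fderiv s2 c2 _).const_mul _)).const_mul _
    have := integral_sub i1 i2
    rw [integral_wz_eq_zero s1 c1, integral_wzb_eq_zero s2 c2, sub_zero] at this
    simp only [← key] at this
    rw [integral_complex_ofReal] at this
    exact_mod_cast this
  have cδ : HasCompactSupport δ :=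
    ((hc.fderiv ℝ).comp_left
      (g := fun L : ℂ →L[ℝ] ℂ => (1 / 2 : ℂ) • (L 1 - Complex.I • L Complex.I)) (by simp)).add
      hc.mul_left
  have j1 := integrable_exp_mul_norm_sq τ c (contDiff_wzb hv).continuous (hasCompactSupport_wzb hc)
  have j2 := integrable_exp_mul_norm_sq τ c sδ.continuous cδ
  have j3 := integrable_exp_mul_norm_sq τ c hv.continuous hc
  have j12 : Integrable fun z => Real.exp (τ * ‖z - c‖ ^ 2) * ‖wzb v z‖ ^ 2
      - Real.exp (τ * ‖z - c‖ ^ 2) * ‖δ z‖ ^ 2 := j1.sub j2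
  rw [integral_sub j12 (j3.const_mul τ), integral_sub j1 j2, integral_const_mul] at hint
  have : 0 ≤ ∫ z, Real.exp (τ * ‖z - c‖ ^ 2) * ‖δ z‖ ^ 2 :=
    integral_nonneg fun z => by positivity
  linarith

theorem wzb_eq_zero_of_differentiableAt {q : ℂ → ℂ} {z : ℂ} (hq : DifferentiableAt ℂ q z) :
    wzb q z = 0 := by
  have h := (differentiableAt_complex_iff_differentiableAt_real.1 hq).2
  rw [wzb, h, smul_smul, Complex.I_mul_I]
  simp

/-- Multiplication by a power of `R / (z - c)` preserves the smoothness of functions that vanish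
near `c` and commutes with `∂/∂z̄`. -/
theorem wzb_pow_div_mul {f : ℂ → ℂ} (hf : ContDiff ℝ ∞ f) {c : ℂ} {ε : ℝ} (hε : 0 < ε)
    (h0 : ∀ z ∈ Metric.ball c ε, f z = 0) (R : ℂ) (k : ℕ) :
    ContDiff ℝ ∞ (fun z => (R / (z - c)) ^ k * f z) ∧
      ∀ z, wzb (fun z => (R / (z - c)) ^ k * f z) z = (R / (z - c)) ^ k * wzb f z := by
  have near : ∀ z ∈ Metric.ball c ε, ((fun z => (R / (z - c)) ^ k * f z) =ᶠ[nhds z] fun _ => 0) ∧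
      f =ᶠ[nhds z] fun _ => 0 := fun z hz => by
    have := Metric.isOpen_ball.mem_nhds hz
    constructor <;> filter_upwards [this] with w hw <;> simp [h0 w hw]
  have hq : ∀ z, z ≠ c → ContDiffAt ℂ ∞ (fun z => (R / (z - c)) ^ k) z := fun z hz =>
    (contDiffAt_const.div (contDiffAt_id.sub contDiffAt_const) (sub_ne_zero.2 hz)).pow k
  constructor
  · refine contDiff_iff_contDiffAt.2 fun z => ?_
    by_cases hz : z ∈ Metric.ball c ε
    · exact contDiffAt_const.congr_of_eventuallyEq (near z hz).1
    · have hzc : z ≠ c := by rintro rfl; exact hz (Metric.mem_ball_self hε)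
      exact ((hq z hzc).restrict_scalars ℝ).mul hf.contDiffAt
  · intro z
    by_cases hz : z ∈ Metric.ball c ε
    · rw [wzb_congr (near z hz).1, wzb_congr (near z hz).2, wzb_const, mul_zero]
    · have hzc : z ≠ c := by rintro rfl; exact hz (Metric.mem_ball_self hε)
      have hd := (hq z hzc).differentiableAt (by simp)
      rw [wzb_mul (hd.restrictScalars ℝ) (hf.differentiable (by simp) z),
        wzb_eq_zero_of_differentiableAt hd]
      ring

/-- The Carleman inequality with the singular weight `|R / (z - c)| ^ (2 k) exp (τ |z - c|²)`, for
functions that vanish near `c`. -/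
theorem carleman_inequality_singular (τ R : ℝ) {f : ℂ → ℂ} (hf : ContDiff ℝ ∞ f)
    (hfc : HasCompactSupport f) {c : ℂ} {ε : ℝ} (hε : 0 < ε)
    (h0 : ∀ z ∈ Metric.ball c ε, f z = 0) (k : ℕ) :
    Integrable (fun z => Real.exp (τ * ‖z - c‖ ^ 2) *
        ((‖(R : ℂ) / (z - c)‖ ^ 2) ^ k * ‖f z‖ ^ 2)) ∧
      Integrable (fun z => Real.exp (τ * ‖z - c‖ ^ 2) *
        ((‖(R : ℂ) / (z - c)‖ ^ 2) ^ k * ‖wzb f z‖ ^ 2)) ∧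
      τ * ∫ z, Real.exp (τ * ‖z - c‖ ^ 2) * ((‖(R : ℂ) / (z - c)‖ ^ 2) ^ k * ‖f z‖ ^ 2) ≤
        ∫ z, Real.exp (τ * ‖z - c‖ ^ 2) * ((‖(R : ℂ) / (z - c)‖ ^ 2) ^ k * ‖wzb f z‖ ^ 2) := by
  obtain ⟨sv, dv⟩ := wzb_pow_div_mul hf hε h0 (R : ℂ) k
  have cv : HasCompactSupport fun z => ((R : ℂ) / (z - c)) ^ k * f z := hfc.mul_left
  have e1 : ∀ z, ‖((R : ℂ) / (z - c)) ^ k * f z‖ ^ 2 =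
      (‖(R : ℂ) / (z - c)‖ ^ 2) ^ k * ‖f z‖ ^ 2 := fun z => by
    rw [norm_mul, norm_pow, mul_pow, pow_right_comm]
  have e2 : ∀ z, ‖wzb (fun z => ((R : ℂ) / (z - c)) ^ k * f z) z‖ ^ 2 =
      (‖(R : ℂ) / (z - c)‖ ^ 2) ^ k * ‖wzb f z‖ ^ 2 := fun z => by
    rw [dv, norm_mul, norm_pow, mul_pow, pow_right_comm]
  simp only [← e1, ← e2]
  exact ⟨integrable_exp_mul_norm_sq τ c sv.continuous cv, integrable_exp_mul_norm_sq τ c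
    (contDiff_wzb sv).continuous (hasCompactSupport_wzb cv), carleman_inequality τ c sv cv⟩

/-- The two-function form of the singular Carleman inequality. -/
theorem carleman_inequality_singular_add (τ R : ℝ) {f₁ f₂ : ℂ → ℂ} (h₁ : ContDiff ℝ ∞ f₁)
    (h₂ : ContDiff ℝ ∞ f₂) (c₁ : HasCompactSupport f₁) (c₂ : HasCompactSupport f₂) {c : ℂ} {ε : ℝ}
    (hε : 0 < ε) (h0 : ∀ z ∈ Metric.ball c ε, f₁ z = 0 ∧ f₂ z = 0) (k : ℕ) :
    Integrable (fun z => Real.exp (τ * ‖z - c‖ ^ 2) *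
        ((‖(R : ℂ) / (z - c)‖ ^ 2) ^ k * (‖f₁ z‖ ^ 2 + ‖f₂ z‖ ^ 2))) ∧
      Integrable (fun z => Real.exp (τ * ‖z - c‖ ^ 2) *
        ((‖(R : ℂ) / (z - c)‖ ^ 2) ^ k * (‖wzb f₁ z‖ ^ 2 + ‖wzb f₂ z‖ ^ 2))) ∧
      τ * ∫ z, Real.exp (τ * ‖z - c‖ ^ 2) *
          ((‖(R : ℂ) / (z - c)‖ ^ 2) ^ k * (‖f₁ z‖ ^ 2 + ‖f₂ z‖ ^ 2)) ≤
        ∫ z, Real.exp (τ * ‖z - c‖ ^ 2) *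
          ((‖(R : ℂ) / (z - c)‖ ^ 2) ^ k * (‖wzb f₁ z‖ ^ 2 + ‖wzb f₂ z‖ ^ 2)) := by
  obtain ⟨a1, a2, a3⟩ := carleman_inequality_singular τ R h₁ c₁ hε (fun z hz => (h0 z hz).1) k
  obtain ⟨b1, b2, b3⟩ := carleman_inequality_singular τ R h₂ c₂ hε (fun z hz => (h0 z hz).2) k
  simp only [mul_add]
  refine ⟨a1.add b1, a2.add b2, ?_⟩
  rw [integral_add a1 b1, integral_add a2 b2, mul_add]
  exact add_le_add a3 b3

/-- Letting the exponent of the singular weight tend to infinity: a nonnegative function `S` that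
vanishes at `c` and satisfies uniform bounds with respect to these weights vanishes on the disc. -/
theorem eq_zero_of_weighted_bound {S : ℂ → ℝ} (cS : Continuous S) (hS0 : ∀ z, 0 ≤ S z)
    {c : ℂ} (hc : S c = 0) {R τ K : ℝ} (hτ : 0 ≤ τ)
    (hi : ∀ k : ℕ, Integrable fun z => Real.exp (τ * ‖z - c‖ ^ 2) *
      ((‖(R : ℂ) / (z - c)‖ ^ 2) ^ k * S z))
    (hK : ∀ k : ℕ, ∫ z, Real.exp (τ * ‖z - c‖ ^ 2) * ((‖(R : ℂ) / (z - c)‖ ^ 2) ^ k * S z) ≤ K)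
    {z : ℂ} (hz : ‖z - c‖ < R) : S z = 0 := by
  obtain ⟨r, hr1, hr2⟩ := exists_between hz
  have hr0 : 0 < r := (norm_nonneg _).trans_lt hr1
  have hR0 : 0 < R := hr0.trans hr2
  have iS : IntegrableOn S (Metric.ball c r) :=
    (cS.continuousOn.integrableOn_compact (isCompact_closedBall c r)).mono_set
      Metric.ball_subset_closedBall
  have lower : ∀ k : ℕ, ((R / r) ^ 2) ^ k * ∫ z in Metric.ball c r, S z ≤ K := by
    intro k
    refine le_trans ?_ (hK k)
    have hpos : ∀ z, 0 ≤ Real.exp (τ * ‖z - c‖ ^ 2) * ((‖(R : ℂ) / (z - c)‖ ^ 2) ^ k * S z) :=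
      fun z => mul_nonneg (Real.exp_pos _).le (mul_nonneg (by positivity) (hS0 z))
    rw [← integral_const_mul]
    refine (setIntegral_mono_on (iS.const_mul _) (hi k).integrableOn measurableSet_ball ?_).trans
      (setIntegral_le_integral (hi k) (Filter.Eventually.of_forall hpos))
    intro z hz
    by_cases hzc : z = c
    · simp [hzc, hc]
    · have hz' : ‖z - c‖ < r := by simpa [dist_eq_norm] using hz
      have hpos : 0 < ‖z - c‖ := norm_pos_iff.2 (sub_ne_zero.2 hzc)
      have hq : (R / r) ^ 2 ≤ ‖(R : ℂ) / (z - c)‖ ^ 2 := by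
        simp only [norm_div, Complex.norm_real, Real.norm_eq_abs, abs_of_pos hR0]
        gcongr
      calc ((R / r) ^ 2) ^ k * S z ≤ (‖(R : ℂ) / (z - c)‖ ^ 2) ^ k * S z :=
            mul_le_mul_of_nonneg_right (pow_le_pow_left₀ (by positivity) hq k) (hS0 z)
        _ ≤ _ := le_mul_of_one_le_left (mul_nonneg (by positivity) (hS0 z))
            (Real.one_le_exp (by positivity))
  have hI : ∫ z in Metric.ball c r, S z = 0 := by
    by_contra hne
    have hpos : 0 < ∫ z in Metric.ball c r, S z :=
      lt_of_le_of_ne (integral_nonneg hS0) (Ne.symm hne)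
    have hgt : 1 < (R / r) ^ 2 := one_lt_pow₀ ((one_lt_div hr0).2 hr2) two_ne_zero
    obtain ⟨k, hk⟩ := pow_unbounded_of_one_lt (K / ∫ z in Metric.ball c r, S z) hgt
    rw [div_lt_iff₀ hpos] at hk
    exact absurd (lower k) (not_le.2 hk)
  have hae := (setIntegral_eq_zero_iff_of_nonneg_ae
    (Filter.Eventually.of_forall hS0) iS).1 hI
  exact Measure.eqOn_open_of_ae_eq hae Metric.isOpen_ball cS.continuousOn continuousOn_const
    (by simpa [dist_eq_norm] using hr1)

/-- Unique continuation for compactly supported functions. -/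
theorem unique_continuation_of_hasCompactSupport {f₁ f₂ : ℂ → ℂ} (h₁ : ContDiff ℝ ∞ f₁)
    (h₂ : ContDiff ℝ ∞ f₂) (c₁ : HasCompactSupport f₁) (c₂ : HasCompactSupport f₂) {c : ℂ}
    {R ε C : ℝ} (hε : 0 < ε) (hC : 0 ≤ C)
    (hf : ∀ z, ‖z - c‖ < R → ‖wzb f₁ z‖ ^ 2 + ‖wzb f₂ z‖ ^ 2 ≤ C * (‖f₁ z‖ ^ 2 + ‖f₂ z‖ ^ 2))
    (h0 : ∀ z ∈ Metric.ball c ε, f₁ z = 0 ∧ f₂ z = 0) {z : ℂ} (hz : ‖z - c‖ < R) :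
    f₁ z = 0 ∧ f₂ z = 0 := by
  have hR0 : 0 < R := (norm_nonneg _).trans_lt hz
  -- With `τ = C + 1` the inequality absorbs the term with the factor `C` and still bounds the
  -- weighted norm of the functions by the contribution from outside of the disc.
  have I := carleman_inequality_singular_add (C + 1) R h₁ h₂ c₁ c₂ hε h0
  obtain ⟨S, hS⟩ : ∃ S : ℂ → ℝ, S = fun z => ‖f₁ z‖ ^ 2 + ‖f₂ z‖ ^ 2 := ⟨_, rfl⟩
  obtain ⟨D, hD⟩ : ∃ D : ℂ → ℝ, D = fun z => ‖wzb f₁ z‖ ^ 2 + ‖wzb f₂ z‖ ^ 2 := ⟨_, rfl⟩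
  have hS0 : ∀ z, 0 ≤ S z := fun z => by rw [hS]; positivity
  have hD0 : ∀ z, 0 ≤ D z := fun z => by rw [hD]; positivity
  have cS : Continuous S := by
    rw [hS]; exact (h₁.continuous.norm.pow 2).add (h₂.continuous.norm.pow 2)
  have hc : S c = 0 := by
    simp [hS, h0 c (Metric.mem_ball_self hε)]
  replace hf : ∀ z, ‖z - c‖ < R → D z ≤ C * S z := by rw [hS, hD]; exact hf
  simp only [← congrFun hS, ← congrFun hD] at I
  have pointwise : ∀ z, ∀ k : ℕ,
      Real.exp ((C + 1) * ‖z - c‖ ^ 2) * ((‖(R : ℂ) / (z - c)‖ ^ 2) ^ k * D z) ≤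
        C * (Real.exp ((C + 1) * ‖z - c‖ ^ 2) * ((‖(R : ℂ) / (z - c)‖ ^ 2) ^ k * S z))
          + Real.exp ((C + 1) * ‖z - c‖ ^ 2) * D z := by
    intro z k
    have hE0 := (Real.exp_pos ((C + 1) * ‖z - c‖ ^ 2)).le
    have hq0 : 0 ≤ (‖(R : ℂ) / (z - c)‖ ^ 2) ^ k := by positivity
    by_cases hz : ‖z - c‖ < R
    · have := mul_le_mul_of_nonneg_left (mul_le_mul_of_nonneg_left (hf z hz) hq0) hE0
      have h2 := mul_nonneg hE0 (hD0 z)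
      linarith
    · have hz' : R ≤ ‖z - c‖ := not_lt.1 hz
      have hq1 : ‖(R : ℂ) / (z - c)‖ ^ 2 ≤ 1 := by
        simp only [norm_div, Complex.norm_real, Real.norm_eq_abs, abs_of_pos hR0]
        exact pow_le_one₀ (by positivity) ((div_le_one (hR0.trans_le hz')).2 hz')
      have h1 := mul_le_mul_of_nonneg_left (mul_le_of_le_one_left (hD0 z)
        (pow_le_one₀ (n := k) (by positivity) hq1)) hE0
      have h2 := mul_nonneg hC (mul_nonneg hE0 (mul_nonneg hq0 (hS0 z)))
      linarith
  have hSz := eq_zero_of_weighted_bound (K := ∫ z, Real.exp ((C + 1) * ‖z - c‖ ^ 2) * D z)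
    cS hS0 hc (by positivity : 0 ≤ C + 1) (fun k => (I k).1) (fun k => ?_) hz
  · rw [hS] at hSz
    have e1 : ‖f₁ z‖ ^ 2 = 0 := by nlinarith [sq_nonneg ‖f₁ z‖, sq_nonneg ‖f₂ z‖]
    have e2 : ‖f₂ z‖ ^ 2 = 0 := by nlinarith [sq_nonneg ‖f₁ z‖, sq_nonneg ‖f₂ z‖]
    exact ⟨by simpa using e1, by simpa using e2⟩
  · obtain ⟨i1, i2, i3⟩ := I k
    have i0 := (I 0).2.1
    simp only [pow_zero, one_mul] at i0
    have e := integral_mono i2 ((i1.const_mul C).add i0) (fun z => pointwise z k)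
    have e' := integral_add (i1.const_mul C) i0
    rw [integral_const_mul] at e'
    have e'' := e.trans_eq e'
    linarith

/-- Unique continuation: a solution of a differential inequality `|∂w/∂z̄|² ≤ C |w|²` on a disc
vanishes if it vanishes near the center. -/
theorem unique_continuation {w₁ w₂ : ℂ → ℂ} {c : ℂ} {R ε C : ℝ} (hε : 0 < ε) (hC : 0 ≤ C)
    (h₁ : ∀ z ∈ Metric.ball c R, ContDiffAt ℝ ∞ w₁ z)
    (h₂ : ∀ z ∈ Metric.ball c R, ContDiffAt ℝ ∞ w₂ z)
    (hw : ∀ z ∈ Metric.ball c R,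
      ‖wzb w₁ z‖ ^ 2 + ‖wzb w₂ z‖ ^ 2 ≤ C * (‖w₁ z‖ ^ 2 + ‖w₂ z‖ ^ 2))
    (h0 : ∀ z ∈ Metric.ball c ε, w₁ z = 0 ∧ w₂ z = 0) :
    ∀ z ∈ Metric.ball c R, w₁ z = 0 ∧ w₂ z = 0 := by
  intro z₁ hz₁
  obtain ⟨R₁, hR1, hR1'⟩ := exists_between (show ‖z₁ - c‖ < R by simpa [dist_eq_norm] using hz₁)
  obtain ⟨R₂, hR2, hR2'⟩ := exists_between hR1'
  have hR0 : 0 < R₁ := (norm_nonneg _).trans_lt hR1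
  let χ : ContDiffBump c := ⟨R₁, R₂, hR0, hR2⟩
  let f : (ℂ → ℂ) → ℂ → ℂ := fun w z => (χ z : ℂ) * w z
  have hχs : ∀ z, ContDiffAt ℝ ∞ (fun z => ((χ z : ℝ) : ℂ)) z := fun z =>
    Complex.ofRealCLM.contDiff.contDiffAt.comp z χ.contDiffAt
  have sf : ∀ w : ℂ → ℂ, (∀ z ∈ Metric.ball c R, ContDiffAt ℝ ∞ w z) → ContDiff ℝ ∞ (f w) := by
    intro w hw
    refine contDiff_iff_contDiffAt.2 fun z => ?_
    by_cases hz : z ∈ Metric.ball c R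
    · exact (hχs z).mul (hw z hz)
    · have hz' : z ∉ tsupport χ := by
        rw [χ.tsupport_eq]
        exact fun h => hz (Metric.closedBall_subset_ball hR2' h)
      refine contDiffAt_const (c := (0 : ℂ)) |>.congr_of_eventuallyEq ?_
      filter_upwards [notMem_tsupport_iff_eventuallyEq.1 hz'] with y hy
      simp [f, hy]
  have cf : ∀ w : ℂ → ℂ, HasCompactSupport (f w) := fun w =>
    (χ.hasCompactSupport.comp_left (g := fun x : ℝ => (x : ℂ)) (by simp)).mul_right
  have fin : ∀ w : ℂ → ℂ, ∀ z, ‖z - c‖ < R₁ → f w =ᶠ[nhds z] w := by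
    intro w z hz
    have hz' : z ∈ Metric.ball c χ.rIn := by simpa [dist_eq_norm] using hz
    filter_upwards [χ.eventuallyEq_one_of_mem_ball hz'] with y hy
    simp [f, hy]
  have key := unique_continuation_of_hasCompactSupport (sf w₁ h₁) (sf w₂ h₂) (cf w₁) (cf w₂) hε hC
    (R := R₁) (fun z hz => ?_) (fun z hz => by simp [f, h0 z hz]) hR1
  · rwa [(fin w₁ z₁ hR1).eq_of_nhds, (fin w₂ z₁ hR1).eq_of_nhds] at key
  · rw [wzb_congr (fin w₁ z hz), wzb_congr (fin w₂ z hz), (fin w₁ z hz).eq_of_nhds,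
      (fin w₂ z hz).eq_of_nhds]
    exact hw z (by simpa [dist_eq_norm] using hz.trans hR1')

end UniqueContinuation

/-! ### Lifts of surfaces in the sphere -/

section Lift

variable {n : ℕ} {U : Set ℂ} {g g' : ℂ → Sph n} {z : ℂ}

/-- The lift `(1, g)` of a surface, as a map into complexified Minkowski space. -/
def lift (g : ℂ → Sph n) (z : ℂ) : Fin (n + 2) → ℂ := toC (coneLift (g z))

theorem mink_vecCons (a b : ℝ) (v w : Amb n) :
    mink (Matrix.vecCons a (fun i => v i)) (Matrix.vecCons b fun i => w i) =
      -(a * b) + inner ℝ v w := by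
  simp [mink, PiLp.inner_apply, mul_comm]

theorem mink_coneLift (x y : Sph n) :
    mink (coneLift x) (coneLift y) = -1 + inner ℝ (x : Amb n) (y : Amb n) := by
  rw [coneLift, coneLift, mink_vecCons, mul_one]

theorem mink_coneLift_self (x : Sph n) : mink (coneLift x) (coneLift x) = 0 := by
  rw [mink_coneLift, real_inner_self_eq_norm_sq, norm_eq_of_mem_sphere]
  norm_num

theorem mink_coneLift_ne_zero {x y : Sph n} (h : x ≠ y) :
    mink (coneLift x) (coneLift y) ≠ 0 := by
  rw [mink_coneLift]
  have := inner_lt_one_iff_real_of_norm_eq_one (norm_eq_of_mem_sphere x) (norm_eq_of_mem_sphere y)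
  have h' := this.2 (fun e => h (Subtype.ext e))
  linarith

theorem hasFDerivAt_coneLift (hg : DifferentiableAt ℝ (fun w => (g w : Amb n)) z) (h : ℂ) :
    DifferentiableAt ℝ (fun w => coneLift (g w)) z ∧
    fderiv ℝ (fun w => coneLift (g w)) z h =
      Matrix.vecCons 0 fun i => fderiv ℝ (fun w => (g w : Amb n)) z h i := by
  have key : HasFDerivAt (fun w => coneLift (g w)) (ContinuousLinearMap.pi
      (Fin.cons (0 : ℂ →L[ℝ] ℝ) fun i => (EuclideanSpace.proj i : Amb n →L[ℝ] ℝ).comp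
        (fderiv ℝ (fun w => (g w : Amb n)) z))) z := by
    refine hasFDerivAt_pi.2 fun i => ?_
    refine Fin.cases ?_ (fun i => ?_) i
    · simpa [coneLift] using hasFDerivAt_const (1 : ℝ) z
    · exact (EuclideanSpace.proj i : Amb n →L[ℝ] ℝ).hasFDerivAt.comp z hg.hasFDerivAt
  refine ⟨key.differentiableAt, ?_⟩
  rw [key.fderiv]
  ext i
  refine Fin.cases ?_ (fun i => ?_) i <;> simp

theorem contDiffAt_coneLift (hg : ContDiffAt ℝ ∞ (fun w => (g w : Amb n)) z) :
    ContDiffAt ℝ ∞ (fun w => coneLift (g w)) z := by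
  refine contDiffAt_pi.2 fun i => ?_
  refine Fin.cases ?_ (fun i => ?_) i
  · simpa [coneLift] using contDiffAt_const
  · exact (EuclideanSpace.proj i : Amb n →L[ℝ] ℝ).contDiff.contDiffAt.comp z hg

theorem contDiffAt_lift (hg : ContDiffAt ℝ ∞ (fun w => (g w : Amb n)) z) :
    ContDiffAt ℝ ∞ (lift g) z :=
  contDiffAt_pi.2 fun i => Complex.ofRealCLM.contDiff.contDiffAt.comp z
    (contDiffAt_pi.1 (contDiffAt_coneLift hg) i)

theorem fderiv_lift (hg : DifferentiableAt ℝ (fun w => (g w : Amb n)) z) (h : ℂ) :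
    fderiv ℝ (lift g) z h = toC (fderiv ℝ (fun w => coneLift (g w)) z h) := by
  have h1 := hasFDerivAt_pi'.1 (hasFDerivAt_coneLift hg 0).1.hasFDerivAt
  have key : HasFDerivAt (lift g) (ContinuousLinearMap.pi fun i => Complex.ofRealCLM.comp
      ((ContinuousLinearMap.proj i).comp (fderiv ℝ (fun w => coneLift (g w)) z))) z :=
    hasFDerivAt_pi.2 fun i => Complex.ofRealCLM.hasFDerivAt.comp z (h1 i)
  rw [key.fderiv]
  ext i
  simp [toC]

theorem mink_fderiv_coneLift (hg : DifferentiableAt ℝ (fun w => (g w : Amb n)) z) (h k : ℂ) :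
    mink (fderiv ℝ (fun w => coneLift (g w)) z h) (fderiv ℝ (fun w => coneLift (g w)) z k) =
      inner ℝ (fderiv ℝ (fun w => (g w : Amb n)) z h) (fderiv ℝ (fun w => (g w : Amb n)) z k) := by
  rw [(hasFDerivAt_coneLift hg h).2, (hasFDerivAt_coneLift hg k).2, mink_vecCons]
  simp

/-- A smooth conformal immersion of an open subset of the plane into the sphere. -/
structure IsConformalSurface (g : ℂ → Sph n) (U : Set ℂ) : Prop where
  isOpen : IsOpen U
  smooth : ∀ z ∈ U, ContDiffAt ℝ ∞ (fun w => (g w : Amb n)) z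
  conformal : ∀ z ∈ U, ConformalAt (fun w => (g w : Amb n)) z

/-- The conformal factor `|g_u|`. -/
noncomputable def speed (g : ℂ → Sph n) (z : ℂ) : ℝ := ‖fderiv ℝ (fun w => (g w : Amb n)) z 1‖

theorem canonLift_eq (g : ℂ → Sph n) (z : ℂ) :
    canonLift g z = (((speed g z)⁻¹ : ℝ) : ℂ) • lift g z := rfl

namespace IsConformalSurface

theorem differentiableAt (h : IsConformalSurface g U) (hz : z ∈ U) :
    DifferentiableAt ℝ (fun w => (g w : Amb n)) z :=
  (h.smooth z hz).differentiableAt (by simp)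

theorem gram (h : IsConformalSurface g U) (hz : z ∈ U) :
    0 < speed g z ∧
      mink (fderiv ℝ (fun w => coneLift (g w)) z 1) (fderiv ℝ (fun w => coneLift (g w)) z 1) =
        speed g z ^ 2 ∧
      mink (fderiv ℝ (fun w => coneLift (g w)) z Complex.I)
        (fderiv ℝ (fun w => coneLift (g w)) z Complex.I) = speed g z ^ 2 ∧
      mink (fderiv ℝ (fun w => coneLift (g w)) z 1)
        (fderiv ℝ (fun w => coneLift (g w)) z Complex.I) = 0 := by
  obtain ⟨c, hc, hcc⟩ := conformalAt_iff'.1 (h.conformal z hz)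
  have hd := h.differentiableAt hz
  simp only [mink_fderiv_coneLift hd, hcc]
  have e : speed g z ^ 2 = c := by
    rw [speed, ← real_inner_self_eq_norm_sq, hcc]
    simp
  refine ⟨?_, ?_, ?_, ?_⟩
  · refine lt_of_le_of_ne (norm_nonneg _) fun h0 => ?_
    rw [show speed g z = 0 from h0.symm, zero_pow two_ne_zero] at e
    exact hc.ne e
  all_goals simp [e, Complex.inner]

theorem smooth_lift (h : IsConformalSurface g U) : ∀ z ∈ U, ContDiffAt ℝ ∞ (lift g) z :=
  fun z hz => contDiffAt_lift (h.smooth z hz)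

theorem smooth_scale (h : IsConformalSurface g U) :
    ∀ z ∈ U, ContDiffAt ℝ ∞ (fun w => (((speed g w)⁻¹ : ℝ) : ℂ)) z := by
  intro z hz
  have hpos := (h.gram hz).1
  have h1 : ContDiffAt ℝ ∞ (fun w => fderiv ℝ (fun w => (g w : Amb n)) w 1) z :=
    ((h.smooth z hz).fderiv_right (m := ∞) (by simp)).clm_apply contDiffAt_const
  have h2 : ContDiffAt ℝ ∞ (speed g) z := h1.norm ℝ (norm_pos_iff.1 hpos)
  exact Complex.ofRealCLM.contDiff.contDiffAt.comp z (h2.inv hpos.ne')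

theorem mink_lift_self (g : ℂ → Sph n) (z : ℂ) : mink (lift g z) (lift g z) = 0 := by
  rw [lift, mink_toC, mink_coneLift_self, Complex.ofReal_zero]

theorem star_lift (g : ℂ → Sph n) (z : ℂ) : star (lift g z) = lift g z := star_toC _

theorem mink_wz_lift (h : IsConformalSurface g U) (hz : z ∈ U) :
    mink (wz (lift g) z) (wz (lift g) z) = 0 ∧
      mink (wz (lift g) z) (wzb (lift g) z) = (speed g z : ℂ) ^ 2 / 2 ∧
      mink (lift g z) (wz (lift g) z) = 0 ∧ mink (lift g z) (wzb (lift g) z) = 0 := by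
  obtain ⟨-, h1, h2, h3⟩ := h.gram hz
  have hd := h.differentiableAt hz
  have h4 := mink_comm (fderiv ℝ (fun w => coneLift (g w)) z Complex.I)
    (fderiv ℝ (fun w => coneLift (g w)) z 1)
  refine ⟨?_, ?_, ?_, ?_⟩
  · simp only [wz, fderiv_lift hd, mink_smul_left, mink_smul_right, mink_sub_left, mink_sub_right,
      mink_toC, h1, h2, h3, h4]
    push_cast
    linear_combination (1 / 4) * (speed g z : ℂ) ^ 2 * Complex.I_mul_I
  · simp only [wz, wzb, fderiv_lift hd, mink_smul_left, mink_smul_right, mink_sub_left,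
      mink_add_right, mink_toC, h1, h2, h3, h4]
    push_cast
    linear_combination -(1 / 4) * (speed g z : ℂ) ^ 2 * Complex.I_mul_I
  · have := mink_wz_of_const h.isOpen h.smooth_lift h.smooth_lift
      (fun z _ => mink_lift_self g z) hz
    rw [mink_comm] at this
    linear_combination this / 2
  · have := mink_wzb_of_const h.isOpen h.smooth_lift h.smooth_lift
      (fun z _ => mink_lift_self g z) hz
    rw [mink_comm] at this
    linear_combination this / 2

theorem wz_canonLift (h : IsConformalSurface g U) (hz : z ∈ U) : wz (canonLift g) z =
    wz (fun w => (((speed g w)⁻¹ : ℝ) : ℂ)) z • lift g z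
      + (((speed g z)⁻¹ : ℝ) : ℂ) • wz (lift g) z :=
  wz_smul (differentiableAt_of_contDiffAt (h.smooth_scale z hz))
    (differentiableAt_of_contDiffAt (h.smooth_lift z hz))

theorem wzb_canonLift (h : IsConformalSurface g U) (hz : z ∈ U) : wzb (canonLift g) z =
    wzb (fun w => (((speed g w)⁻¹ : ℝ) : ℂ)) z • lift g z
      + (((speed g z)⁻¹ : ℝ) : ℂ) • wzb (lift g) z :=
  wzb_smul (differentiableAt_of_contDiffAt (h.smooth_scale z hz))
    (differentiableAt_of_contDiffAt (h.smooth_lift z hz))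

theorem isCanonicalLift (h : IsConformalSurface g U) : IsCanonicalLift U (canonLift g) := by
  have sl := h.smooth_scale
  have sF := h.smooth_lift
  refine ⟨h.isOpen, fun z hz => (sl z hz).smul (sF z hz), fun z hz => ?_, fun z hz => ?_,
    fun z hz => ?_, fun z hz => ?_⟩
  · rw [canonLift_eq, star_smul_eq, Complex.conj_ofReal, star_lift]
  · rw [canonLift_eq, mink_smul_left, mink_smul_right, mink_lift_self]; ring
  · obtain ⟨a1, a2, a3, a4⟩ := h.mink_wz_lift hz
    have a3' := (mink_comm _ _).trans a3
    rw [h.wz_canonLift hz]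
    simp only [mink_add_left, mink_add_right, mink_smul_left, mink_smul_right, a1, a3, a3',
      mink_lift_self]
    ring
  · obtain ⟨a1, a2, a3, a4⟩ := h.mink_wz_lift hz
    have a3' := (mink_comm _ _).trans a3
    have hpos : (speed g z : ℂ) ≠ 0 := by exact_mod_cast (h.gram hz).1.ne'
    rw [h.wz_canonLift hz, h.wzb_canonLift hz]
    simp only [mink_add_left, mink_add_right, mink_smul_left, mink_smul_right, a2, a3', a4,
      mink_lift_self]
    push_cast
    field_simp
    ring

end IsConformalSurface

/-! ### Pairs of surfaces that envelop a common sphere congruence -/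

/-- Two conformal surfaces, without common points, that envelop a common family of 2-spheres. -/
structure IsEnvelopingPair (g g' : ℂ → Sph n) (U : Set ℂ) : Prop where
  left : IsConformalSurface g U
  right : IsConformalSurface g' U
  ne : ∀ z ∈ U, g z ≠ g' z
  tangent : ∀ z ∈ U, ∃ W : Submodule ℝ (Fin (n + 2) → ℝ), Module.finrank ℝ W = 4 ∧
    coneLift (g z) ∈ W ∧ coneLift (g' z) ∈ W ∧
    (∀ h, fderiv ℝ (fun w => coneLift (g w)) z h ∈ W) ∧
    ∀ h, fderiv ℝ (fun w => coneLift (g' w)) z h ∈ W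

/-- The lift `Z` of `g'` with `⟨Y, Z⟩ = -1`, where `Y` is the canonical lift of `g`. -/
noncomputable def partner (g g' : ℂ → Sph n) (z : ℂ) : Fin (n + 2) → ℂ :=
  (-(mink (canonLift g z) (lift g' z))⁻¹) • lift g' z

namespace IsEnvelopingPair

theorem symm (h : IsEnvelopingPair g g' U) : IsEnvelopingPair g' g U :=
  ⟨h.right, h.left, fun z hz => (h.ne z hz).symm, fun z hz => by
    obtain ⟨W, h1, h2, h3, h4, h5⟩ := h.tangent z hz
    exact ⟨W, h1, h3, h2, h5, h4⟩⟩

theorem mono (h : IsEnvelopingPair g g' U) {V : Set ℂ} (hV : IsOpen V) (hVU : V ⊆ U) :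
    IsEnvelopingPair g g' V :=
  ⟨⟨hV, fun z hz => h.left.smooth z (hVU hz), fun z hz => h.left.conformal z (hVU hz)⟩,
    ⟨hV, fun z hz => h.right.smooth z (hVU hz), fun z hz => h.right.conformal z (hVU hz)⟩,
    fun z hz => h.ne z (hVU hz), fun z hz => h.tangent z (hVU hz)⟩

theorem mink_lift_ne_zero (h : IsEnvelopingPair g g' U) (hz : z ∈ U) :
    mink (lift g z) (lift g' z) ≠ 0 := by
  rw [lift, lift, mink_toC]
  exact_mod_cast mink_coneLift_ne_zero (h.ne z hz)

theorem mink_canonLift_ne_zero (h : IsEnvelopingPair g g' U) (hz : z ∈ U) :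
    mink (canonLift g z) (lift g' z) ≠ 0 := by
  rw [canonLift_eq, mink_smul_left]
  refine mul_ne_zero ?_ (h.mink_lift_ne_zero hz)
  exact_mod_cast inv_ne_zero (h.left.gram hz).1.ne'

/-- The sphere congruence is spanned by `F, F_u, F_v, F'`, so that the derivative of `F'` is a
linear combination of these vectors. -/
theorem exists_fderiv_eq (h : IsEnvelopingPair g g' U) (hz : z ∈ U) (v : ℂ) :
    ∃ c₀ c₁ c₂ c₃ : ℝ, fderiv ℝ (fun w => coneLift (g' w)) z v =
      c₀ • coneLift (g z) + c₁ • fderiv ℝ (fun w => coneLift (g w)) z 1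
        + c₂ • fderiv ℝ (fun w => coneLift (g w)) z Complex.I + c₃ • coneLift (g' z) := by
  obtain ⟨W, hW, w0, w3, w1, w4⟩ := h.tangent z hz
  obtain ⟨hpos, g11, g22, g12⟩ := h.left.gram hz
  have g21 := (mink_comm _ _).trans g12
  have hne := mink_coneLift_ne_zero (h.ne z hz)
  have g00 := mink_coneLift_self (g z)
  have g01 : ∀ v, mink (coneLift (g z)) (fderiv ℝ (fun w => coneLift (g w)) z v) = 0 := by
    intro v
    obtain ⟨-, -, a, b⟩ := h.left.mink_wz_lift hz
    have : mink (lift g z) (fderiv ℝ (lift g) z v) = 0 := by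
      rw [fderiv_apply_eq]
      simp [a, b]
    rw [fderiv_lift (h.left.differentiableAt hz), lift, mink_toC] at this
    exact_mod_cast this
  have g10 : ∀ v, mink (fderiv ℝ (fun w => coneLift (g w)) z v) (coneLift (g z)) = 0 :=
    fun v => (mink_comm _ _).trans (g01 v)
  let b : Fin 4 → Fin (n + 2) → ℝ := ![coneLift (g z), fderiv ℝ (fun w => coneLift (g w)) z 1,
    fderiv ℝ (fun w => coneLift (g w)) z Complex.I, coneLift (g' z)]
  have hli : LinearIndependent ℝ b := by
    rw [Fintype.linearIndependent_iff]
    intro c hc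
    simp only [Fin.sum_univ_four] at hc
    change c 0 • coneLift (g z) + c 1 • fderiv ℝ (fun w => coneLift (g w)) z 1
      + c 2 • fderiv ℝ (fun w => coneLift (g w)) z Complex.I + c 3 • coneLift (g' z) = 0 at hc
    have hs : speed g z ^ 2 ≠ 0 := (pow_pos hpos 2).ne'
    have e0 := congrArg (mink (coneLift (g z))) hc
    have e1 := congrArg (mink (fderiv ℝ (fun w => coneLift (g w)) z 1)) hc
    have e2 := congrArg (mink (fderiv ℝ (fun w => coneLift (g w)) z Complex.I)) hc
    have e3 := congrArg (mink (coneLift (g' z))) hc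
    simp only [mink_add_right, mink_smul_right, mink_zero_right, g00, g01, g10, g11, g22, g12,
      g21] at e0 e1 e2 e3
    have h3 : c 3 = 0 := by
      have : c 3 * mink (coneLift (g z)) (coneLift (g' z)) = 0 := by linear_combination e0
      exact (mul_eq_zero.1 this).resolve_right hne
    rw [h3] at e1 e2 e3
    have h1 : c 1 = 0 := by
      have : c 1 * speed g z ^ 2 = 0 := by linear_combination e1
      exact (mul_eq_zero.1 this).resolve_right hs
    have h2 : c 2 = 0 := by
      have : c 2 * speed g z ^ 2 = 0 := by linear_combination e2
      exact (mul_eq_zero.1 this).resolve_right hs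
    rw [h1, h2, mink_comm _ (coneLift (g z))] at e3
    have h0 : c 0 = 0 := by
      have : c 0 * mink (coneLift (g z)) (coneLift (g' z)) = 0 := by linear_combination e3
      exact (mul_eq_zero.1 this).resolve_right hne
    intro i
    fin_cases i
    exacts [h0, h1, h2, h3]
  have hle : Submodule.span ℝ (Set.range b) ≤ W := by
    rw [Submodule.span_le]
    rintro _ ⟨i, rfl⟩
    fin_cases i
    exacts [w0, w1 1, w1 Complex.I, w3]
  have heq : Submodule.span ℝ (Set.range b) = W :=
    Submodule.eq_of_le_of_finrank_eq hle (by
      rw [finrank_span_eq_card hli, hW, Fintype.card_fin])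
  have hmem := w4 v
  rw [← heq, Submodule.mem_span_range_iff_exists_fun] at hmem
  obtain ⟨c, hc⟩ := hmem
  refine ⟨c 0, c 1, c 2, c 3, ?_⟩
  rw [← hc, Fin.sum_univ_four]
  rfl

theorem smooth_partnerScale (h : IsEnvelopingPair g g' U) :
    ∀ z ∈ U, ContDiffAt ℝ ∞ (fun w => -(mink (canonLift g w) (lift g' w))⁻¹) z := fun z hz =>
  ((contDiffAt_mink (h.left.isCanonicalLift.smooth z hz) (h.right.smooth_lift z hz)).inv
    (h.mink_canonLift_ne_zero hz)).neg

theorem conj_mink_canonLift (h : IsEnvelopingPair g g' U) (hz : z ∈ U) :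
    conj (mink (canonLift g z) (lift g' z)) = mink (canonLift g z) (lift g' z) := by
  rw [conj_mink, h.left.isCanonicalLift.real z hz, IsConformalSurface.star_lift]

theorem isAdaptedPair (h : IsEnvelopingPair g g' U) :
    IsAdaptedPair U (canonLift g) (partner g g') := by
  have hY := h.left.isCanonicalLift
  set σ : ℂ → ℂ := fun w => -(mink (canonLift g w) (lift g' w))⁻¹ with hσ
  have sσ := h.smooth_partnerScale
  have σ0 : ∀ z ∈ U, σ z ≠ 0 :=
    fun z hz => neg_ne_zero.2 (inv_ne_zero (h.mink_canonLift_ne_zero hz))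
  have σr : ∀ z ∈ U, conj (σ z) = σ z := fun z hz => by
    simp only [hσ, map_neg, map_inv₀, h.conj_mink_canonLift hz]
  have dσ := fun z hz => differentiableAt_of_contDiffAt (sσ z hz)
  have dF := fun z hz => differentiableAt_of_contDiffAt (h.right.smooth_lift z hz)
  have e1 : ∀ z ∈ U, wz (partner g g') z = wz σ z • lift g' z + σ z • wz (lift g') z :=
    fun z hz => wz_smul (dσ z hz) (dF z hz)
  have e2 : ∀ z ∈ U, wzb (partner g g') z = wzb σ z • lift g' z + σ z • wzb (lift g') z :=
    fun z hz => wzb_smul (dσ z hz) (dF z hz)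
  refine { hY with
    smooth' := fun z hz => (sσ z hz).smul (h.right.smooth_lift z hz)
    real' := fun z hz => ?_
    null' := fun z hz => ?_
    pairing := fun z hz => ?_
    conformal' := fun z hz => ?_
    immersed' := fun z hz => ?_
    tangent := fun z hz => ?_ }
  · change star (σ z • lift g' z) = σ z • lift g' z
    rw [star_smul_eq, σr z hz, IsConformalSurface.star_lift]
  · simp [partner, IsConformalSurface.mink_lift_self]
  · have := h.mink_canonLift_ne_zero hz
    simp only [partner, mink_smul_right]
    field_simp
  · obtain ⟨a1, a2, a3, a4⟩ := h.right.mink_wz_lift hz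
    have a3' := (mink_comm _ _).trans a3
    rw [e1 z hz]
    simp only [mink_add_left, mink_add_right, mink_smul_left, mink_smul_right, a1, a3, a3',
      IsConformalSurface.mink_lift_self]
    ring
  · obtain ⟨a1, a2, a3, a4⟩ := h.right.mink_wz_lift hz
    have a3' := (mink_comm _ _).trans a3
    have hpos : (speed g' z : ℂ) ≠ 0 := by exact_mod_cast (h.right.gram hz).1.ne'
    rw [e1 z hz, e2 z hz]
    simp only [mink_add_left, mink_add_right, mink_smul_left, mink_smul_right, a2, a3', a4,
      IsConformalSurface.mink_lift_self]
    simp only [mul_zero, zero_add, add_zero]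
    exact mul_ne_zero (σ0 z hz)
      (mul_ne_zero (σ0 z hz) (div_ne_zero (pow_ne_zero 2 hpos) two_ne_zero))
  · -- Everything lies in the complex span of `Y, Y_z, Y_z̄, Z`.
    let S := Submodule.span ℂ (Set.range ![canonLift g z, wz (canonLift g) z, wzb (canonLift g) z,
      partner g g' z])
    have m : ∀ i, ![canonLift g z, wz (canonLift g) z, wzb (canonLift g) z, partner g g' z] i ∈ S :=
      fun i => Submodule.subset_span ⟨i, rfl⟩
    have m0 : canonLift g z ∈ S := m 0
    have m1 : wz (canonLift g) z ∈ S := m 1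
    have m2 : wzb (canonLift g) z ∈ S := m 2
    have m3 : partner g g' z ∈ S := m 3
    have hpos : (speed g z)⁻¹ ≠ 0 := inv_ne_zero (h.left.gram hz).1.ne'
    have hpos' : (((speed g z)⁻¹ : ℝ) : ℂ) ≠ 0 := by exact_mod_cast hpos
    have f0 : lift g z ∈ S := by
      rw [canonLift_eq] at m0
      exact (S.smul_mem_iff hpos').1 m0
    have f1 : wz (lift g) z ∈ S := by
      rw [h.left.wz_canonLift hz] at m1
      exact (S.smul_mem_iff hpos').1 ((S.add_mem_iff_right (S.smul_mem _ f0)).1 m1)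
    have f2 : wzb (lift g) z ∈ S := by
      rw [h.left.wzb_canonLift hz] at m2
      exact (S.smul_mem_iff hpos').1 ((S.add_mem_iff_right (S.smul_mem _ f0)).1 m2)
    have f3 : lift g' z ∈ S := (S.smul_mem_iff (σ0 z hz)).1 m3
    have f4 : ∀ v, fderiv ℝ (lift g') z v ∈ S := by
      intro v
      obtain ⟨c₀, c₁, c₂, c₃, hc⟩ := h.exists_fderiv_eq hz v
      have : fderiv ℝ (lift g') z v = (c₀ : ℂ) • lift g z + (c₁ : ℂ) • fderiv ℝ (lift g) z 1
          + (c₂ : ℂ) • fderiv ℝ (lift g) z Complex.I + (c₃ : ℂ) • lift g' z := by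
        rw [fderiv_lift (h.right.differentiableAt hz), hc, fderiv_lift (h.left.differentiableAt hz),
          fderiv_lift (h.left.differentiableAt hz)]
        ext i
        simp [toC, lift]
      rw [this, fderiv_one_eq, fderiv_I_eq]
      exact S.add_mem (S.add_mem (S.add_mem (S.smul_mem _ f0) (S.smul_mem _ (S.add_mem f1 f2)))
        (S.smul_mem _ (S.smul_mem _ (S.sub_mem f1 f2)))) (S.smul_mem _ f3)
    have f5 : wz (lift g') z ∈ S :=
      S.smul_mem _ (S.sub_mem (f4 _) (S.smul_mem _ (f4 _)))
    have f6 : wz (partner g g') z ∈ S := by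
      rw [e1 z hz]
      exact S.add_mem (S.smul_mem _ f3) (S.smul_mem _ f5)
    obtain ⟨c, hc⟩ := Submodule.mem_span_range_iff_exists_fun ℂ |>.1 f6
    refine ⟨c 0, c 1, c 2, c 3, ?_⟩
    rw [← hc, Fin.sum_univ_four]
    rfl

end IsEnvelopingPair

end Lift

/-! ### Scale invariance of the two coefficients -/

section Invariance

variable {n : ℕ} {U : Set ℂ} {g g' : ℂ → Sph n} {A B Z : ℂ → Fin (n + 2) → ℂ} {z : ℂ}

/-- The coefficient `θ`, written in terms of arbitrary lifts of the two surfaces. -/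
noncomputable def pairTheta (A B : ℂ → Fin (n + 2) → ℂ) (z : ℂ) : ℂ :=
  -2 * (mink (wz A z) (wz B z) * mink (A z) (B z) - mink (wz A z) (B z) * mink (A z) (wz B z)) /
    mink (A z) (B z) ^ 2

theorem pairTheta_comm (A B : ℂ → Fin (n + 2) → ℂ) (z : ℂ) :
    pairTheta A B z = pairTheta B A z := by
  rw [pairTheta, pairTheta, mink_comm (wz A z) (wz B z), mink_comm (A z) (B z),
    mink_comm (wz A z) (B z), mink_comm (A z) (wz B z)]
  ring

theorem pairTheta_smul {c d : ℂ → ℂ} (hA : DifferentiableAt ℝ A z) (hB : DifferentiableAt ℝ B z)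
    (hc : DifferentiableAt ℝ c z) (hd : DifferentiableAt ℝ d z) (hc0 : c z ≠ 0) (hd0 : d z ≠ 0) :
    pairTheta (fun w => c w • A w) (fun w => d w • B w) z = pairTheta A B z := by
  simp only [pairTheta, wz_smul hc hA, wz_smul hd hB, mink_add_left, mink_add_right,
    mink_smul_left, mink_smul_right]
  by_cases h : mink (A z) (B z) = 0
  · simp [h]
  field_simp
  ring

/-- The expression `θ dz²` is a quadratic differential. -/
theorem pairTheta_comp {k : ℂ → ℂ} {k' w : ℂ} (hk : HasDerivAt k k' w)
    (hA : DifferentiableAt ℝ A (k w)) (hB : DifferentiableAt ℝ B (k w)) :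
    pairTheta (fun w => A (k w)) (fun w => B (k w)) w = k' ^ 2 * pairTheta A B (k w) := by
  simp only [pairTheta, wz_comp_holomorphic hk hA, wz_comp_holomorphic hk hB, mink_smul_left,
    mink_smul_right]
  ring

theorem IsAdaptedPair.thetaCoef_eq {Y : ℂ → Fin (n + 2) → ℂ} (h : IsAdaptedPair U Y Z)
    (hz : z ∈ U) : thetaCoef Y Z z = pairTheta Y Z z := by
  rw [pairTheta, h.pairing z hz, h.mink_left_wz' hz, thetaCoef,
    show mink (wz Y z) (Z z) = connCoef Y Z z from rfl]
  ring

theorem IsEnvelopingPair.thetaCoef_eq (h : IsEnvelopingPair g g' U) (hz : z ∈ U) :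
    thetaCoef (canonLift g) (partner g g') z = pairTheta (lift g) (lift g') z := by
  rw [h.isAdaptedPair.thetaCoef_eq hz]
  refine pairTheta_smul (differentiableAt_of_contDiffAt (h.left.smooth_lift z hz))
    (differentiableAt_of_contDiffAt (h.right.smooth_lift z hz))
    (differentiableAt_of_contDiffAt (h.left.smooth_scale z hz))
    (differentiableAt_of_contDiffAt (h.smooth_partnerScale z hz)) ?_
    (neg_ne_zero.2 (inv_ne_zero (h.mink_canonLift_ne_zero hz)))
  exact_mod_cast inv_ne_zero (h.left.gram hz).1.ne'

/-! ### Pairs whose enveloped spheres are the mean curvature spheres -/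

/-- If `Z` lies in the mean curvature sphere, then the latter is the enveloped sphere. -/
theorem IsAdaptedPair.sphereDefect_eq_zero (h : IsAdaptedPair U (canonLift g) Z) (hz : z ∈ U)
    (hm : Z z ∈ meanSphere g z) : sphereDefect (canonLift g) Z z = 0 := by
  obtain ⟨⟨g00, g01, g02, g03, g04, g05⟩, ⟨g10, g11, g12, g13, g14, g15⟩,
    ⟨g20, g21, g22, g23, g24, g25⟩, -⟩ := h.gram hz
  rw [IsCanonicalLift.meanSphere_eq_range, Submodule.mem_span_range_iff_exists_fun] at hm
  obtain ⟨c, hc⟩ := hm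
  rw [Fin.sum_univ_four] at hc
  change c 0 • canonLift g z + c 1 • wz (canonLift g) z + c 2 • wzb (canonLift g) z
    + c 3 • wzb (wz (canonLift g)) z = Z z at hc
  have ha : mink (wz (canonLift g) z) (Z z) = connCoef (canonLift g) Z z := rfl
  have ha' := h.mink_wzb_right hz
  have e0 := h.pairing z hz
  have en := h.null' z hz
  rw [← hc] at e0 ha ha'
  simp only [mink_add_right, mink_smul_right, g00, g01, g02, g04, g10, g11, g12, g14, g20, g21,
    g22, g24] at e0 ha ha'
  have h3 : c 3 = 2 := by linear_combination -2 * e0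
  have h2 : c 2 = 2 * connCoef (canonLift g) Z z := by linear_combination 2 * ha
  have h1 : c 1 = 2 * conj (connCoef (canonLift g) Z z) := by linear_combination 2 * ha'
  have ev : sphereDefect (canonLift g) Z z = (mink (wzb (wz (canonLift g)) z) (Z z)
      + 2 * connCoef (canonLift g) Z z * conj (connCoef (canonLift g) Z z) - c 0 / 2)
      • canonLift g z := by
    rw [sphereDefect]
    nth_rewrite 1 [← hc]
    rw [h1, h2, h3]
    module
  -- The defect is a multiple of `Y` that is orthogonal to `Z`, hence zero.
  have e4 := congrArg (mink (Z z)) ev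
  rw [sphereDefect] at e4
  simp only [mink_add_right, mink_sub_right, mink_smul_right, mink_comm (Z z) (canonLift g z),
    h.pairing z hz, en, mink_comm (Z z) (wz (canonLift g) z), mink_comm (Z z) (wzb (canonLift g) z),
    h.mink_wzb_right hz, show mink (wz (canonLift g) z) (Z z) = connCoef (canonLift g) Z z from rfl,
    mink_comm (Z z) (wzb (wz (canonLift g)) z)] at e4
  rw [ev, show mink (wzb (wz (canonLift g)) z) (Z z)
    + 2 * connCoef (canonLift g) Z z * conj (connCoef (canonLift g) Z z) - c 0 / 2 = 0 by
      linear_combination e4, zero_smul]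

namespace IsEnvelopingPair

theorem lift_eq (h : IsEnvelopingPair g g' U) (hz : z ∈ U) :
    lift g' z = (-mink (canonLift g z) (lift g' z)) • partner g g' z := by
  rw [partner, smul_smul, neg_mul_neg, mul_inv_cancel₀ (h.mink_canonLift_ne_zero hz), one_smul]

theorem smooth_mink (h : IsEnvelopingPair g g' U) :
    ∀ z ∈ U, ContDiffAt ℝ ∞ (fun w => -mink (canonLift g w) (lift g' w)) z := fun z hz =>
  (contDiffAt_mink (h.left.isCanonicalLift.smooth z hz) (h.right.smooth_lift z hz)).neg

/-- The structure equation in terms of the lifts `(1, g)` and `(1, g')`, where only the coefficients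
of `wz (lift g)` and `wzb (lift g)` matter for the orientations. -/
theorem wz_lift_right (h : IsEnvelopingPair g g' U) (hz : z ∈ U) : ∃ b c : ℂ,
    wz (lift g') z = b • lift g' z + c • lift g z +
      ((-mink (canonLift g z) (lift g' z)) * rhoCoef (canonLift g) (partner g g') z
        * ((speed g z)⁻¹ : ℝ)) • wz (lift g) z +
      ((-mink (canonLift g z) (lift g' z)) * thetaCoef (canonLift g) (partner g g') z
        * ((speed g z)⁻¹ : ℝ)) • wzb (lift g) z := by
  have e1 := wz_smul (differentiableAt_of_contDiffAt (h.smooth_mink z hz))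
    (differentiableAt_of_contDiffAt (h.isAdaptedPair.smooth' z hz))
  rw [← wz_congr_on h.left.isOpen (fun w hw => h.lift_eq hw) hz, h.isAdaptedPair.wz_right hz,
    h.left.wz_canonLift hz, h.left.wzb_canonLift hz] at e1
  have e2 : partner g g' z = (-mink (canonLift g z) (lift g' z))⁻¹ • lift g' z := by
    rw [partner, inv_neg]
  generalize wz (fun w => -mink (canonLift g w) (lift g' w)) z = m1 at e1
  generalize -mink (canonLift g z) (lift g' z) = m at e1 e2 ⊢
  rw [canonLift_eq] at e1
  change wz (lift g') z = _ at e1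
  rw [e1, e2]
  generalize connCoef (canonLift g) (partner g g') z = a
  generalize rhoCoef (canonLift g) (partner g g') z = r
  generalize thetaCoef (canonLift g) (partner g g') z = t
  generalize wz (fun w => (((speed g w)⁻¹ : ℝ) : ℂ)) z = s1
  generalize wzb (fun w => (((speed g w)⁻¹ : ℝ) : ℂ)) z = s2
  generalize (((speed g z)⁻¹ : ℝ) : ℂ) = s
  refine ⟨m1 * m⁻¹ + m * a * m⁻¹, m * (r * s1 + r * a * s + t * s2 + t * conj a * s), ?_⟩
  module

end IsEnvelopingPair

/-! ### Orientations -/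

/-- The transition matrix between the two contact frames has determinant `|τ|²`. -/
theorem isOrientationPreservingAt_of_wz_eq (hg : DifferentiableAt ℝ (fun w => (g w : Amb n)) z)
    (hg' : DifferentiableAt ℝ (fun w => (g' w : Amb n)) z) {b c τ : ℂ} (hτ : τ ≠ 0)
    (h : wz (lift g') z = b • lift g' z + c • lift g z + τ • wzb (lift g) z) :
    IsOrientationPreservingAt g g' z := by
  refine ⟨!![0, 0, 0, 1; 2 * c.re, τ.re, -τ.im, 2 * b.re; -2 * c.im, -τ.im, -τ.re, -2 * b.im;
    1, 0, 0, 0], ?_, ?_⟩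
  · have : 0 < τ.re * τ.re + τ.im * τ.im := by
      rw [← Complex.normSq_apply]; exact Complex.normSq_pos.2 hτ
    simp [Matrix.det_succ_row_zero, Fin.sum_univ_succ, Fin.succAbove]
    linarith
  · simp only [wz, wzb, fderiv_lift hg, fderiv_lift hg'] at h
    have hre := fun j => congrArg Complex.re (congrFun h j)
    have him := fun j => congrArg Complex.im (congrFun h j)
    simp [toC, lift] at hre him
    intro i
    fin_cases i
    · simp [contactFrame, Fin.sum_univ_four]
    · ext j
      have := hre j
      simp [contactFrame, Fin.sum_univ_four]
      linarith
    · ext j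
      have := him j
      simp [contactFrame, Fin.sum_univ_four]
      linarith
    · simp [contactFrame, Fin.sum_univ_four]

/-- The transition matrix between the two contact frames has determinant `-|τ|²`. -/
theorem isOrientationReversingAt_of_wz_eq (hg : DifferentiableAt ℝ (fun w => (g w : Amb n)) z)
    (hg' : DifferentiableAt ℝ (fun w => (g' w : Amb n)) z) {b c τ : ℂ} (hτ : τ ≠ 0)
    (h : wz (lift g') z = b • lift g' z + c • lift g z + τ • wz (lift g) z) :
    IsOrientationReversingAt g g' z := by
  refine ⟨!![0, 0, 0, 1; 2 * c.re, τ.re, τ.im, 2 * b.re; -2 * c.im, -τ.im, τ.re, -2 * b.im;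
    1, 0, 0, 0], ?_, ?_⟩
  · have : 0 < τ.re * τ.re + τ.im * τ.im := by
      rw [← Complex.normSq_apply]; exact Complex.normSq_pos.2 hτ
    simp [Matrix.det_succ_row_zero, Fin.sum_univ_succ, Fin.succAbove]
    linarith
  · simp only [wz, fderiv_lift hg, fderiv_lift hg'] at h
    have hre := fun j => congrArg Complex.re (congrFun h j)
    have him := fun j => congrArg Complex.im (congrFun h j)
    simp [toC, lift] at hre him
    intro i
    fin_cases i
    · simp [contactFrame, Fin.sum_univ_four]
    · ext j
      have := hre j
      simp [contactFrame, Fin.sum_univ_four]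
      linarith
    · ext j
      have := him j
      simp [contactFrame, Fin.sum_univ_four]
      linarith
    · simp [contactFrame, Fin.sum_univ_four]

end Invariance

/-! ### The three cases in a coordinate -/

section Cases

variable {n : ℕ} {U : Set ℂ} {g g' : ℂ → Sph n} {z : ℂ}

namespace IsEnvelopingPair

theorem mink_canonLift_partner_scale (h : IsEnvelopingPair g g' U) (hz : z ∈ U) :
    -mink (canonLift g z) (lift g' z) ≠ 0 := neg_ne_zero.2 (h.mink_canonLift_ne_zero hz)

theorem speed_inv_ne_zero (h : IsEnvelopingPair g g' U) (hz : z ∈ U) :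
    (((speed g z)⁻¹ : ℝ) : ℂ) ≠ 0 := by
  exact_mod_cast inv_ne_zero (h.left.gram hz).1.ne'

theorem isOrientationPreservingAt (h : IsEnvelopingPair g g' U) (hz : z ∈ U)
    (hr : rhoCoef (canonLift g) (partner g g') z = 0) :
    IsOrientationPreservingAt g g' z := by
  have ht := (h.isAdaptedPair.theta_ne_zero_or_rho_ne_zero hz).resolve_right (not_not.2 hr)
  obtain ⟨b, c, e⟩ := h.wz_lift_right hz
  rw [hr, mul_zero, zero_mul, zero_smul, add_zero] at e
  exact isOrientationPreservingAt_of_wz_eq (h.left.differentiableAt hz)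
    (h.right.differentiableAt hz) (mul_ne_zero (mul_ne_zero (h.mink_canonLift_partner_scale hz) ht)
      (h.speed_inv_ne_zero hz)) e

theorem isOrientationReversingAt (h : IsEnvelopingPair g g' U) (hz : z ∈ U)
    (ht : thetaCoef (canonLift g) (partner g g') z = 0) :
    IsOrientationReversingAt g g' z := by
  have hr := (h.isAdaptedPair.theta_ne_zero_or_rho_ne_zero hz).resolve_left (not_not.2 ht)
  obtain ⟨b, c, e⟩ := h.wz_lift_right hz
  rw [ht, mul_zero, zero_mul, zero_smul, add_zero] at e
  exact isOrientationReversingAt_of_wz_eq (h.left.differentiableAt hz)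
    (h.right.differentiableAt hz) (mul_ne_zero (mul_ne_zero (h.mink_canonLift_partner_scale hz) hr)
      (h.speed_inv_ne_zero hz)) e

/-- If `θ` is a nonzero real constant, then the pair is a Darboux pair with parameter `θ`. The
second surface is isothermic because `θ` is symmetric in the two surfaces. -/
theorem isDarbouxPairOn (h : IsEnvelopingPair g g' U) {r : ℝ} (hr : r ≠ 0)
    (ht : ∀ z ∈ U, pairTheta (lift g) (lift g') z = r) :
    IsDarbouxPairOn g g' U ∧ ∀ z ∈ U, IsOrientationPreservingAt g g' z := by
  have hr' : (r : ℂ) ≠ 0 := by exact_mod_cast hr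
  have ht1 : ∀ z ∈ U, thetaCoef (canonLift g) (partner g g') z = r := fun z hz => by
    rw [h.thetaCoef_eq hz, ht z hz]
  have ht2 : ∀ z ∈ U, thetaCoef (canonLift g') (partner g' g) z = r := fun z hz => by
    rw [h.symm.thetaCoef_eq hz, pairTheta_comm, ht z hz]
  have hr1 : ∀ z ∈ U, rhoCoef (canonLift g) (partner g g') z = 0 := fun z hz =>
    (mul_eq_zero.1 (h.isAdaptedPair.theta_mul_rho hz)).resolve_left (by rw [ht1 z hz]; exact hr')
  have hr2 : ∀ z ∈ U, rhoCoef (canonLift g') (partner g' g) z = 0 := fun z hz =>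
    (mul_eq_zero.1 (h.symm.isAdaptedPair.theta_mul_rho hz)).resolve_left
      (by rw [ht2 z hz]; exact hr')
  refine ⟨⟨h.isAdaptedPair.isIsothermicCoordOn hr1 hr ht1,
    h.symm.isAdaptedPair.isIsothermicCoordOn hr2 hr ht2, r, hr, fun z hz => ?_⟩,
    fun z hz => h.isOrientationPreservingAt hz (hr1 z hz)⟩
  change wz (lift g') z + (r : ℂ) • wedge (canonLift g z) (wzb (canonLift g) z) (lift g' z) ∈
    Submodule.span ℂ {lift g' z}
  have e1 := wz_smul (differentiableAt_of_contDiffAt (h.smooth_mink z hz))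
    (differentiableAt_of_contDiffAt (h.isAdaptedPair.smooth' z hz))
  rw [← wz_congr_on h.left.isOpen (fun w hw => h.lift_eq hw) hz, h.isAdaptedPair.wz_right hz,
    hr1 z hz, ht1 z hz] at e1
  change wz (lift g') z = _ at e1
  have e2 : mink (wzb (canonLift g) z) (lift g' z) = -mink (canonLift g z) (lift g' z) *
      conj (connCoef (canonLift g) (partner g g') z) := by
    rw [h.lift_eq hz, mink_smul_right, h.isAdaptedPair.mink_wzb_right hz, ← h.lift_eq hz]
  have e3 : partner g g' z = (-mink (canonLift g z) (lift g' z))⁻¹ • lift g' z := by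
    rw [partner, inv_neg]
  -- As `⟨Y, Z⟩ = -1`, the term `r (Y_z̄ + ā Y)` of the structure equation is cancelled by
  -- `r (Y ∧ Y_z̄) Z`.
  rw [Submodule.mem_span_singleton]
  refine ⟨(wz (fun w => -mink (canonLift g w) (lift g' w)) z
    + -mink (canonLift g z) (lift g' z) * connCoef (canonLift g) (partner g g') z)
    * (-mink (canonLift g z) (lift g' z))⁻¹, ?_⟩
  rw [e1, wedge, e2, e3]
  module

/-- If the enveloped sphere is the mean curvature sphere of `g`, then it is the mean curvature
sphere of `g'` as well. -/
theorem meanSphere_eq (h : IsEnvelopingPair g g' U)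
    (ht : ∀ z ∈ U, thetaCoef (canonLift g) (partner g g') z = 0)
    (hd : ∀ z ∈ U, sphereDefect (canonLift g) (partner g g') z = 0) (hz : z ∈ U) :
    meanSphere g z = meanSphere g' z := by
  let σ : ℂ → ℂ := fun w => (((speed g' w)⁻¹ : ℝ) : ℂ) * -mink (canonLift g w) (lift g' w)
  have hσ : ∀ z ∈ U, ContDiffAt ℝ ∞ σ z := fun z hz =>
    (h.right.smooth_scale z hz).mul (h.smooth_mink z hz)
  have e : ∀ w ∈ U, canonLift g' w = σ w • partner g g' w := by
    intro w hw
    rw [canonLift_eq, mul_smul, ← h.lift_eq hw]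
  obtain ⟨m0, m1, m2, m3⟩ :=
    IsAdaptedPair.wzb_wz_smul_mem_meanSphere h.isAdaptedPair ht hd hσ hz
  have e1 : ∀ w ∈ U, wz (canonLift g') w = wz (fun w => σ w • partner g g' w) w :=
    fun w hw => wz_congr_on h.left.isOpen e hw
  rw [← e z hz] at m0
  rw [← e1 z hz] at m1
  rw [← wzb_congr_on h.left.isOpen e hz] at m2
  rw [← wzb_congr_on h.left.isOpen e1 hz] at m3
  have hle : meanSphere g' z ≤ meanSphere g z := by
    rw [meanSphere, Submodule.span_le]
    rintro v (rfl | rfl | rfl | rfl)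
    exacts [m0, m1, m2, m3]
  have hfin : FiniteDimensional ℂ (meanSphere g z) := inferInstance
  exact (Submodule.eq_of_le_of_finrank_eq hle (by
    rw [h.left.isCanonicalLift.finrank_meanSphere hz,
      h.right.isCanonicalLift.finrank_meanSphere hz])).symm

/-- If `θ = 0` and the enveloped spheres are the mean curvature spheres, then the pair consists of
an S-Willmore surface and its dual. -/
theorem isSWillmoreDualPairOn (h : IsEnvelopingPair g g' U)
    (ht : ∀ z ∈ U, thetaCoef (canonLift g) (partner g g') z = 0)
    (hd : ∀ z ∈ U, sphereDefect (canonLift g) (partner g g') z = 0) :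
    IsSWillmoreDualPairOn g g' U ∧ ∀ z ∈ U, IsOrientationReversingAt g g' z := by
  have ht' : ∀ z ∈ U, thetaCoef (canonLift g') (partner g' g) z = 0 := fun z hz => by
    rw [h.symm.thetaCoef_eq hz, pairTheta_comm, ← h.thetaCoef_eq hz, ht z hz]
  have hV : ∀ z ∈ U, meanSphere g z = meanSphere g' z := fun z hz => h.meanSphere_eq ht hd hz
  have hd' : ∀ z ∈ U, sphereDefect (canonLift g') (partner g' g) z = 0 := by
    intro z hz
    refine h.symm.isAdaptedPair.sphereDefect_eq_zero hz ?_
    rw [← hV z hz]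
    refine Submodule.smul_mem _ _ ((Submodule.smul_mem_iff _ (h.speed_inv_ne_zero hz)).1 ?_)
    rw [← canonLift_eq]
    exact Submodule.subset_span (by simp)
  refine ⟨⟨h.isAdaptedPair.isSWillmoreOn ht hd, h.symm.isAdaptedPair.isSWillmoreOn ht' hd', hV,
    fun w => 2 * connCoef (canonLift g) (partner g g') w, fun z hz => ⟨?_, ?_⟩⟩,
    fun z hz => h.isOrientationReversingAt hz (ht z hz)⟩
  · rw [IsAdaptedPair.normalDzbar_hopf h.isAdaptedPair ht hd hz, map_mul, map_ofNat]
    module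
  · refine ⟨-mink (canonLift g z) (lift g' z), ?_⟩
    change lift g' z = _
    nth_rewrite 1 [h.lift_eq hz]
    rw [h.isAdaptedPair.right_eq_of_sphereDefect_eq_zero hz (hd z hz), dz_eq_wz, dzbar_eq_wzb]
    have e : (((‖2 * connCoef (canonLift g) (partner g g') z‖ ^ 2 / 2 : ℝ)) : ℂ) =
        2 * connCoef (canonLift g) (partner g g') z
          * conj (connCoef (canonLift g) (partner g g') z) := by
      push_cast
      rw [← Complex.mul_conj', map_mul, map_ofNat]
      ring
    rw [e, map_mul, map_ofNat]

/-- If `θ = 0` and `ρ` is real, the two surfaces are interchanged by a fixed reflection. -/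
theorem exists_reflection (h : IsEnvelopingPair g g' U) (hU : IsPreconnected U)
    (ht : ∀ z ∈ U, thetaCoef (canonLift g) (partner g g') z = 0)
    (hr : ∀ z ∈ U, conj (rhoCoef (canonLift g) (partner g g') z) =
      rhoCoef (canonLift g) (partner g g') z) {z₀ : ℂ} (hz₀ : z₀ ∈ U) :
    ∃ X : Fin (n + 2) → ℝ, mink X X ≠ 0 ∧ ∀ z ∈ U, ∃ c : ℝ, coneLift (g' z) =
      c • (coneLift (g z) - (2 * mink (coneLift (g z)) X / mink X X) • X) := by
  have hr0 : ∀ z ∈ U, rhoCoef (canonLift g) (partner g g') z ≠ 0 := fun z hz =>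
    (h.isAdaptedPair.theta_ne_zero_or_rho_ne_zero hz).resolve_left (not_not.2 (ht z hz))
  obtain ⟨X, hX, hXX, hZ⟩ := h.isAdaptedPair.reflection_of_rho_real hU ht hr hr0 hz₀
  obtain ⟨x, rfl⟩ : ∃ x : Fin (n + 2) → ℝ, X = toC x :=
    ⟨fun i => (X i).re, funext fun i => (Complex.conj_eq_iff_re.1 (congrFun hX i)).symm⟩
  rw [mink_toC] at hXX
  refine ⟨x, by exact_mod_cast hXX, fun z hz => ?_⟩
  obtain ⟨c, hc⟩ := Complex.conj_eq_iff_real.1 (hr z hz)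
  have hm : -mink (canonLift g z) (lift g' z) =
      ((-((speed g z)⁻¹ * mink (coneLift (g z)) (coneLift (g' z))) : ℝ) : ℂ) := by
    rw [canonLift_eq, mink_smul_left, lift, lift, mink_toC]
    push_cast
    rfl
  refine ⟨-((speed g z)⁻¹ * mink (coneLift (g z)) (coneLift (g' z))) * c * (speed g z)⁻¹, ?_⟩
  have e : lift g' z = _ := h.lift_eq hz
  rw [hZ z hz, hm, hc, canonLift_eq, mink_smul_left,
    show mink (lift g z) (toC x) = ((mink (coneLift (g z)) x : ℝ) : ℂ) from mink_toC _ _,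
    mink_toC] at e
  ext i
  have ei := congrFun e i
  simp only [lift, toC, Pi.smul_apply, Pi.sub_apply, smul_eq_mul] at ei ⊢
  have ei' : ((coneLift (g' z) i : ℝ) : ℂ) = _ := ei
  norm_cast at ei'
  rw [ei']
  ring

/-- The alternative for pairs that reverse the orientation. The set where `ρ` is not real is open,
and the enveloped sphere is the mean curvature sphere there. If the latter does not hold near a
point, then `ρ` is real on some small disc next to it, and by unique continuation on a disc around
it. -/
theorem reversing_alternative (h : IsEnvelopingPair g g' U)
    (ht : ∀ z ∈ U, thetaCoef (canonLift g) (partner g g') z = 0) {z₀ : ℂ} (hz₀ : z₀ ∈ U) :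
    ∃ δ > 0, Metric.ball z₀ δ ⊆ U ∧
      ((∀ z ∈ Metric.ball z₀ δ, conj (rhoCoef (canonLift g) (partner g g') z) =
          rhoCoef (canonLift g) (partner g g') z) ∨
        ∀ z ∈ Metric.ball z₀ δ, sphereDefect (canonLift g) (partner g g') z = 0) := by
  have hA := h.isAdaptedPair
  have hrc := hA.smooth_rhoCoef
  have hac := hA.smooth_connCoef
  have hsys := fun z hz => hA.elliptic_system ht (z := z) hz
  have hcompat := fun z hz => (hA.compat_of_theta_eq_zero ht (z := z) hz).2.2
  have hdc : ContinuousOn (sphereDefect (canonLift g) (partner g g')) U := by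
    intro z hz
    have s12 := contDiffAt_wzb (hA.smooth_wz z hz)
    have ha := hac z hz
    have hab := IsAdaptedPair.smooth_conj ha
    have : ContDiffAt ℝ ∞ (sphereDefect (canonLift g) (partner g g')) z :=
      (((s12.sub ((contDiffAt_const (c := (1 / 2 : ℂ))).smul (hA.smooth' z hz))).add
        (hab.smul (hA.smooth_wz z hz))).add (ha.smul (hA.smooth_wzb z hz))).add
        (((contDiffAt_mink s12 (hA.smooth' z hz)).add
          (((contDiffAt_const (c := (2 : ℂ))).mul ha).mul hab)).smul (hA.smooth z hz))
    exact this.continuousAt.continuousWithinAt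
  obtain ⟨R, hR, hRU⟩ := Metric.nhds_basis_closedBall.mem_iff.1 (h.left.isOpen.mem_nhds hz₀)
  have hb : Metric.ball z₀ (R / 4) ⊆ Metric.closedBall z₀ R :=
    (Metric.ball_subset_ball (by linarith)).trans Metric.ball_subset_closedBall
  -- The disc of radius `R / 2` about any point of the disc of radius `R / 4` about `z₀` contains
  -- the latter disc and stays within distance `R` of `z₀`.
  refine ⟨R / 4, by positivity, hb.trans hRU, ?_⟩
  by_cases hdef : ∀ z ∈ Metric.ball z₀ (R / 4), sphereDefect (canonLift g) (partner g g') z = 0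
  · exact Or.inr hdef
  refine Or.inl ?_
  push Not at hdef
  obtain ⟨c, hc, hcd⟩ := hdef
  have hcU : c ∈ U := hRU (hb hc)
  set ρ := rhoCoef (canonLift g) (partner g g') with hρ
  set a := connCoef (canonLift g) (partner g g') with ha
  let w₁ : ℂ → ℂ := fun w => ρ w - conj (ρ w)
  let w₂ : ℂ → ℂ := fun w => wz ρ w - 2 * (a w * ρ w)
  -- Near `c` the sphere defect does not vanish, so that `ρ` is real.
  obtain ⟨ε, hε, hεU⟩ : ∃ ε > 0, Metric.ball c ε ⊆
      {w | w ∈ U ∧ sphereDefect (canonLift g) (partner g g') w ≠ 0} := by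
    refine Metric.mem_nhds_iff.1 (Filter.inter_mem (h.left.isOpen.mem_nhds hcU) ?_)
    exact ((hdc c hcU).continuousAt (h.left.isOpen.mem_nhds hcU)).eventually_ne hcd
  have hw1 : ∀ z ∈ Metric.ball c ε, w₁ z = 0 := fun z hz =>
    (smul_eq_zero.1 (hcompat z (hεU hz).1)).resolve_right (hεU hz).2
  have hw2 : ∀ z ∈ Metric.ball c ε, w₂ z = 0 := by
    intro z hz
    have e := (hsys z (hεU hz).1).1
    have e1 : wzb w₁ z = 0 := by
      rw [wzb_congr_on Metric.isOpen_ball hw1 hz, wzb_const]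
    have e2 : ρ z - conj (ρ z) = 0 := hw1 z hz
    rw [show wzb (fun w => ρ w - conj (ρ w)) z = 0 from e1, e2] at e
    have e3 : conj (w₂ z) = 0 := by simp only [w₂]; linear_combination e
    exact (map_eq_zero _).1 e3
  have hball : Metric.ball c (R / 2) ⊆ Metric.closedBall z₀ R := by
    intro w hw
    rw [Metric.mem_ball] at hw hc
    rw [Metric.mem_closedBall]
    linarith [dist_triangle w c z₀]
  obtain ⟨A, hAb⟩ := (isCompact_closedBall z₀ R).exists_bound_of_continuousOn (f := a)
    fun z hz => (hac z (hRU hz)).continuousAt.continuousWithinAt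
  obtain ⟨P, hPb⟩ := (isCompact_closedBall z₀ R).exists_bound_of_continuousOn (f := ρ)
    fun z hz => (hrc z (hRU hz)).continuousAt.continuousWithinAt
  have sq : ∀ x y : ℂ, ‖x + y‖ ^ 2 ≤ 2 * ‖x‖ ^ 2 + 2 * ‖y‖ ^ 2 := fun x y => by
    have := pow_le_pow_left₀ (norm_nonneg _) (norm_add_le x y) 2
    nlinarith [sq_nonneg (‖x‖ - ‖y‖)]
  have huc := unique_continuation (w₁ := w₁) (w₂ := w₂) (c := c) (R := R / 2)
    (C := 8 * A ^ 2 + 2 * P ^ 2 + 2) hε (by positivity)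
    (fun z hz => (hrc z (hRU (hball hz))).sub (IsAdaptedPair.smooth_conj (hrc z (hRU (hball hz)))))
    (fun z hz => (contDiffAt_wz (hrc z (hRU (hball hz)))).sub
      (contDiffAt_const.mul ((hac z (hRU (hball hz))).mul (hrc z (hRU (hball hz))))))
    (fun z hz => ?_) (fun z hz => ⟨hw1 z hz, hw2 z hz⟩)
  · intro z hz
    have hz' : z ∈ Metric.ball c (R / 2) := by
      rw [Metric.mem_ball] at hz hc ⊢
      linarith [dist_triangle z z₀ c, dist_comm c z₀]
    exact (sub_eq_zero.1 (huc z hz').1).symm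
  · obtain ⟨e1, e2⟩ := hsys z (hRU (hball hz))
    have e1' : wzb w₁ z = 2 * conj (a z) * w₁ z + -conj (w₂ z) := by
      rw [← sub_eq_add_neg]; exact e1
    have e2' : wzb w₂ z = 2 * conj (a z) * w₂ z + ρ z * w₁ z := e2
    have n1 := sq (2 * conj (a z) * w₁ z) (-conj (w₂ z))
    have n2 := sq (2 * conj (a z) * w₂ z) (ρ z * w₁ z)
    rw [← e1'] at n1
    rw [← e2'] at n2
    simp only [norm_mul, norm_neg, RCLike.norm_conj, RCLike.norm_ofNat, mul_pow] at n1 n2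
    have hA2 : ‖a z‖ ^ 2 ≤ A ^ 2 := pow_le_pow_left₀ (norm_nonneg _) (hAb z (hball hz)) 2
    have hP2 : ‖ρ z‖ ^ 2 ≤ P ^ 2 := pow_le_pow_left₀ (norm_nonneg _) (hPb z (hball hz)) 2
    have k1 := mul_le_mul_of_nonneg_right hA2 (sq_nonneg ‖w₁ z‖)
    have k2 := mul_le_mul_of_nonneg_right hA2 (sq_nonneg ‖w₂ z‖)
    have k3 := mul_le_mul_of_nonneg_right hP2 (sq_nonneg ‖w₁ z‖)
    have k4 : 0 ≤ P ^ 2 * ‖w₂ z‖ ^ 2 := by positivity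
    nlinarith [sq_nonneg ‖w₁ z‖]

end IsEnvelopingPair

end Cases

/-! ### Surfaces in the coordinates of a Riemann surface -/

section Charts

variable {n : ℕ} {M : Type*} [TopologicalSpace M] [ChartedSpace ℂ M] {f f' : M → Sph n}
  {φ : OpenPartialHomeomorph M ℂ}

/-- Holomorphic coordinates are smooth coordinates in the real sense. -/
theorem mem_maximalAtlas_real (hφ : φ ∈ coords M) :
    φ ∈ IsManifold.maximalAtlas 𝓘(ℝ, ℂ) ∞ M := by
  have hle : contDiffGroupoid ω 𝓘(ℂ) ≤ contDiffGroupoid ∞ 𝓘(ℝ, ℂ) := by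
    rw [contDiffGroupoid, contDiffGroupoid]
    apply groupoid_of_pregroupoid_le
    intro f s hfs
    have h1 : ContDiffOn ℂ ω (𝓘(ℂ) ∘ f ∘ 𝓘(ℂ).symm) (𝓘(ℂ).symm ⁻¹' s ∩ Set.range 𝓘(ℂ)) := hfs
    exact (h1.restrict_scalars ℝ).of_le le_top
  exact StructureGroupoid.maximalAtlas_mono hle hφ

theorem IsConformalImmersion.isConformalSurface (hf : IsConformalImmersion f)
    [IsManifold 𝓘(ℂ) ω M] (hφ : φ ∈ coords M) :
    IsConformalSurface (f ∘ φ.symm) φ.target := by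
  refine ⟨φ.open_target, fun z hz => ?_, hf.conformal φ hφ⟩
  have h1 : ContMDiffAt 𝓘(ℝ, ℂ) 𝓘(ℝ, ℂ) ∞ φ.symm z :=
    contMDiffAt_symm_of_mem_maximalAtlas (mem_maximalAtlas_real hφ) hz
  have : Fact (Module.finrank ℝ (Amb n) = n + 1) := ⟨finrank_euclideanSpace_fin⟩
  exact ((contMDiff_coe_sphere (E := Amb n) (m := ∞) (n := n)).contMDiffAt.comp z
    (hf.smooth.contMDiffAt.comp z h1)).contDiffAt

theorem isEnvelopingPair_of_envelops [IsManifold 𝓘(ℂ) ω M] (hf : IsConformalImmersion f)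
    (hf' : IsConformalImmersion f') {W : M → Submodule ℝ (Fin (n + 2) → ℝ)}
    (hW : ∀ p, IsTwoSphere (W p)) (h : Envelops f W) (h' : Envelops f' W) (hφ : φ ∈ coords M)
    (hne : ∀ q ∈ φ.source, f q ≠ f' q) :
    IsEnvelopingPair (f ∘ φ.symm) (f' ∘ φ.symm) φ.target :=
  ⟨hf.isConformalSurface hφ, hf'.isConformalSurface hφ, fun _ hz => hne _ (φ.map_target hz),
    fun z hz => ⟨W (φ.symm z), (hW _).finrank_eq, h.1 _, h'.1 _, h.2 φ hφ z hz, h'.2 φ hφ z hz⟩⟩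

/-- Holomorphic changes of coordinates. -/
theorem trans_mem_coords (hφ : φ ∈ coords M) {e : OpenPartialHomeomorph ℂ ℂ}
    (he : e ∈ contDiffGroupoid ω 𝓘(ℂ)) : φ.trans e ∈ coords M := by
  intro ψ hψ
  obtain ⟨h1, h2⟩ := hφ ψ hψ
  constructor
  · rw [OpenPartialHomeomorph.trans_symm_eq_symm_trans_symm, OpenPartialHomeomorph.trans_assoc]
    exact StructureGroupoid.trans _ (StructureGroupoid.symm _ he) h1
  · rw [← OpenPartialHomeomorph.trans_assoc]
    exact StructureGroupoid.trans _ h2 he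

/-- Coordinates can be restricted to an open set of values. -/
theorem exists_coord_restrict (hφ : φ ∈ coords M) {p : M} (hp : p ∈ φ.source) {V : Set ℂ}
    (hV : IsOpen V) (hVφ : V ⊆ φ.target) (hpV : φ p ∈ V) :
    ∃ ψ ∈ coords M, p ∈ ψ.source ∧ ψ.target = V ∧ (ψ.symm : ℂ → M) = φ.symm :=
  ⟨φ.trans (OpenPartialHomeomorph.ofSet V hV),
    trans_mem_coords hφ (ofSet_mem_contDiffGroupoid hV), by simp [hp, hpV],
    by simpa [OpenPartialHomeomorph.trans_target] using hVφ, by ext; simp⟩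

/-- Away from its zeros a holomorphic quadratic differential `θ dz²` is the square `dw²` of the
differential of a holomorphic coordinate `w = ∫ √θ dz`. -/
theorem exists_coord_of_quadratic_differential {V : Set ℂ} (hV : IsOpen V) {θ : ℂ → ℂ}
    (hθ : DifferentiableOn ℂ θ V) {z₀ : ℂ} (hz₀ : z₀ ∈ V) (h0 : θ z₀ ≠ 0) :
    ∃ e : OpenPartialHomeomorph ℂ ℂ, e ∈ contDiffGroupoid ω 𝓘(ℂ) ∧ z₀ ∈ e.source ∧
      e.source ⊆ V ∧ ∀ w ∈ e.target, ∃ k', HasDerivAt e.symm k' w ∧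
        k' ^ 2 * θ (e.symm w) = 1 := by
  have hd : ∀ z ∈ V, DifferentiableAt ℂ θ z := fun z hz => hθ.differentiableAt (hV.mem_nhds hz)
  -- Near `z₀` the quotient `θ / θ z₀` stays in the domain of the principal square root.
  obtain ⟨ε, hε, hεV⟩ : ∃ ε > 0, Metric.ball z₀ ε ⊆
      {z | z ∈ V ∧ θ z / θ z₀ ∈ Complex.slitPlane} := by
    refine Metric.mem_nhds_iff.1 (Filter.inter_mem (hV.mem_nhds hz₀) ?_)
    refine ((hd z₀ hz₀).continuousAt.div_const _).preimage_mem_nhds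
      (Complex.isOpen_slitPlane.mem_nhds ?_)
    rw [div_self h0]
    exact Complex.one_mem_slitPlane
  let q : ℂ → ℂ := fun z => θ z₀ ^ (1 / 2 : ℂ) * (θ z / θ z₀) ^ (1 / 2 : ℂ)
  have hsq : ∀ x : ℂ, (x ^ (1 / 2 : ℂ)) ^ 2 = x := fun x => by
    rw [← Complex.cpow_nat_mul]; norm_num
  have hq2 : ∀ z, q z ^ 2 = θ z := fun z => by
    rw [mul_pow, hsq, hsq, mul_div_cancel₀ _ h0]
  have hq0 : ∀ z ∈ Metric.ball z₀ ε, q z ≠ 0 := by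
    intro z hz e
    have e' := hq2 z
    rw [e] at e'
    have := Complex.slitPlane_ne_zero (hεV hz).2
    rw [← e'] at this
    simp at this
  have hqd : DifferentiableOn ℂ q (Metric.ball z₀ ε) := fun z hz =>
    ((((hd z (hεV hz).1).div_const _).cpow_const (hεV hz).2).const_mul _).differentiableWithinAt
  obtain ⟨k, hk⟩ := hqd.isExactOn_ball
  have hkd : DifferentiableOn ℂ k (Metric.ball z₀ ε) :=
    fun z hz => (hk z hz).differentiableAt.differentiableWithinAt
  have hz₀ε := Metric.mem_ball_self hε (x := z₀)
  have hks : HasStrictDerivAt k (q z₀) z₀ := by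
    have h1 : AnalyticAt ℂ k z₀ := hkd.analyticAt (Metric.isOpen_ball.mem_nhds hz₀ε)
    have h2 := h1.hasStrictDerivAt
    rwa [(hk z₀ hz₀ε).deriv] at h2
  let e₀ : OpenPartialHomeomorph ℂ ℂ :=
    (hks.hasStrictFDerivAt_equiv (hq0 z₀ hz₀ε)).toOpenPartialHomeomorph k
  let e : OpenPartialHomeomorph ℂ ℂ := e₀.restrOpen (Metric.ball z₀ ε) Metric.isOpen_ball
  have hes : e.source ⊆ Metric.ball z₀ ε := fun z hz => by
    simp only [e, OpenPartialHomeomorph.restrOpen_source] at hz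
    exact hz.2
  have hsymm : ∀ w ∈ e.target, HasDerivAt e.symm (q (e.symm w))⁻¹ w := fun w hw =>
    e.hasDerivAt_symm hw (hq0 _ (hes (e.map_target hw))) (hk _ (hes (e.map_target hw)))
  refine ⟨e, ⟨?_, ?_⟩, ⟨?_, hz₀ε⟩, fun z hz => (hεV (hes hz)).1, fun w hw => ⟨_, hsymm w hw, ?_⟩⟩
  · have h1 : ContDiffOn ℂ ω e e.source :=
      (DifferentiableOn.analyticOnNhd (hkd.mono hes) e.open_source).contDiffOn
        e.open_source.uniqueDiffOn
    simpa [contDiffPregroupoid] using h1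
  · have h1 : ContDiffOn ℂ ω e.symm e.target :=
      (DifferentiableOn.analyticOnNhd (fun w hw =>
        (hsymm w hw).differentiableAt.differentiableWithinAt)
        e.open_target).contDiffOn e.open_target.uniqueDiffOn
    simpa [contDiffPregroupoid] using h1
  · exact (hks.hasStrictFDerivAt_equiv (hq0 z₀ hz₀ε)).mem_toOpenPartialHomeomorph_source
  · rw [← hq2, ← mul_pow, inv_mul_cancel₀ (hq0 _ (hes (e.map_target hw))), one_pow]

end Charts

/-! ### The two types of pairs near a point -/

section Local

variable {n : ℕ} {g g' : ℂ → Sph n} {U : Set ℂ} {z₀ : ℂ}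

/-- A pair with `θ = 0` at a point has `θ = 0` in a neighborhood, because `ρ` does not vanish
there. -/
theorem IsEnvelopingPair.exists_ball_thetaCoef_eq_zero (h : IsEnvelopingPair g g' U) (hz₀ : z₀ ∈ U)
    (ht : thetaCoef (canonLift g) (partner g g') z₀ = 0) :
    ∃ ε > 0, Metric.ball z₀ ε ⊆ U ∧
      ∀ z ∈ Metric.ball z₀ ε, thetaCoef (canonLift g) (partner g g') z = 0 := by
  have hA := h.isAdaptedPair
  have hr := (hA.theta_ne_zero_or_rho_ne_zero hz₀).resolve_left (not_not.2 ht)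
  obtain ⟨ε, hε, hεU⟩ := Metric.mem_nhds_iff.1 (Filter.inter_mem (h.left.isOpen.mem_nhds hz₀)
    ((hA.smooth_rhoCoef z₀ hz₀).continuousAt.eventually_ne hr))
  exact ⟨ε, hε, fun z hz => (hεU hz).1,
    fun z hz => (mul_eq_zero.1 (hA.theta_mul_rho (hεU hz).1)).resolve_right (hεU hz).2⟩

/-- Where `θ` does not vanish, it is holomorphic. -/
theorem IsEnvelopingPair.exists_ball_differentiableOn_pairTheta (h : IsEnvelopingPair g g' U)
    (hz₀ : z₀ ∈ U) (ht : thetaCoef (canonLift g) (partner g g') z₀ ≠ 0) :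
    ∃ ε > 0, Metric.ball z₀ ε ⊆ U ∧
      DifferentiableOn ℂ (pairTheta (lift g) (lift g')) (Metric.ball z₀ ε) := by
  have hA := h.isAdaptedPair
  obtain ⟨ε, hε, hεU⟩ := Metric.mem_nhds_iff.1 (Filter.inter_mem (h.left.isOpen.mem_nhds hz₀)
    ((hA.smooth_thetaCoef z₀ hz₀).continuousAt.eventually_ne ht))
  have hsub : Metric.ball z₀ ε ⊆ U := fun z hz => (hεU hz).1
  have h' := h.mono Metric.isOpen_ball hsub
  refine ⟨ε, hε, hsub, DifferentiableOn.congr (f := thetaCoef (canonLift g) (partner g g'))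
    (fun z hz => ?_) fun z hz => (h'.thetaCoef_eq hz).symm⟩
  refine (differentiableAt_of_wzb_eq_zero
    (differentiableAt_of_contDiffAt (hA.smooth_thetaCoef z (hsub hz)))
    (h'.isAdaptedPair.compat_of_rho_eq_zero (fun w hw => ?_) hz).1).differentiableWithinAt
  exact (mul_eq_zero.1 (hA.theta_mul_rho (hsub hw))).resolve_left (hεU hw).2

end Local

end Blaschke

theorem mainTheorem1 {n : ℕ} {M : Type*} [TopologicalSpace M] [ChartedSpace ℂ M]
    [IsManifold 𝓘(ℂ) ω M] (f f' : M → Sph n)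
    (hf : IsConformalImmersion f) (hf' : IsConformalImmersion f')
    (henv : ∃ W : M → Submodule ℝ (Fin (n + 2) → ℝ),
      (∀ p, IsTwoSphere (W p)) ∧ Envelops f W ∧ Envelops f' W)
    (p : M) (hp : f p ≠ f' p) :
    ∃ φ ∈ coords M, p ∈ φ.source ∧
      (IsReflectionOn f f' φ.source ∨
        (IsDarbouxPairOn (f ∘ φ.symm) (f' ∘ φ.symm) φ.target ∧
          ∀ z ∈ φ.target, IsOrientationPreservingAt (f ∘ φ.symm) (f' ∘ φ.symm) z) ∨
        (IsSWillmoreDualPairOn (f ∘ φ.symm) (f' ∘ φ.symm) φ.target ∧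
          ∀ z ∈ φ.target, IsOrientationReversingAt (f ∘ φ.symm) (f' ∘ φ.symm) z)) := by
  obtain ⟨W, hW, hfW, hfW'⟩ := henv
  have hopen : IsOpen {q | f q ≠ f' q} :=
    isOpen_ne_fun hf.smooth.continuous hf'.smooth.continuous
  obtain ⟨φ, hφ, hpφ, hne⟩ : ∃ φ ∈ coords M, p ∈ φ.source ∧ ∀ q ∈ φ.source, f q ≠ f' q := by
    refine ⟨(chartAt ℂ p).restr {q | f q ≠ f' q}, restr_mem_maximalAtlas _
      (IsManifold.chart_mem_maximalAtlas p) hopen, ?_, fun q hq => ?_⟩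
    · simp [hopen.interior_eq, hp]
    · rw [(chartAt ℂ p).restr_source, hopen.interior_eq] at hq
      exact hq.2
  have h := isEnvelopingPair_of_envelops hf hf' hW hfW hfW' hφ hne
  have hz₀ := φ.map_source hpφ
  by_cases ht : thetaCoef (canonLift (f ∘ φ.symm)) (partner (f ∘ φ.symm) (f' ∘ φ.symm)) (φ p) = 0
  · obtain ⟨ε, hε, hεU, ht'⟩ := h.exists_ball_thetaCoef_eq_zero hz₀ ht
    obtain ⟨δ, hδ, hδε, halt⟩ := (h.mono Metric.isOpen_ball hεU).reversing_alternative ht'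
      (Metric.mem_ball_self hε)
    have hδU := hδε.trans hεU
    have hδ' := h.mono Metric.isOpen_ball hδU
    obtain ⟨ψ, hψ, hpψ, hψt, hψs⟩ := exists_coord_restrict hφ hpφ Metric.isOpen_ball hδU
      (Metric.mem_ball_self hδ)
    refine ⟨ψ, hψ, hpψ, ?_⟩
    rw [hψt, hψs]
    rcases halt with hr | hd
    · obtain ⟨X, hX, hR⟩ := hδ'.exists_reflection (convex_ball _ _).isPreconnected
        (fun z hz => ht' z (hδε hz)) hr (Metric.mem_ball_self hδ)
      refine Or.inl ⟨X, hX, fun q hq => ?_⟩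
      have e := hR (ψ q) (hψt ▸ ψ.map_source hq)
      rwa [← hψs, Function.comp_apply, Function.comp_apply, ψ.left_inv hq] at e
    · exact Or.inr (Or.inr (hδ'.isSWillmoreDualPairOn (fun z hz => ht' z (hδε hz)) hd))
  · obtain ⟨ε, hε, hεU, hhol⟩ := h.exists_ball_differentiableOn_pairTheta hz₀ ht
    rw [h.thetaCoef_eq hz₀] at ht
    obtain ⟨e, he, hpe, heV, hk⟩ := exists_coord_of_quadratic_differential Metric.isOpen_ball hhol
      (Metric.mem_ball_self hε) ht
    have hψ := trans_mem_coords hφ he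
    refine ⟨φ.trans e, hψ, ?_, Or.inr (Or.inl ?_)⟩
    · rw [OpenPartialHomeomorph.trans_source]
      exact ⟨hpφ, hpe⟩
    refine (isEnvelopingPair_of_envelops hf hf' hW hfW hfW' hψ fun q hq => hne q ?_).isDarbouxPairOn
      one_ne_zero fun w hw => ?_
    · rw [OpenPartialHomeomorph.trans_source] at hq
      exact hq.1
    -- In the coordinate `e ∘ φ` the holomorphic function `θ` is equal to `1`.
    rw [OpenPartialHomeomorph.trans_target] at hw
    obtain ⟨k', hk', e1⟩ := hk w hw.1
    have hwU := hεU (heV (e.map_target hw.1))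
    have e2 := pairTheta_comp hk'
      (differentiableAt_of_contDiffAt (h.left.smooth_lift _ hwU))
      (differentiableAt_of_contDiffAt (h.right.smooth_lift _ hwU))
    rw [e1] at e2
    exact_mod_cast e2
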